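/- **Setting.** For $1\le p<\infty$ and $n\in\mathbb N$ let $\|x\|_p=(\sum_{i=1}^n|x_i|^p)^{1/p}$ and $\mathbb B_p^n=\{x\in\mathbb R^n:\|x\|_p\le 1\}$. Let $\mathbf U_{n,p}$ be the uniform distribution on $\mathbb B_p^n$ and let $\mathbf C_{n,p}$ be the cone probability measure, that is, $\mathbf C_{n,p}(A)=|\{rx:x\in A,\ r\in[0,1]\}|/|\mathbb B_p^n|$ for measurable $A\subseteq\{x:\|x\|_p=1\}$, where $|\cdot|$ is Lebesgue measure. For a Borel probability measure $\mathbf W$ on $[0,\infty)$ put $$\mathbf P_{n,p,\mathbf W}=\mathbf W(\{0\})\,\mathbf C_{n,p}+H\,\mathbf U_{n,p},\qquad H(x)=h(\|x\|_p),$$ $$h(r)=\frac{1}{\Gamma(1+\frac np)}\,\frac{1}{(1-r^p)^{1+n/p}}\int_0^\infty s^{n/p}e^{-r^ps/(1-r^p)}\,\mathbf W(\mathrm ds).$$ Let $\nu_{n,k}$ be the Haar probability measure on the Grassmannian of $k$-dimensional linear subspaces of $\mathbb R^n$, i.e. the image of the Haar probability measure on $O(n)$ under $T\mapsto TE_0$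 with $E_0=\mathrm{span}\{e_1,\dots,e_k\}$; let $P_E$ be the orthogonal projection onto $E$. For $\lambda\in[0,1]$ put $$\sigma^2(p,\lambda)=\frac{\lambda}{4}\,\frac{\Gamma(\frac1p)\Gamma(\frac5p)}{\Gamma(\frac3p)^2}-\lambda\Big(\frac34+\frac1p\Big)+\frac12 .$$ **Theorem 2.** There is an absolute constant $\alpha\in(0,\infty)$, and for every $p\in[1,\infty)$ and $\lambda\in[0,1]$ with $(p,\lambda)\neq(2,1)$ there is a constant $C_{p,\lambda}\in(0,\infty)$, depending only on $p$ if $p\neq2$ (so $C_{p,\lambda}=C_p$) and only on $\lambda$ if $p=2$, such that the following holds. Let $\mathbf W$ be a probability distribution on $[0,\infty)$, let $(k_n)_{n\ge1}$ be a sequence with $k_n\in\{1,\dots,n\}$ and, as $n\to\infty$, $$k_n\to\infty,\qquad \frac{k_n}{n}\to\lambda,\qquad \frac{k_n}{n^{2/3}}\to\infty .$$ Let $(X_n)_{n\ge 1}$ be a sequence of independent random vectors, $X_n$ with distribution $\mathbf P_{n,p,\mathbf W}$, and let $(E_n)_{n\ge1}$ be a sequence of independent random subspaces, $E_n$ with distribution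 $\nu_{n,k_n}$, such that $X_n$ and $E_n$ are independent for each $n$. Put $$\mathscr X_{n,p}=n^{1/p}\sqrt{\frac{\Gamma(\frac1p)}{p^{2/p}\,\Gamma(\frac3p)}}\;\|P_{E_n}X_n\|_2-\sqrt{k_n},$$ let $F_{n,p}$ be the distribution function of $\mathscr X_{n,p}$ and $\Phi$ the distribution function of the centered Gaussian law with variance $\sigma^2(p,\lambda)$. Then, for every $n\ge2$, $$\sup_{t\in\mathbb R}|F_{n,p}(t)-\Phi(t)|\le C_{p,\lambda}\max\Big\{\frac{\log k_n}{\sqrt{k_n}},\ \frac{n}{k_n^{3/2}},\ \Big|\frac{k_n}{n}-\lambda\Big|\Big\}+\mathbb P\Big(|W|>\frac{\alpha p\,n\log k_n}{k_n}\Big)+2\,\mathbb P\Big(|W|>\sqrt{\frac{n^2\log k_n}{k_n}}\Big),$$ where $W$ is a random variable with distribution $\mathbf W$. -/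

import Mathlib

open MeasureTheory ProbabilityTheory Filter Topology
open scoped NNReal ENNReal

noncomputable section

namespace LpProjection

/-! ### Probability measures on the unit ball of `ℓ_p^n` -/

/-- The `ℓ_p^n`-norm `(∑ |x_i|^p)^{1/p}` of a vector of `ℝⁿ`. -/
def lpNorm {n : ℕ} (p : ℝ) (x : EuclideanSpace ℝ (Fin n)) : ℝ :=
  (∑ i, |x i| ^ p) ^ (1 / p)

/-- The closed unit ball of `ℓ_p^n`. -/
def lpBall (n : ℕ) (p : ℝ) : Set (EuclideanSpace ℝ (Fin n)) :=
  {x | lpNorm p x ≤ 1}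

/-- The unit sphere of `ℓ_p^n`. -/
def lpSphere (n : ℕ) (p : ℝ) : Set (EuclideanSpace ℝ (Fin n)) :=
  {x | lpNorm p x = 1}

/-- The uniform distribution on the unit ball of `ℓ_p^n` (normalized Lebesgue measure). -/
def uniformMeasure (n : ℕ) (p : ℝ) : Measure (EuclideanSpace ℝ (Fin n)) :=
  (volume (lpBall n p))⁻¹ • volume.restrict (lpBall n p)

/-- The cone probability measure, as a measure on `ℝⁿ` carried by the unit sphere of `ℓ_p^n`:
the image of the uniform distribution on the ball under `x ↦ x / ‖x‖_p`.
See `coneMeasure_apply` for the usual formula. -/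
def coneMeasure (n : ℕ) (p : ℝ) : Measure (EuclideanSpace ℝ (Fin n)) :=
  (uniformMeasure n p).map (fun x => (lpNorm p x)⁻¹ • x)

/-- The radial density `h(r)`, with values in `[0, ∞]`: it equals
`(1 / Γ(1 + n/p)) (1 - r^p)^{-(1 + n/p)} ∫ s^{n/p} exp (-r^p s / (1 - r^p)) 𝐖(ds)`. -/
def radialDensity (n : ℕ) (p : ℝ) (W : Measure ℝ≥0) (r : ℝ) : ℝ≥0∞ :=
  ENNReal.ofReal (1 / Real.Gamma (1 + n / p) * (1 / (1 - r ^ p) ^ (1 + n / p))) *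
    ∫⁻ s, ENNReal.ofReal ((s : ℝ) ^ ((n : ℝ) / p) * Real.exp (-(r ^ p * s / (1 - r ^ p)))) ∂W

/-- The measure `𝐏_{n,p,𝐖} = 𝐖({0}) 𝐂_{n,p} + H 𝐔_{n,p}`, with `H(x) = h(‖x‖_p)`. -/
def ballMeasure (n : ℕ) (p : ℝ) (W : Measure ℝ≥0) : Measure (EuclideanSpace ℝ (Fin n)) :=
  W {0} • coneMeasure n p +
    (uniformMeasure n p).withDensity (fun x => radialDensity n p W (lpNorm p x))

theorem measurable_lpNorm {n : ℕ} {p : ℝ} :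
    Measurable (lpNorm p : EuclideanSpace ℝ (Fin n) → ℝ) := by
  unfold lpNorm
  fun_prop

theorem lpNorm_nonneg {n : ℕ} {p : ℝ} (x : EuclideanSpace ℝ (Fin n)) : 0 ≤ lpNorm p x := by
  unfold lpNorm
  positivity

theorem lpNorm_smul {n : ℕ} {p : ℝ} (hp : 0 < p) {r : ℝ} (hr : 0 ≤ r)
    (x : EuclideanSpace ℝ (Fin n)) : lpNorm p (r • x) = r * lpNorm p x := by
  have h1 : ∀ i, |(r • x) i| ^ p = r ^ p * |x i| ^ p := by
    intro i
    rw [PiLp.smul_apply, smul_eq_mul, abs_mul, abs_of_nonneg hr,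
      Real.mul_rpow hr (abs_nonneg _)]
  unfold lpNorm
  simp_rw [h1]
  rw [← Finset.mul_sum, Real.mul_rpow (by positivity) (by positivity), ← Real.rpow_mul hr,
    mul_one_div_cancel hp.ne', Real.rpow_one]

theorem measurable_normalize {n : ℕ} {p : ℝ} :
    Measurable (fun x : EuclideanSpace ℝ (Fin n) => (lpNorm p x)⁻¹ • x) :=
  measurable_lpNorm.inv.smul measurable_id

theorem lpNorm_pos {n : ℕ} {p : ℝ} {x : EuclideanSpace ℝ (Fin n)} (hx : x ≠ 0) :
    0 < lpNorm p x := by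
  obtain ⟨i, hi⟩ : ∃ i, x i ≠ 0 := by
    by_contra! h
    exact hx (by ext i; simpa using h i)
  unfold lpNorm
  refine Real.rpow_pos_of_pos ?_ _
  exact Finset.sum_pos' (fun j _ => by positivity)
    ⟨i, Finset.mem_univ i, Real.rpow_pos_of_pos (abs_pos.mpr hi) p⟩

/-- The usual formula for the cone measure: for a measurable subset `A` of the unit sphere of
`ℓ_p^n`, it is `|{r x : x ∈ A, r ∈ [0,1]}|` divided by the volume of the ball. -/
theorem coneMeasure_apply {n : ℕ} {p : ℝ} (hp : 1 ≤ p)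
    {A : Set (EuclideanSpace ℝ (Fin n))} (hA : MeasurableSet A) (hAs : A ⊆ lpSphere n p) :
    coneMeasure n p A =
      volume {y | ∃ r ∈ Set.Icc (0 : ℝ) 1, ∃ x ∈ A, y = r • x} / volume (lpBall n p) := by
  have hp0 : 0 < p := by linarith
  have hB : MeasurableSet (lpBall n p) := measurableSet_le measurable_lpNorm measurable_const
  rcases Nat.eq_zero_or_pos n with rfl | hn
  · have hA0 : A = ∅ := by
      refine Set.eq_empty_of_forall_notMem fun x hx => ?_
      have h := hAs hx
      have hp1 : p⁻¹ ≠ 0 := by positivity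
      simp [lpSphere, lpNorm, Real.zero_rpow hp1] at h
    simp [hA0]
  · have : Nonempty (Fin n) := ⟨⟨0, hn⟩⟩
    rw [coneMeasure, Measure.map_apply measurable_normalize hA, uniformMeasure,
      Measure.smul_apply, smul_eq_mul, Measure.restrict_apply (measurable_normalize hA),
      ENNReal.div_eq_inv_mul]
    congr 1
    refine measure_congr ?_
    have h0 : ∀ᵐ x : EuclideanSpace ℝ (Fin n), x ≠ 0 := by
      simp [ae_iff]
    filter_upwards [h0] with x hx
    have hpos := lpNorm_pos (p := p) hx
    refine propext ⟨?_, ?_⟩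
    · rintro ⟨h1, h2⟩
      exact ⟨lpNorm p x, ⟨hpos.le, h2⟩, _, h1, by rw [smul_inv_smul₀ hpos.ne']⟩
    · rintro ⟨r, ⟨hr0, hr1⟩, y, hy, rfl⟩
      have hy1 : lpNorm p y = 1 := hAs hy
      have hr : r ≠ 0 := by
        rintro rfl
        simp at hx
      have hN : lpNorm p (r • y) = r := by rw [lpNorm_smul hp0 hr0, hy1, mul_one]
      refine ⟨?_, ?_⟩
      · change (lpNorm p (r • y))⁻¹ • r • y ∈ A
        rwa [hN, inv_smul_smul₀ hr]
      · change lpNorm p (r • y) ≤ 1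
        rwa [hN]

/-! ### The Haar probability measure on the Grassmannian -/

/-- The Grassmannian of `k`-dimensional linear subspaces of `ℝⁿ`. -/
def Gr (n k : ℕ) : Type :=
  {E : Submodule ℝ (EuclideanSpace ℝ (Fin n)) // Module.finrank ℝ E = k}

/-- The orthogonal projection `P_E` onto `E`, as an endomorphism of `ℝⁿ`. -/
def Gr.proj {n k : ℕ} (E : Gr n k) :
    EuclideanSpace ℝ (Fin n) →L[ℝ] EuclideanSpace ℝ (Fin n) :=
  E.1.starProjection

/-- The Borel `σ`-algebra of the Grassmannian, whose topology is the one that makes `E ↦ P_E` an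
embedding into the space of linear endomorphisms of `ℝⁿ`. -/
instance (n k : ℕ) : MeasurableSpace (Gr n k) :=
  MeasurableSpace.comap Gr.proj inferInstance

instance (n : ℕ) : MeasurableSpace (Matrix.orthogonalGroup (Fin n) ℝ) := borel _

instance (n : ℕ) : BorelSpace (Matrix.orthogonalGroup (Fin n) ℝ) := ⟨rfl⟩

instance (n : ℕ) : CompactSpace (Matrix.orthogonalGroup (Fin n) ℝ) := by
  refine isCompact_iff_compactSpace.mp ?_
  have hK : IsCompact (Set.univ.pi fun _ : Fin n => Set.univ.pi fun _ : Fin n =>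
      Metric.closedBall (0 : ℝ) 1) :=
    isCompact_univ_pi fun _ => isCompact_univ_pi fun _ => isCompact_closedBall _ _
  refine IsCompact.of_isClosed_subset hK ?_ ?_
  · have : ((Matrix.orthogonalGroup (Fin n) ℝ : Submonoid _) : Set (Matrix (Fin n) (Fin n) ℝ)) =
        {A | A * star A = 1} := by
      ext A
      exact Matrix.mem_orthogonalGroup_iff (Fin n) ℝ
    change IsClosed ((Matrix.orthogonalGroup (Fin n) ℝ : Submonoid _) :
      Set (Matrix (Fin n) (Fin n) ℝ))
    rw [this]
    exact isClosed_eq (by fun_prop) continuous_const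
  · intro A hA i _ j _
    simpa using entry_norm_bound_of_unitary hA i j

/-- The Haar probability measure on the orthogonal group `O(n)`. -/
def haarOrthogonal (n : ℕ) : Measure (Matrix.orthogonalGroup (Fin n) ℝ) :=
  Measure.haarMeasure ⊤

instance (n : ℕ) : IsProbabilityMeasure (haarOrthogonal n) :=
  ⟨by simpa [haarOrthogonal] using Measure.haarMeasure_self (K₀ := (⊤ : TopologicalSpace.PositiveCompacts
      (Matrix.orthogonalGroup (Fin n) ℝ)))⟩

/-- The linear isometry of `ℝⁿ` given by an orthogonal matrix. -/
def isometryOf {n : ℕ} (T : Matrix.orthogonalGroup (Fin n) ℝ) :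
    EuclideanSpace ℝ (Fin n) ≃ₗᵢ[ℝ] EuclideanSpace ℝ (Fin n) :=
  Unitary.linearIsometryEquiv
    ⟨Matrix.toEuclideanCLM (n := Fin n) (𝕜 := ℝ) T.1, Unitary.map_mem _ T.2⟩

theorem isometryOf_apply {n : ℕ} (T : Matrix.orthogonalGroup (Fin n) ℝ)
    (x : EuclideanSpace ℝ (Fin n)) :
    isometryOf T x = Matrix.toEuclideanCLM (n := Fin n) (𝕜 := ℝ) T.1 x := rfl

theorem isometryOf_symm_apply {n : ℕ} (T : Matrix.orthogonalGroup (Fin n) ℝ)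
    (x : EuclideanSpace ℝ (Fin n)) :
    (isometryOf T).symm x = Matrix.toEuclideanCLM (n := Fin n) (𝕜 := ℝ) (star T.1) x := by
  rw [map_star]
  rfl

/-- The subspace `E₀` spanned by the first `k` vectors of the canonical basis of `ℝⁿ`. -/
def coordSubspace {n k : ℕ} (hk : k ≤ n) : Gr n k :=
  ⟨Submodule.span ℝ (Set.range fun i : Fin k =>
      EuclideanSpace.basisFun (Fin n) ℝ (Fin.castLE hk i)), by
    have h : LinearIndependent ℝ fun i : Fin k =>
        EuclideanSpace.basisFun (Fin n) ℝ (Fin.castLE hk i) :=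
      (EuclideanSpace.basisFun (Fin n) ℝ).orthonormal.linearIndependent.comp _
        (Fin.castLE_injective hk)
    rw [finrank_span_eq_card h, Fintype.card_fin]⟩

/-- The image `T E` of a subspace under an orthogonal transformation. -/
def rotate {n k : ℕ} (T : Matrix.orthogonalGroup (Fin n) ℝ) (E : Gr n k) : Gr n k :=
  ⟨E.1.map ((isometryOf T).toLinearEquiv : _ →ₗ[ℝ] _), by
    rw [LinearEquiv.finrank_map_eq, E.2]⟩

/-- The Haar probability measure `ν_{n,k}` on the Grassmannian: the image of the Haar probability
measure on `O(n)` under `T ↦ T E₀`. -/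
def haarGr {n k : ℕ} (hk : k ≤ n) : Measure (Gr n k) :=
  (haarOrthogonal n).map fun T => rotate T (coordSubspace hk)

theorem measurable_rotate {n k : ℕ} (E : Gr n k) :
    Measurable fun T : Matrix.orthogonalGroup (Fin n) ℝ => rotate T E := by
  rw [measurable_comap_iff]
  have h : Gr.proj ∘ (fun T : Matrix.orthogonalGroup (Fin n) ℝ => rotate T E) = fun T =>
      Matrix.toEuclideanCLM (n := Fin n) (𝕜 := ℝ) T.1 ∘L Gr.proj E ∘L
        Matrix.toEuclideanCLM (n := Fin n) (𝕜 := ℝ) (star T.1) := by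
    funext T
    ext1 x
    have := Submodule.starProjection_map_apply (isometryOf T) E.1 x
    simp only [ContinuousLinearMap.comp_apply, ← isometryOf_symm_apply, ← isometryOf_apply]
    exact this
  rw [h]
  have hc : Continuous fun A : Matrix (Fin n) (Fin n) ℝ =>
      Matrix.toEuclideanCLM (n := Fin n) (𝕜 := ℝ) A :=
    LinearMap.continuous_of_finiteDimensional
      (Matrix.toEuclideanCLM (n := Fin n) (𝕜 := ℝ)).toAlgEquiv.toLinearMap
  refine Continuous.measurable ?_
  exact (hc.comp continuous_subtype_val).clm_comp
    (continuous_const.clm_comp (hc.comp (continuous_star.comp continuous_subtype_val)))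

instance {n k : ℕ} (hk : k ≤ n) : IsProbabilityMeasure (haarGr hk) :=
  Measure.isProbabilityMeasure_map (measurable_rotate _).aemeasurable

/-! ### The normalized length of the projection and the limiting variance -/

/-- `n^{1/p} √(Γ(1/p) / (p^{2/p} Γ(3/p))) ‖P_E x‖₂ - √k`, for `x ∈ ℝⁿ` and `E` a `k`-dimensional
subspace of `ℝⁿ`. -/
def normalizedLength {n k : ℕ} (p : ℝ) (x : EuclideanSpace ℝ (Fin n)) (E : Gr n k) : ℝ :=
  (n : ℝ) ^ (1 / p) * √(Real.Gamma (1 / p) / (p ^ (2 / p) * Real.Gamma (3 / p))) * ‖E.proj x‖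
    - √(k : ℝ)

/-- The limiting variance `σ²(p, l)`. -/
def limitVariance (p l : ℝ) : ℝ :=
  l / 4 * (Real.Gamma (1 / p) * Real.Gamma (5 / p) / Real.Gamma (3 / p) ^ 2)
    - l * (3 / 4 + 1 / p) + 1 / 2

end LpProjection

end

noncomputable section

namespace LpProjection

/-! ### Gaussian smoothing and characteristic functions -/

/-! The proof replaces the random length by an explicit function of averages of independent
variables, linearizes it, and applies a Berry–Esseen bound to the linear part.

Let `G` have independent coordinates with density proportional to `exp (-|t| ^ p)`, let `w` have law
`W`, let `g` be standard Gaussian, all independent. Polar coordinates for the `ℓ_p`-norm show that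
`G / (‖G‖_p ^ p + w) ^ (1/p)` has law `𝐏_{n,p,𝐖}` (`map_pGauss_eq_ballMeasure`): the atom of `W` at
0 gives the cone measure, and the values `w > 0` give the density `h`. Invariance of Haar measure
and of the Gaussian law shows that `‖P_E x‖` is distributed as `‖x‖` times the square root of
`∑_{i<k} g_i² / ∑ g_i²` (`lintegral_norm_proj_haarGr`).

Hence the normalized length has the law of `√k (√x₁ (x₂ + p w / n) ^ (-1/p) √(x₃ / x₄) - 1)`, where
`x₁, x₂, x₄` are averages over `n` coordinates and `x₃` is an average over `k` coordinates, all of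
mean 1 (`reprLength_eq`). Outside an event of probability `O(log k / √k)` each average is within
`ε`, a multiple of `√(log k / k)`, of its mean. If moreover `w ≤ p n log k / k`, then `p w / n` is
`O(ε²)`. The second-order remainder is then `√k · O(ε²) = O(log k / √k)`, which has the size of the
claimed rate (`abs_linearization_le`, `exists_tail_bound`).

The linear part is a sum of `2n` independent centred variables whose variance is exactly `σ²(p,
k/n)`. It is compared with a normal law by a Berry–Esseen bound with a logarithmic loss
(`berry_esseen`), which is harmless because the rate already contains the logarithm. Replacing
`σ²(p, k/n)` by `σ²(p, l)` costs a multiple of `|k/n - l|`, since the variance is affine in its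
second argument. The variance stays away from 0 on all of `[0, 1]` when `p ≠ 2`; for `p = 2` it
equals `(1 - l)/2`, and the constant must depend on `l`. -/

theorem gaussianPDFReal_eq_integral_charFun {v : ℝ≥0} (hv : v ≠ 0) (w u : ℝ) :
    (gaussianPDFReal w v u : ℂ) = ((√(2 * Real.pi * v))⁻¹ : ℝ) *
      ∫ τ, Complex.exp (-(τ * w * Complex.I)) * Complex.exp (τ * u * Complex.I)
        ∂(gaussianReal 0 v⁻¹) := by
  have h := charFun_gaussianReal (μ := 0) (v := v⁻¹) (u - w)
  rw [charFun_apply_real] at h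
  have h2 : ∀ τ : ℝ, Complex.exp (-(τ * w * Complex.I)) * Complex.exp (τ * u * Complex.I)
      = Complex.exp ((u - w : ℝ) * τ * Complex.I) := by
    intro τ
    rw [← Complex.exp_add]
    congr 1
    push_cast
    ring
  simp_rw [h2, h, gaussianPDFReal]
  push_cast
  congr 2
  have : (v : ℂ) ≠ 0 := by exact_mod_cast hv
  field_simp
  ring

/-- The primitive `exp (iτu) / (iτ)` gives a bound free of the length of the interval, so that its
left end can later go to `-∞`. -/
theorem norm_setIntegral_exp_le {y x : ℝ} (hyx : y ≤ x) {τ : ℝ} (hτ : τ ≠ 0) :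
    ‖∫ u in Set.Ioc y x, Complex.exp (τ * u * Complex.I)‖ ≤ 2 / |τ| := by
  have hc : (τ * Complex.I : ℂ) ≠ 0 := by simp [hτ]
  have h1 : ∀ u : ℝ, Complex.exp (τ * u * Complex.I) = Complex.exp ((τ * Complex.I) * u) := by
    intro u; ring_nf
  simp_rw [h1]
  rw [← intervalIntegral.integral_of_le hyx, integral_exp_mul_complex hc, norm_div]
  have h2 : ∀ u : ℝ, ‖Complex.exp ((τ * Complex.I) * u)‖ = 1 := by
    intro u
    rw [Complex.norm_exp]
    simp
  have h3 : ‖(τ * Complex.I : ℂ)‖ = |τ| := by simp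
  rw [h3]
  gcongr
  refine (norm_sub_le _ _).trans ?_
  rw [h2, h2]
  norm_num

theorem measurable_setIntegral_exp (y x : ℝ) :
    Measurable fun τ : ℝ => ∫ u in Set.Ioc y x, Complex.exp (τ * u * Complex.I) := by
  have h : Continuous fun q : ℝ × ℝ => Complex.exp (q.1 * q.2 * Complex.I) := by fun_prop
  exact (StronglyMeasurable.integral_prod_right
    (f := fun τ u : ℝ => Complex.exp (τ * u * Complex.I)) h.stronglyMeasurable).measurable

theorem norm_setIntegral_exp_le_volume (y x τ : ℝ) :
    ‖∫ u in Set.Ioc y x, Complex.exp (τ * u * Complex.I)‖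
      ≤ (volume : Measure ℝ).real (Set.Ioc y x) := by
  refine (norm_setIntegral_le_of_norm_le_const (C := 1) (by simp) ?_).trans (by simp)
  intro u _
  have := Complex.norm_exp_ofReal_mul_I (τ * u)
  push_cast at this
  exact this.le

/-- Fourier inversion without an inversion theorem: a Gaussian density is itself the characteristic
function of a Gaussian law of inverse variance, so two applications of Fubini suffice. On a bounded
interval all integrands are bounded and all measures finite. -/
theorem conv_gaussianReal_Ioc (μ : Measure ℝ) [IsProbabilityMeasure μ] {v : ℝ≥0} (hv : v ≠ 0)
    (y x : ℝ) :
    ((μ ∗ gaussianReal 0 v).real (Set.Ioc y x) : ℂ) = ((√(2 * Real.pi * v))⁻¹ : ℝ) *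
      ∫ τ, (∫ u in Set.Ioc y x, Complex.exp (τ * u * Complex.I)) * charFun μ (-τ)
        ∂(gaussianReal 0 v⁻¹) := by
  have h1 : (μ ∗ gaussianReal 0 v).real (Set.Ioc y x)
      = ∫ w, (gaussianReal w v).real (Set.Ioc y x) ∂μ := by
    rw [measureReal_def, Measure.conv, Measure.map_apply (by fun_prop) measurableSet_Ioc,
      Measure.prod_apply (measurable_add measurableSet_Ioc), integral_eq_lintegral_of_nonneg_ae]
    · congr 1
      refine lintegral_congr fun w => ?_
      rw [measureReal_def, ENNReal.ofReal_toReal (measure_ne_top _ _)]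
      have : gaussianReal w v = (gaussianReal 0 v).map (w + ·) := by
        rw [gaussianReal_map_const_add, zero_add]
      rw [this, Measure.map_apply (by fun_prop) measurableSet_Ioc]
      rfl
    · exact Eventually.of_forall fun w => measureReal_nonneg
    · have hm : Measurable fun w => (gaussianReal 0 v) ((fun z => (w, z)) ⁻¹'
          ((fun p : ℝ × ℝ => p.1 + p.2) ⁻¹' Set.Ioc y x)) :=
        measurable_measure_prodMk_left (measurable_add measurableSet_Ioc)
      have he : (fun w => (gaussianReal w v).real (Set.Ioc y x)) = fun w =>
          ((gaussianReal 0 v) ((fun z => (w, z)) ⁻¹'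
          ((fun p : ℝ × ℝ => p.1 + p.2) ⁻¹' Set.Ioc y x))).toReal := by
        funext w
        have : gaussianReal w v = (gaussianReal 0 v).map (w + ·) := by
          rw [gaussianReal_map_const_add, zero_add]
        rw [measureReal_def, this, Measure.map_apply (by fun_prop) measurableSet_Ioc]
        rfl
      rw [he]
      exact hm.ennreal_toReal.aestronglyMeasurable
  have h2 : ∀ w, (gaussianReal w v).real (Set.Ioc y x)
      = ∫ u in Set.Ioc y x, gaussianPDFReal w v u := by
    intro w
    rw [measureReal_def, gaussianReal_apply_eq_integral _ hv, ENNReal.toReal_ofReal]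
    exact integral_nonneg fun _ => gaussianPDFReal_nonneg _ _ _
  set γ := gaussianReal 0 v⁻¹ with hγ
  have hb : ∀ a : ℝ, ‖Complex.exp (a * Complex.I)‖ = 1 := Complex.norm_exp_ofReal_mul_I
  have h3 : ∀ w, ((gaussianReal w v).real (Set.Ioc y x) : ℂ) = ((√(2 * Real.pi * v))⁻¹ : ℝ) *
      ∫ τ, Complex.exp (-(τ * w * Complex.I)) *
        (∫ u in Set.Ioc y x, Complex.exp (τ * u * Complex.I)) ∂γ := by
    intro w
    rw [h2, ← integral_complex_ofReal]
    simp_rw [gaussianPDFReal_eq_integral_charFun hv, ← integral_const_mul]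
    rw [integral_integral_swap]
    refine Integrable.of_bound (C := ‖(((√(2 * Real.pi * v))⁻¹ : ℝ) : ℂ)‖) ?_ ?_
    · refine Continuous.aestronglyMeasurable ?_
      simp only [Function.uncurry_def]
      fun_prop
    · refine Eventually.of_forall fun q => ?_
      have e1 : ‖Complex.exp (-(q.2 * w * Complex.I))‖ = 1 := by
        have := hb (-(q.2 * w)); push_cast at this; rwa [neg_mul] at this
      have e2 : ‖Complex.exp (q.2 * q.1 * Complex.I)‖ = 1 := by
        have := hb (q.2 * q.1); push_cast at this; exact this
      simp only [Function.uncurry_def, norm_mul, e1, e2]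
      simp
  rw [h1, ← integral_complex_ofReal]
  simp_rw [h3]
  rw [integral_const_mul]
  congr 1
  rw [integral_integral_swap]
  · refine integral_congr_ae (Eventually.of_forall fun τ => ?_)
    simp only
    rw [integral_mul_const, charFun_apply_real, mul_comm]
    congr 1
    refine integral_congr_ae (Eventually.of_forall fun w => ?_)
    simp only
    push_cast
    ring_nf
  · refine Integrable.of_bound (C := (volume : Measure ℝ).real (Set.Ioc y x)) ?_ ?_
    · simp only [Function.uncurry_def]
      refine AEStronglyMeasurable.mul ?_ ?_
      · exact Continuous.aestronglyMeasurable (by fun_prop)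
      · exact ((measurable_setIntegral_exp y x).comp measurable_snd).aestronglyMeasurable
    · refine Eventually.of_forall fun q => ?_
      have e1 : ‖Complex.exp (-(q.2 * q.1 * Complex.I))‖ = 1 := by
        have := hb (-(q.2 * q.1)); push_cast at this; rwa [neg_mul] at this
      simp only [Function.uncurry_def, norm_mul, e1, one_mul]
      exact norm_setIntegral_exp_le_volume y x _

/-- The inversion formula bounds the difference on `(y, x]` uniformly in `y`; then `y → -∞`. -/
theorem abs_conv_gaussianReal_Iic_sub_le (μ ν : Measure ℝ) [IsProbabilityMeasure μ]
    [IsProbabilityMeasure ν] {v : ℝ≥0} (hv : v ≠ 0) (x : ℝ)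
    (hint : Integrable (fun τ => ‖charFun μ τ - charFun ν τ‖ / |τ|) (gaussianReal 0 v⁻¹)) :
    |(μ ∗ gaussianReal 0 v).real (Set.Iic x) - (ν ∗ gaussianReal 0 v).real (Set.Iic x)| ≤
      (√(2 * Real.pi * v))⁻¹ * (2 *
        ∫ τ, ‖charFun μ τ - charFun ν τ‖ / |τ| ∂(gaussianReal 0 v⁻¹)) := by
  set B := (√(2 * Real.pi * v))⁻¹ * (2 *
        ∫ τ, ‖charFun μ τ - charFun ν τ‖ / |τ| ∂(gaussianReal 0 v⁻¹)) with hB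
  have hvi : v⁻¹ ≠ 0 := inv_ne_zero hv
  have key : ∀ y ≤ x, |(μ ∗ gaussianReal 0 v).real (Set.Ioc y x)
      - (ν ∗ gaussianReal 0 v).real (Set.Ioc y x)| ≤ B := by
    intro y hyx
    rw [← Real.norm_eq_abs, ← Complex.norm_real]
    push_cast
    rw [conv_gaussianReal_Ioc μ hv, conv_gaussianReal_Ioc ν hv, ← mul_sub, norm_mul,
      Complex.norm_real, Real.norm_of_nonneg (by positivity), hB]
    gcongr
    have hI : ∀ (ρ : Measure ℝ) [IsProbabilityMeasure ρ], Integrable (fun τ : ℝ =>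
        (∫ u in Set.Ioc y x, Complex.exp (τ * u * Complex.I)) * charFun ρ (-τ))
        (gaussianReal 0 v⁻¹) := by
      intro ρ _
      refine Integrable.of_bound (C := (volume : Measure ℝ).real (Set.Ioc y x)) ?_ ?_
      · exact ((measurable_setIntegral_exp y x).mul (measurable_charFun.comp measurable_neg)).aestronglyMeasurable
      · refine Eventually.of_forall fun τ => ?_
        rw [norm_mul]
        calc _ ≤ (volume : Measure ℝ).real (Set.Ioc y x) * 1 :=
              mul_le_mul (norm_setIntegral_exp_le_volume y x τ) (norm_charFun_le_one _) (norm_nonneg _) (by positivity)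
          _ = _ := mul_one _
    rw [← integral_sub (hI μ) (hI ν), ← integral_const_mul]
    refine norm_integral_le_of_norm_le (hint.const_mul 2) ?_
    -- The bound `2 / |τ|` is false for Lean's division at `τ = 0`; the Gaussian law does not charge
    -- this point.
    have hna : NullSingletonClass (gaussianReal 0 v⁻¹) := nullSingletonClass_gaussianReal hvi
    have h0 : ∀ᵐ τ ∂(gaussianReal 0 v⁻¹), τ ≠ 0 := by
      simp [ae_iff]
    filter_upwards [h0] with τ hτ
    rw [← mul_sub, norm_mul, charFun_neg, charFun_neg, ← map_sub, RCLike.norm_conj]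
    calc _ ≤ 2 / |τ| * ‖charFun μ τ - charFun ν τ‖ := by
          gcongr
          exact norm_setIntegral_exp_le hyx hτ
      _ = _ := by ring
  have hlim : ∀ (ρ : Measure ℝ) [IsProbabilityMeasure ρ],
      Tendsto (fun y => ρ.real (Set.Ioc y x)) atBot (𝓝 (ρ.real (Set.Iic x))) := by
    intro ρ _
    have h1 : Tendsto (fun y => cdf ρ x - cdf ρ y) atBot (𝓝 (cdf ρ x - 0)) :=
      tendsto_const_nhds.sub (tendsto_cdf_atBot ρ)
    rw [sub_zero, cdf_eq_real] at h1
    refine h1.congr' ?_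
    filter_upwards [eventually_le_atBot x] with y hy
    rw [cdf_eq_real, ← measureReal_sdiff (Set.Iic_subset_Iic.2 hy) measurableSet_Iic]
    congr 1
    ext z
    simp [and_comm]
  refine le_of_tendsto ((hlim _).sub (hlim _)).abs ?_
  filter_upwards [eventually_le_atBot x] with y hy using key y hy

/-! ### Gaussian tails and increments -/

/-- Chernoff's bound with the optimal parameter `a / v`. -/
theorem gaussianReal_real_Ici_le {v : ℝ≥0} (hv : v ≠ 0) {a : ℝ} (ha : 0 ≤ a) :
    (gaussianReal 0 v).real (Set.Ici a) ≤ Real.exp (-a ^ 2 / (2 * v)) := by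
  have hv' : (0 : ℝ) < v := by positivity
  have h := measure_ge_le_exp_mul_mgf (μ := gaussianReal 0 v) (X := id) a
    (t := a / v) (by positivity) (by simpa using integrable_exp_mul_gaussianReal (a / v))
  rw [mgf_id_gaussianReal, ← Real.exp_add] at h
  refine (show (gaussianReal 0 v).real (Set.Ici a) ≤ _ from h).trans (le_of_eq ?_)
  congr 1
  field_simp
  ring

theorem gaussianReal_real_Iic_neg_le {v : ℝ≥0} (hv : v ≠ 0) {a : ℝ} (ha : 0 ≤ a) :
    (gaussianReal 0 v).real (Set.Iic (-a)) ≤ Real.exp (-a ^ 2 / (2 * v)) := by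
  have h := gaussianReal_map_neg (μ := 0) (v := v)
  rw [neg_zero] at h
  rw [← h, map_measureReal_apply (by fun_prop) measurableSet_Iic]
  convert gaussianReal_real_Ici_le hv ha using 2
  ext z
  simp

theorem gaussianPDFReal_le (v : ℝ≥0) (m x : ℝ) :
    gaussianPDFReal m v x ≤ (√(2 * Real.pi * v))⁻¹ := by
  rw [gaussianPDFReal]
  refine mul_le_of_le_one_right (by positivity) ?_
  rw [Real.exp_le_one_iff]
  have : 0 ≤ (x - m) ^ 2 / (2 * v) := by positivity
  linarith [neg_div (2 * (v : ℝ)) ((x - m) ^ 2)]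

/-- The density is at most `1 / √(2πv)`, so the distribution function is Lipschitz with this
constant. -/
theorem cdf_gaussianReal_add_le {v : ℝ≥0} (hv : v ≠ 0) (x : ℝ) {h : ℝ} (hh : 0 ≤ h) :
    cdf (gaussianReal 0 v) (x + h) ≤ cdf (gaussianReal 0 v) x + (√(2 * Real.pi * v))⁻¹ * h := by
  rw [cdf_eq_real, cdf_eq_real]
  have h1 : Set.Iic (x + h) ⊆ Set.Iic x ∪ Set.Ioc x (x + h) := by
    intro z hz
    by_cases h : z ≤ x
    · exact Or.inl h
    · exact Or.inr ⟨not_le.1 h, hz⟩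
  refine (measureReal_mono h1).trans ((measureReal_union_le _ _).trans ?_)
  gcongr
  rw [measureReal_def, gaussianReal_apply_eq_integral _ hv, ENNReal.toReal_ofReal
    (integral_nonneg fun _ => gaussianPDFReal_nonneg _ _ _)]
  have h2 : ∫ z in Set.Ioc x (x + h), gaussianPDFReal 0 v z ≤
      ∫ _ in Set.Ioc x (x + h), (√(2 * Real.pi * v))⁻¹ := by
    refine setIntegral_mono (integrable_gaussianPDFReal 0 v).integrableOn
      (integrableOn_const measure_Ioc_lt_top.ne) ?_
    intro z
    exact gaussianPDFReal_le v 0 z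
  refine h2.trans (le_of_eq ?_)
  simp [hh, mul_comm]

theorem real_Iic_le_conv (μ : Measure ℝ) [IsProbabilityMeasure μ] (ρ : Measure ℝ)
    [IsProbabilityMeasure ρ] (x δ : ℝ) :
    μ.real (Set.Iic x) ≤ (μ ∗ ρ).real (Set.Iic (x + δ)) + ρ.real (Set.Ici δ) := by
  have h1 : μ.real (Set.Iic x) = (μ.prod ρ).real (Set.Iic x ×ˢ Set.univ) := by simp
  have h2 : ρ.real (Set.Ici δ) = (μ.prod ρ).real (Set.univ ×ˢ Set.Ici δ) := by simp
  rw [h1, h2, Measure.conv, map_measureReal_apply (by fun_prop) measurableSet_Iic]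
  refine (measureReal_mono ?_).trans (measureReal_union_le _ _)
  rintro ⟨a, b⟩ ⟨ha, -⟩
  by_cases hb : δ ≤ b
  · exact Or.inr ⟨trivial, hb⟩
  · left
    simp only [Set.mem_Iic, Set.mem_preimage] at ha ⊢
    linarith

theorem conv_real_Iic_le (μ : Measure ℝ) [IsProbabilityMeasure μ] (ρ : Measure ℝ)
    [IsProbabilityMeasure ρ] (x δ : ℝ) :
    (μ ∗ ρ).real (Set.Iic x) ≤ μ.real (Set.Iic (x + δ)) + ρ.real (Set.Iic (-δ)) := by
  have h1 : μ.real (Set.Iic (x + δ)) = (μ.prod ρ).real (Set.Iic (x + δ) ×ˢ Set.univ) := by simp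
  have h2 : ρ.real (Set.Iic (-δ)) = (μ.prod ρ).real (Set.univ ×ˢ Set.Iic (-δ)) := by simp
  rw [h1, h2, Measure.conv, map_measureReal_apply (by fun_prop) measurableSet_Iic]
  refine (measureReal_mono ?_).trans (measureReal_union_le _ _)
  rintro ⟨a, b⟩ hab
  simp only [Set.mem_Iic, Set.mem_preimage] at hab
  by_cases hb : b ≤ -δ
  · exact Or.inr ⟨trivial, hb⟩
  · refine Or.inl ⟨?_, trivial⟩
    simp only [Set.mem_Iic]
    linarith

/-- Removal of the smoothing. Adding noise moves a point by more than `δ` only with the probability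
of a Gaussian tail. This is used once for `μ` and once for the normal law, which gives the factor 2;
the two shifts by `δ` are paid for by the Lipschitz bound of the normal distribution function. -/
theorem abs_cdf_sub_le_of_conv (μ : Measure ℝ) [IsProbabilityMeasure μ] {v w : ℝ≥0} (hv : v ≠ 0)
    (hw : w ≠ 0) {η δ : ℝ} (hδ : 0 ≤ δ)
    (h : ∀ x, |(μ ∗ gaussianReal 0 w).real (Set.Iic x)
      - (gaussianReal 0 v ∗ gaussianReal 0 w).real (Set.Iic x)| ≤ η) (x : ℝ) :
    |cdf μ x - cdf (gaussianReal 0 v) x| ≤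
      η + 2 * Real.exp (-δ ^ 2 / (2 * w)) + (√(2 * Real.pi * v))⁻¹ * (2 * δ) := by
  have t1 := gaussianReal_real_Ici_le hw hδ
  have t2 := gaussianReal_real_Iic_neg_le hw hδ
  rw [abs_le]
  constructor
  · have a1 := conv_real_Iic_le μ (gaussianReal 0 w) (x - δ) δ
    have a2 := real_Iic_le_conv (gaussianReal 0 v) (gaussianReal 0 w) (x - 2 * δ) δ
    have a3 := (abs_le.1 (h (x - δ))).1
    have a4 := cdf_gaussianReal_add_le hv (x - 2 * δ) (h := 2 * δ) (by positivity)
    rw [show x - 2 * δ + δ = x - δ by ring] at a2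
    rw [sub_add_cancel, cdf_eq_real, cdf_eq_real] at a4
    rw [sub_add_cancel] at a1
    rw [cdf_eq_real, cdf_eq_real]
    linarith
  · have a1 := real_Iic_le_conv μ (gaussianReal 0 w) x δ
    have a2 := conv_real_Iic_le (gaussianReal 0 v) (gaussianReal 0 w) (x + δ) δ
    have a3 := (abs_le.1 (h (x + δ))).2
    have a4 := cdf_gaussianReal_add_le hv x (h := 2 * δ) (by positivity)
    rw [show x + δ + δ = x + 2 * δ by ring] at a2
    rw [cdf_eq_real, cdf_eq_real] at a4
    rw [cdf_eq_real, cdf_eq_real]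
    linarith

/-! ### Estimates for characteristic functions -/

/-- For `|x| ≤ 1` this is the exponential series. For `|x| > 1` every term of `1 + 1 + |x| + x²/2`
is at most its coefficient times `|x|³`, for a total of `7/2 ≤ 4`. -/
theorem norm_exp_mul_I_sub_taylor_le (x : ℝ) :
    ‖Complex.exp (x * Complex.I) - (1 + x * Complex.I - x ^ 2 / 2)‖ ≤ 4 * |x| ^ 3 := by
  have hn : ‖(x * Complex.I : ℂ)‖ = |x| := by simp
  rcases le_or_gt |x| 1 with h | h
  · have h1 := Complex.exp_bound (x := x * Complex.I) (by rw [hn]; exact h) (n := 3) (by norm_num)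
    rw [hn] at h1
    have h2 : ∑ m ∈ Finset.range 3, (x * Complex.I : ℂ) ^ m / (m.factorial : ℂ)
        = 1 + x * Complex.I - x ^ 2 / 2 := by
      simp [Finset.sum_range_succ, mul_pow, Nat.factorial]
      ring
    rw [h2] at h1
    refine h1.trans ?_
    rw [mul_comm]
    gcongr
    norm_num [Nat.factorial]
  · have e1 : ‖Complex.exp (x * Complex.I)‖ = 1 := Complex.norm_exp_ofReal_mul_I x
    have e2 : ‖(x ^ 2 / 2 : ℂ)‖ = |x| ^ 2 / 2 := by simp
    have e3 : ‖(1 + x * Complex.I - x ^ 2 / 2 : ℂ)‖ ≤ 1 + |x| + |x| ^ 2 / 2 := by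
      refine (norm_sub_le _ _).trans ?_
      rw [e2]
      gcongr
      refine (norm_add_le _ _).trans ?_
      rw [hn]
      simp
    refine (norm_sub_le _ _).trans ?_
    rw [e1]
    have h2 : |x| ≤ |x| ^ 3 := le_self_pow₀ h.le (by norm_num)
    have h3 : |x| ^ 2 ≤ |x| ^ 3 := pow_le_pow_right₀ h.le (by norm_num)
    linarith

theorem integrable_pow_of_abs_pow_three {ν : Measure ℝ} [IsFiniteMeasure ν]
    (h3 : Integrable (fun x => |x| ^ 3) ν) {j : ℕ} (hj : j ≤ 3) :
    Integrable (fun x : ℝ => x ^ j) ν := by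
  refine ((integrable_const (1 : ℝ)).add h3).mono' (by fun_prop) (Eventually.of_forall fun x => ?_)
  rw [norm_pow, Real.norm_eq_abs]
  simp only [Pi.add_apply]
  rcases le_total |x| 1 with h | h
  · have := pow_le_one₀ (n := j) (abs_nonneg x) h
    have : 0 ≤ |x| ^ 3 := by positivity
    linarith
  · have := pow_le_pow_right₀ h hj
    linarith

theorem norm_charFun_sub_taylor_le {ν : Measure ℝ} [IsProbabilityMeasure ν]
    (h3 : Integrable (fun x => |x| ^ 3) ν) (h1 : ∫ x, x ∂ν = 0) (t : ℝ) :
    ‖charFun ν t - (1 - (∫ x, x ^ 2 ∂ν) * t ^ 2 / 2 : ℝ)‖ ≤ 4 * (∫ x, |x| ^ 3 ∂ν) * |t| ^ 3 := by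
  have i1 : Integrable (fun x : ℝ => x) ν := by
    simpa using integrable_pow_of_abs_pow_three h3 (j := 1) (by norm_num)
  have i2 : Integrable (fun x : ℝ => x ^ 2) ν :=
    integrable_pow_of_abs_pow_three h3 (by norm_num)
  have ie : Integrable (fun x : ℝ => Complex.exp (t * x * Complex.I)) ν := by
    refine Integrable.of_bound (C := 1) (Continuous.aestronglyMeasurable (by fun_prop)) ?_
    refine Eventually.of_forall fun x => ?_
    have := Complex.norm_exp_ofReal_mul_I (t * x)
    push_cast at this
    exact this.le
  have hq : Integrable (fun x : ℝ =>
      (1 + (t * x : ℝ) * Complex.I - ((t * x : ℝ) : ℂ) ^ 2 / 2)) ν := by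
    refine (((integrable_const _).add ?_).sub ?_)
    · exact ((i1.const_mul t).ofReal (𝕜 := ℂ)).mul_const _
    · have := ((i2.const_mul (t ^ 2)).ofReal (𝕜 := ℂ)).div_const 2
      refine this.congr (Eventually.of_forall fun x => ?_)
      simp [mul_pow]
  have he : ((1 - (∫ x, x ^ 2 ∂ν) * t ^ 2 / 2 : ℝ) : ℂ) =
      ∫ x : ℝ, (1 + (t * x : ℝ) * Complex.I - ((t * x : ℝ) : ℂ) ^ 2 / 2) ∂ν := by
    have i1' : Integrable (fun x : ℝ => ((t * x : ℝ) : ℂ) * Complex.I) ν := ((i1.const_mul t).ofReal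
      (𝕜 := ℂ)).mul_const Complex.I
    have i2' : Integrable (fun x : ℝ => ((t * x : ℝ) : ℂ) ^ 2 / 2) ν := by
      have := ((i2.const_mul (t ^ 2)).ofReal (𝕜 := ℂ)).div_const 2
      refine this.congr (Eventually.of_forall fun x => ?_)
      simp [mul_pow]
    have ea : ∫ x : ℝ, ((t * x : ℝ) : ℂ) * Complex.I ∂ν = 0 := by
      rw [integral_mul_const, integral_complex_ofReal, integral_const_mul, h1]
      simp
    have eb : ∫ x : ℝ, ((t * x : ℝ) : ℂ) ^ 2 / 2 ∂ν = (((∫ x, x ^ 2 ∂ν) * t ^ 2 / 2 : ℝ) : ℂ) := by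
      have : ∀ x : ℝ, ((t * x : ℝ) : ℂ) ^ 2 / 2 = ((x ^ 2 * (t ^ 2 / 2) : ℝ) : ℂ) := by
        intro x; push_cast; ring
      simp_rw [this]
      rw [integral_complex_ofReal, integral_mul_const]
      congr 1
      ring
    have i3' : Integrable (fun x : ℝ => 1 + ((t * x : ℝ) : ℂ) * Complex.I) ν :=
      (integrable_const _).add i1'
    rw [integral_sub i3' i2', integral_add (integrable_const (1 : ℂ)) i1',
      ea, eb]
    push_cast
    simp
  rw [he, charFun_apply_real, ← integral_sub ie hq, mul_right_comm, ← integral_const_mul]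
  refine norm_integral_le_of_norm_le (h3.const_mul _) (Eventually.of_forall fun x => ?_)
  have := norm_exp_mul_I_sub_taylor_le (t * x)
  rw [abs_mul, mul_pow] at this
  push_cast at this ⊢
  linarith

/-- The condition on `t` makes `1 - s t²/2` nonnegative, with `s` the second moment, so it is its
own norm, and `1 + y ≤ exp y` finishes. -/
theorem norm_charFun_le_exp {ν : Measure ℝ} [IsProbabilityMeasure ν]
    (h3 : Integrable (fun x => |x| ^ 3) ν) (h1 : ∫ x, x ∂ν = 0) {t : ℝ}
    (ht : (∫ x, x ^ 2 ∂ν) * t ^ 2 ≤ 2) :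
    ‖charFun ν t‖ ≤
      Real.exp (-((∫ x, x ^ 2 ∂ν) * t ^ 2 / 2) + 4 * (∫ x, |x| ^ 3 ∂ν) * |t| ^ 3) := by
  have h := norm_charFun_sub_taylor_le h3 h1 t
  have h2 : ‖charFun ν t‖ ≤ 4 * (∫ x, |x| ^ 3 ∂ν) * |t| ^ 3
      + ‖((1 - (∫ x, x ^ 2 ∂ν) * t ^ 2 / 2 : ℝ) : ℂ)‖ := by
    have := norm_add_le (charFun ν t - (1 - (∫ x, x ^ 2 ∂ν) * t ^ 2 / 2 : ℝ))
      ((1 - (∫ x, x ^ 2 ∂ν) * t ^ 2 / 2 : ℝ) : ℂ)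
    rw [sub_add_cancel] at this
    linarith
  rw [Complex.norm_real, Real.norm_of_nonneg (by linarith)] at h2
  have h3 := Real.add_one_le_exp
    (-((∫ x, x ^ 2 ∂ν) * t ^ 2 / 2) + 4 * (∫ x, |x| ^ 3 ∂ν) * |t| ^ 3)
  linarith

theorem norm_charFun_sub_gaussian_le {ν : Measure ℝ} [IsProbabilityMeasure ν]
    (h3 : Integrable (fun x => |x| ^ 3) ν) (h1 : ∫ x, x ∂ν = 0) {t : ℝ}
    (ht : (∫ x, x ^ 2 ∂ν) * t ^ 2 ≤ 2) :
    ‖charFun ν t - (Real.exp (-((∫ x, x ^ 2 ∂ν) * t ^ 2 / 2)) : ℝ)‖ ≤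
      4 * (∫ x, |x| ^ 3 ∂ν) * |t| ^ 3 + (∫ x, x ^ 2 ∂ν) ^ 2 * t ^ 4 / 4 := by
  have h := norm_charFun_sub_taylor_le h3 h1 t
  have hs : 0 ≤ ∫ x, x ^ 2 ∂ν := integral_nonneg fun x => sq_nonneg x
  have hy : 0 ≤ (∫ x, x ^ 2 ∂ν) * t ^ 2 / 2 := by positivity
  have h2 := Real.norm_exp_sub_one_sub_id_le (x := -((∫ x, x ^ 2 ∂ν) * t ^ 2 / 2))
    (by rw [norm_neg, Real.norm_of_nonneg hy]; linarith)
  have h4 := norm_sub_le (charFun ν t - (1 - (∫ x, x ^ 2 ∂ν) * t ^ 2 / 2 : ℝ))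
    ((Real.exp (-((∫ x, x ^ 2 ∂ν) * t ^ 2 / 2)) - 1 - -((∫ x, x ^ 2 ∂ν) * t ^ 2 / 2) : ℝ) : ℂ)
  rw [Complex.norm_real] at h4
  have e : charFun ν t - (1 - (∫ x, x ^ 2 ∂ν) * t ^ 2 / 2 : ℝ) -
    ((Real.exp (-((∫ x, x ^ 2 ∂ν) * t ^ 2 / 2)) - 1 - -((∫ x, x ^ 2 ∂ν) * t ^ 2 / 2) : ℝ) : ℂ)
    = charFun ν t - (Real.exp (-((∫ x, x ^ 2 ∂ν) * t ^ 2 / 2)) : ℝ) := by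
    push_cast
    ring
  rw [e] at h4
  rw [norm_neg, Real.norm_of_nonneg hy] at h2
  have e2 : ((∫ x, x ^ 2 ∂ν) * t ^ 2 / 2) ^ 2 = (∫ x, x ^ 2 ∂ν) ^ 2 * t ^ 4 / 4 := by ring
  linarith

/-- Telescoping. Each term of the telescoped sum lacks one factor `c j` of the full product; the
hypothesis `1 ≤ M * c j` restores it at the cost of `M`. -/
theorem norm_prod_sub_prod_le {ι : Type*} (s : Finset ι) (a b : ι → ℂ) (c : ι → ℝ)
    (hc : ∀ i, 0 < c i) {M : ℝ} (hM : ∀ i, 1 ≤ M * c i)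
    (ha : ∀ i, ‖a i‖ ≤ c i) (hb : ∀ i, ‖b i‖ ≤ c i) :
    ‖∏ i ∈ s, a i - ∏ i ∈ s, b i‖ ≤ M * (∏ i ∈ s, c i) * ∑ i ∈ s, ‖a i - b i‖ := by
  classical
  induction s using Finset.induction_on with
  | empty => simp
  | insert j s hj ih =>
    rw [Finset.prod_insert hj, Finset.prod_insert hj, Finset.prod_insert hj, Finset.sum_insert hj]
    have hA : ‖∏ i ∈ s, a i‖ ≤ ∏ i ∈ s, c i := by
      rw [norm_prod]
      exact Finset.prod_le_prod (fun _ _ => norm_nonneg _) fun i _ => ha i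
    have hP : 0 ≤ ∏ i ∈ s, c i := Finset.prod_nonneg fun i _ => (hc i).le
    have e : a j * ∏ i ∈ s, a i - b j * ∏ i ∈ s, b i =
        (a j - b j) * ∏ i ∈ s, a i + b j * (∏ i ∈ s, a i - ∏ i ∈ s, b i) := by ring
    rw [e]
    refine (norm_add_le _ _).trans ?_
    rw [norm_mul, norm_mul]
    have h1 : ‖a j - b j‖ * ‖∏ i ∈ s, a i‖ ≤ M * c j * (‖a j - b j‖ * ∏ i ∈ s, c i) := by
      refine (mul_le_mul_of_nonneg_left hA (norm_nonneg _)).trans ?_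
      exact le_mul_of_one_le_left (by positivity) (hM j)
    have h2 : ‖b j‖ * ‖∏ i ∈ s, a i - ∏ i ∈ s, b i‖ ≤
        c j * (M * (∏ i ∈ s, c i) * ∑ i ∈ s, ‖a i - b i‖) :=
      mul_le_mul (hb j) ih (norm_nonneg _) (hc j).le
    nlinarith

/-! ### A Berry–Esseen bound -/

/-- With `s i` and `g i` the second and third absolute moments, `exp (-s i t²/2 + 4 g i |t|³)`
dominates both the `i`-th characteristic function and its Gaussian counterpart. On `|t| ≤ T` the
cubic terms add up to at most half of the quadratic ones, which leaves `exp (-t²/4 · ∑ s i)`. Since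
`s i t² ≤ 2`, each single factor is at least `exp (-1)`, whence the constant `e`. -/
theorem norm_prod_charFun_sub_gaussian_le {ι : Type*} [Fintype ι] (ν : ι → Measure ℝ)
    [∀ i, IsProbabilityMeasure (ν i)] (h3 : ∀ i, Integrable (fun x => |x| ^ 3) (ν i))
    (h1 : ∀ i, ∫ x, x ∂(ν i) = 0) {S T : ℝ} (hS : ∀ i, ∫ x, x ^ 2 ∂(ν i) ≤ S)
    (hST : S * T ^ 2 ≤ 2)
    (hT : 16 * (∑ i, ∫ x, |x| ^ 3 ∂(ν i)) * T ≤ ∑ i, ∫ x, x ^ 2 ∂(ν i))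
    {t : ℝ} (ht : |t| ≤ T) :
    ‖∏ i, charFun (ν i) t - (Real.exp (-((∑ i, ∫ x, x ^ 2 ∂(ν i)) * t ^ 2 / 2)) : ℝ)‖ ≤
      Real.exp 1 * Real.exp (-((∑ i, ∫ x, x ^ 2 ∂(ν i)) * t ^ 2 / 4)) *
        (4 * (∑ i, ∫ x, |x| ^ 3 ∂(ν i)) * |t| ^ 3
          + S * (∑ i, ∫ x, x ^ 2 ∂(ν i)) * t ^ 4 / 4) := by
  set s : ι → ℝ := fun i => ∫ x, x ^ 2 ∂(ν i) with hs
  set g : ι → ℝ := fun i => ∫ x, |x| ^ 3 ∂(ν i) with hg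
  have hs0 : ∀ i, 0 ≤ s i := fun i => integral_nonneg fun x => sq_nonneg x
  have hg0 : ∀ i, 0 ≤ g i := fun i => integral_nonneg fun x => by positivity
  have ht2 : t ^ 2 ≤ T ^ 2 := sq_le_sq' (by linarith [neg_abs_le t]) ((le_abs_self t).trans ht)
  have hst : ∀ i, s i * t ^ 2 ≤ 2 := fun i =>
    (mul_le_mul (hS i) ht2 (sq_nonneg t) ((hs0 i).trans (hS i))).trans hST
  have hprod : ((Real.exp (-((∑ i, s i) * t ^ 2 / 2)) : ℝ) : ℂ) =
      ∏ i, ((Real.exp (-(s i * t ^ 2 / 2)) : ℝ) : ℂ) := by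
    rw [← Complex.ofReal_prod, ← Real.exp_sum]
    congr 2
    rw [Finset.sum_neg_distrib, Finset.sum_mul, Finset.sum_div]
  rw [hprod]
  refine (norm_prod_sub_prod_le Finset.univ _ _
    (fun i => Real.exp (-(s i * t ^ 2 / 2) + 4 * g i * |t| ^ 3)) (fun i => Real.exp_pos _)
    (M := Real.exp 1) ?_ ?_ ?_).trans ?_
  · intro i
    rw [← Real.exp_add, Real.one_le_exp_iff]
    have := hst i
    have : 0 ≤ 4 * g i * |t| ^ 3 := by have := hg0 i; positivity
    linarith
  · intro i
    exact norm_charFun_le_exp (h3 i) (h1 i) (hst i)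
  · intro i
    rw [Complex.norm_real, Real.norm_of_nonneg (Real.exp_pos _).le, Real.exp_le_exp]
    have : 0 ≤ 4 * g i * |t| ^ 3 := by have := hg0 i; positivity
    linarith
  · refine mul_le_mul (mul_le_mul_of_nonneg_left ?_ (Real.exp_pos _).le) ?_
      (Finset.sum_nonneg fun _ _ => norm_nonneg _) (by positivity)
    · rw [← Real.exp_sum, Real.exp_le_exp, Finset.sum_add_distrib, Finset.sum_neg_distrib,
        ← Finset.sum_div, ← Finset.sum_mul, ← Finset.sum_mul, ← Finset.mul_sum]
      have hG : 0 ≤ ∑ i, g i := Finset.sum_nonneg fun i _ => hg0 i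
      have e1 : 16 * (∑ i, g i) * |t| ≤ ∑ i, s i :=
        (mul_le_mul_of_nonneg_left ht (by positivity)).trans hT
      have e2 : |t| ^ 3 = |t| * t ^ 2 := by rw [← sq_abs t]; ring
      rw [e2]
      nlinarith [mul_le_mul_of_nonneg_right e1 (sq_nonneg t)]
    · refine (Finset.sum_le_sum fun i _ =>
        norm_charFun_sub_gaussian_le (h3 i) (h1 i) (hst i)).trans ?_
      rw [Finset.sum_add_distrib]
      refine add_le_add (le_of_eq ?_) ?_
      · rw [← Finset.sum_mul, ← Finset.mul_sum]
      rw [Finset.mul_sum, Finset.sum_mul, Finset.sum_div]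
      refine Finset.sum_le_sum fun i _ => ?_
      have : s i ^ 2 ≤ S * s i := by
        rw [sq]
        exact mul_le_mul_of_nonneg_right (hS i) (hs0 i)
      have t4 : 0 ≤ t ^ 4 := by positivity
      have := mul_le_mul_of_nonneg_right this t4
      linarith

theorem abs_exp_neg_sub_exp_neg_le {x y m : ℝ} (hx : m ≤ x) (hy : m ≤ y) :
    |Real.exp (-x) - Real.exp (-y)| ≤ |x - y| * Real.exp (-m) := by
  wlog h : x ≤ y generalizing x y
  · rw [abs_sub_comm, abs_sub_comm x y]
    exact this hy hx (not_le.1 h).le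
  have h1 : Real.exp (-y) ≤ Real.exp (-x) := Real.exp_le_exp.2 (by linarith)
  rw [abs_of_nonneg (by linarith), abs_sub_comm, abs_of_nonneg (by linarith)]
  have h2 : Real.exp (-y) = Real.exp (-x) * Real.exp (x - y) := by
    rw [← Real.exp_add]; congr 1; ring
  have h3 := Real.add_one_le_exp (x - y)
  have h4 : Real.exp (-x) ≤ Real.exp (-m) := Real.exp_le_exp.2 (by linarith)
  have h5 := Real.exp_pos (-x)
  nlinarith

/-- Bounding the density by its maximum turns the Gaussian average into a Lebesgue integral. Its
normalizing constant will cancel the one in the inversion formula. -/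
theorem integral_gaussianReal_le_of_nonneg {w : ℝ≥0} (hw : w ≠ 0) {h : ℝ → ℝ}
    (h0 : ∀ x, 0 ≤ h x) (hi : Integrable h) :
    Integrable h (gaussianReal 0 w) ∧
      ∫ x, h x ∂(gaussianReal 0 w) ≤ (√(2 * Real.pi * w))⁻¹ * ∫ x, h x := by
  have hint : Integrable (fun x => gaussianPDFReal 0 w x * h x) := by
    refine (hi.const_mul (√(2 * Real.pi * w))⁻¹).mono'
      ((measurable_gaussianPDFReal 0 w).aestronglyMeasurable.mul hi.1)
      (Eventually.of_forall fun x => ?_)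
    rw [norm_mul, Real.norm_of_nonneg (gaussianPDFReal_nonneg _ _ _), Real.norm_of_nonneg (h0 x)]
    exact mul_le_mul_of_nonneg_right (gaussianPDFReal_le w 0 x) (h0 x)
  refine ⟨?_, ?_⟩
  · rw [gaussianReal_of_var_ne_zero _ hw, integrable_withDensity_iff_integrable_smul'
      (measurable_gaussianPDF 0 w) (Eventually.of_forall fun x => gaussianPDF_lt_top)]
    refine hint.congr (Eventually.of_forall fun x => ?_)
    simp [toReal_gaussianPDF]
  · rw [integral_gaussianReal_eq_integral_smul hw, ← integral_const_mul]
    refine integral_mono hint (hi.const_mul _) fun x => ?_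
    exact mul_le_mul_of_nonneg_right (gaussianPDFReal_le w 0 x) (h0 x)

/-- Characteristic functions that are close on `[-T, T]` have close Gaussian smoothings. -/
theorem abs_conv_gaussianReal_Iic_sub_le_of_le (μ ν : Measure ℝ) [IsProbabilityMeasure μ]
    [IsProbabilityMeasure ν] {v : ℝ≥0} (hv : v ≠ 0) (x : ℝ) {h : ℝ → ℝ} (h0 : ∀ x, 0 ≤ h x)
    (hi : Integrable h) {T : ℝ} (hT : 0 < T)
    (hle : ∀ t, |t| ≤ T → ‖charFun μ t - charFun ν t‖ / |t| ≤ h t) :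
    |(μ ∗ gaussianReal 0 v).real (Set.Iic x) - (ν ∗ gaussianReal 0 v).real (Set.Iic x)| ≤
      (∫ t, h t) + 8 / (√v * T) * Real.exp (-(v * T ^ 2 / 2)) := by
  have hvi : v⁻¹ ≠ 0 := inv_ne_zero hv
  have hv0 : (0 : ℝ) < v := by positivity
  obtain ⟨hi1, hi2⟩ := integral_gaussianReal_le_of_nonneg hvi h0 hi
  set A : Set ℝ := Set.Ici T ∪ Set.Iic (-T) with hA
  have hAm : MeasurableSet A := measurableSet_Ici.union measurableSet_Iic
  have hA1 : (gaussianReal 0 v⁻¹).real A ≤ 2 * Real.exp (-(v * T ^ 2 / 2)) := by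
    have e : -T ^ 2 / (2 * ((v⁻¹ : ℝ≥0) : ℝ)) = -(v * T ^ 2 / 2) := by
      push_cast; field_simp
    have h1 := gaussianReal_real_Ici_le hvi hT.le
    have h2 := gaussianReal_real_Iic_neg_le hvi hT.le
    rw [e] at h1 h2
    refine (measureReal_union_le _ _).trans ?_
    linarith
  have hind : Integrable (A.indicator fun _ => 2 / T) (gaussianReal 0 v⁻¹) :=
    (integrable_const _).indicator hAm
  have hb : ∀ t, ‖charFun μ t - charFun ν t‖ / |t| ≤ h t + A.indicator (fun _ => 2 / T) t := by
    intro t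
    by_cases ht : |t| ≤ T
    · refine (hle t ht).trans (le_add_of_nonneg_right ?_)
      exact Set.indicator_nonneg (fun _ _ => by positivity) _
    · have htA : t ∈ A := by
        rw [not_le, lt_abs] at ht
        rcases ht with ht | ht
        · exact Or.inl ht.le
        · exact Or.inr (by simp only [Set.mem_Iic]; linarith)
      rw [Set.indicator_of_mem htA]
      refine le_add_of_nonneg_of_le (h0 t) ?_
      have : ‖charFun μ t - charFun ν t‖ ≤ 2 := by
        refine (norm_sub_le _ _).trans ?_
        linarith [norm_charFun_le_one (μ := μ) t, norm_charFun_le_one (μ := ν) t]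
      exact div_le_div₀ (by norm_num) this hT (not_le.1 ht).le
  have hint : Integrable (fun τ => ‖charFun μ τ - charFun ν τ‖ / |τ|) (gaussianReal 0 v⁻¹) := by
    refine (hi1.add hind).mono' ?_ (Eventually.of_forall fun t => ?_)
    · have hm : Measurable fun τ : ℝ => ‖charFun μ τ - charFun ν τ‖ / |τ| :=
        ((measurable_charFun.sub measurable_charFun).norm).div (by fun_prop)
      exact hm.aestronglyMeasurable
    · rw [Real.norm_of_nonneg (by positivity)]
      exact hb t
  refine (abs_conv_gaussianReal_Iic_sub_le μ ν hv x hint).trans ?_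
  have hI : ∫ τ, ‖charFun μ τ - charFun ν τ‖ / |τ| ∂(gaussianReal 0 v⁻¹) ≤
      (√(2 * Real.pi * (v⁻¹ : ℝ≥0)))⁻¹ * (∫ t, h t) +
        2 / T * (2 * Real.exp (-(v * T ^ 2 / 2))) := by
    refine (integral_mono hint (hi1.add hind) hb).trans ?_
    rw [show (∫ t, (h + A.indicator fun _ => 2 / T) t ∂(gaussianReal 0 v⁻¹)) = _ from
      integral_add hi1 hind, integral_indicator hAm, setIntegral_const, smul_eq_mul, mul_comm _ (2 / T)]
    gcongr
  have hpi : 2 ≤ Real.pi := Real.two_le_pi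
  have hh : 0 ≤ ∫ t, h t := integral_nonneg h0
  -- The two normalizing constants, for variances `v` and `1 / v`, multiply to `1 / (2π)`: the main
  -- term does not depend on the amount of smoothing.
  have e1 : (√(2 * Real.pi * v))⁻¹ * (√(2 * Real.pi * (v⁻¹ : ℝ≥0)))⁻¹ = (2 * Real.pi)⁻¹ := by
    rw [← mul_inv, ← Real.sqrt_mul (by positivity)]
    congr 1
    rw [show 2 * Real.pi * v * (2 * Real.pi * ((v⁻¹ : ℝ≥0) : ℝ)) = (2 * Real.pi) ^ 2 by
      push_cast; field_simp]
    exact Real.sqrt_sq (by positivity)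
  have e2 : (√(2 * Real.pi * v))⁻¹ ≤ (√v)⁻¹ := by
    gcongr
    nlinarith
  calc _ ≤ (√(2 * Real.pi * v))⁻¹ * (2 * ((√(2 * Real.pi * (v⁻¹ : ℝ≥0)))⁻¹ * (∫ t, h t) +
        2 / T * (2 * Real.exp (-(v * T ^ 2 / 2))))) := by gcongr
    _ = 2 * ((√(2 * Real.pi * v))⁻¹ * (√(2 * Real.pi * (v⁻¹ : ℝ≥0)))⁻¹) * (∫ t, h t) +
        (√(2 * Real.pi * v))⁻¹ * (8 / T * Real.exp (-(v * T ^ 2 / 2))) := by ring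
    _ ≤ 1 * (∫ t, h t) + (√v)⁻¹ * (8 / T * Real.exp (-(v * T ^ 2 / 2))) := by
        rw [e1]
        gcongr
        rw [mul_inv, ← mul_assoc, mul_inv_cancel₀ (by norm_num), one_mul]
        exact inv_le_one_of_one_le₀ (by linarith)
    _ = _ := by
        field_simp

theorem integrable_abs_pow_mul_exp_neg_mul_sq {a : ℝ} (ha : 0 < a) (j : ℕ) :
    Integrable fun t : ℝ => |t| ^ j * Real.exp (-(a * t ^ 2)) := by
  have h := (integrable_rpow_mul_exp_neg_mul_sq ha (s := j) (by
    have : (0 : ℝ) ≤ j := by positivity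
    linarith)).norm
  refine h.congr (Eventually.of_forall fun t => ?_)
  simp [neg_mul]

/-- The first summand is the error of the product of characteristic functions against a Gaussian of
the same variance; the second is the error of changing this variance to `v`. After division by `|t|`
both are integrable with respect to Lebesgue measure. -/
theorem norm_charFun_sub_gaussian_div_le {K : ℝ} (hK : 1 ≤ K) {N : ℝ} (hN0 : 0 < N)
    {ι : Type*} [Fintype ι] (μ : Measure ℝ) (ν : ι → Measure ℝ)
    [∀ i, IsProbabilityMeasure (ν i)] (hφ : ∀ t, charFun μ t = ∏ i, charFun (ν i) t)
    (h3 : ∀ i, Integrable (fun x => |x| ^ 3) (ν i)) (h1 : ∀ i, ∫ x, x ∂(ν i) = 0)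
    (hs : ∀ i, ∫ x, x ^ 2 ∂(ν i) ≤ K / N) (hg : ∑ i, ∫ x, |x| ^ 3 ∂(ν i) ≤ K / √N)
    (hlo : 1 / K ≤ ∑ i, ∫ x, x ^ 2 ∂(ν i)) (hhi : ∑ i, ∫ x, x ^ 2 ∂(ν i) ≤ K)
    {v : ℝ≥0} (hv : 1 / K ≤ v) {t : ℝ} (ht : |t| ≤ √N / (16 * K ^ 2)) :
    ‖charFun μ t - charFun (gaussianReal 0 v) t‖ / |t| ≤
      15 * K / √N * (|t| ^ 2 * Real.exp (-(1 / (4 * K) * t ^ 2)))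
      + |v - ∑ i, ∫ x, x ^ 2 ∂(ν i)| / 2 * (|t| ^ 1 * Real.exp (-(1 / (4 * K) * t ^ 2))) := by
  have hK0 : 0 < K := by linarith
  set a : ℝ := 1 / (4 * K) with ha
  have ha0 : 0 < a := by positivity
  have hsN : 0 < √N := Real.sqrt_pos.2 hN0
  have hsN2 : √N ^ 2 = N := Real.sq_sqrt hN0.le
  set σ := ∑ i, ∫ x, x ^ 2 ∂(ν i) with hσ
  set Γ := ∑ i, ∫ x, |x| ^ 3 ∂(ν i) with hΓ
  set d := |v - σ| with hd
  -- This `T` is as large as allowed: third moments of total at most `K / √N` then give `16 Γ T ≤ 1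
  -- / K ≤ σ`.
  set T : ℝ := √N / (16 * K ^ 2) with hT
  have hT0 : 0 < T := by positivity
  have hST : K / N * T ^ 2 ≤ 2 := by
    rw [hT, div_pow, hsN2]
    have : K / N * (N / (16 * K ^ 2) ^ 2) = 1 / (256 * K ^ 3) := by
      field_simp; ring
    rw [this, div_le_iff₀ (by positivity)]
    have : 1 ≤ K ^ 3 := one_le_pow₀ hK
    linarith
  have hΓT : 16 * Γ * T ≤ σ := by
    refine le_trans ?_ hlo
    calc 16 * Γ * T ≤ 16 * (K / √N) * T := by gcongr
      _ = 1 / K := by rw [hT]; field_simp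
  have hd0 : 0 ≤ d := abs_nonneg _
  rcases eq_or_ne t 0 with rfl | ht0
  · simp
  have htp : 0 < |t| := abs_pos.2 ht0
  have b1 := norm_prod_charFun_sub_gaussian_le ν h3 h1 hs hST hΓT ht
  rw [← hφ, ← hσ, ← hΓ] at b1
  have b2 : ‖((Real.exp (-(σ * t ^ 2 / 2)) : ℝ) : ℂ) - charFun (gaussianReal 0 v) t‖ ≤
      d * t ^ 2 / 2 * Real.exp (-(a * t ^ 2)) := by
    have e : charFun (gaussianReal 0 v) t = ((Real.exp (-(v * t ^ 2 / 2)) : ℝ) : ℂ) := by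
      rw [charFun_gaussianReal]
      push_cast
      congr 1
      simp
    rw [e, ← Complex.ofReal_sub, Complex.norm_real, Real.norm_eq_abs]
    have m : ∀ r : ℝ, 1 / K ≤ r → a * t ^ 2 ≤ r * t ^ 2 / 2 := by
      intro r hr
      have : a = 1 / K / 4 := by rw [ha]; field_simp
      nlinarith [mul_le_mul_of_nonneg_right hr (sq_nonneg t), sq_nonneg t,
        mul_nonneg ha0.le (sq_nonneg t)]
    refine (abs_exp_neg_sub_exp_neg_le (m σ hlo) (m v hv)).trans (le_of_eq ?_)
    rw [show σ * t ^ 2 / 2 - v * t ^ 2 / 2 = (σ - v) * (t ^ 2 / 2) by ring, abs_mul,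
      abs_of_nonneg (by positivity : 0 ≤ t ^ 2 / 2), abs_sub_comm, ← hd]
    ring
  have b3 : Real.exp (-(σ * t ^ 2 / 4)) ≤ Real.exp (-(a * t ^ 2)) := by
    rw [Real.exp_le_exp]
    have : a = 1 / K / 4 := by rw [ha]; field_simp
    nlinarith [mul_le_mul_of_nonneg_right hlo (sq_nonneg t)]
  have b4 : 4 * Γ * |t| ^ 3 + K / N * σ * t ^ 4 / 4 ≤ 5 * K / √N * |t| ^ 3 := by
    have e1 : 4 * Γ * |t| ^ 3 ≤ 4 * (K / √N) * |t| ^ 3 := by gcongr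
    -- On `|t| ≤ T` one power of `|t|` is of order `√N`, so the quartic term is absorbed by the
    -- cubic one.
    have e2 : K / N * σ * t ^ 4 / 4 ≤ K / √N * |t| ^ 3 := by
      calc K / N * σ * t ^ 4 / 4 = K / N * σ * |t| / 4 * |t| ^ 3 := by
            rw [← Even.pow_abs (by decide : Even 4) t]; ring
        _ ≤ K / N * K * T / 4 * |t| ^ 3 := by gcongr
        _ = 1 / (64 * √N) * |t| ^ 3 := by
            rw [hT]
            nth_rw 1 [← hsN2]
            congr 1
            field_simp
            norm_num
        _ ≤ K / √N * |t| ^ 3 := by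
            refine mul_le_mul_of_nonneg_right ?_ (by positivity)
            rw [div_le_div_iff₀ (by positivity) hsN]
            nlinarith
    calc _ ≤ 4 * (K / √N) * |t| ^ 3 + K / √N * |t| ^ 3 := add_le_add e1 e2
      _ = _ := by ring
  have he : Real.exp 1 ≤ 3 := by linarith [Real.exp_one_lt_d9]
  rw [div_le_iff₀ htp]
  calc _ ≤ ‖charFun μ t - (Real.exp (-(σ * t ^ 2 / 2)) : ℝ)‖ +
        ‖((Real.exp (-(σ * t ^ 2 / 2)) : ℝ) : ℂ) - charFun (gaussianReal 0 v) t‖ :=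
          norm_sub_le_norm_sub_add_norm_sub _ _ _
    _ ≤ 3 * Real.exp (-(a * t ^ 2)) * (5 * K / √N * |t| ^ 3) +
        d * t ^ 2 / 2 * Real.exp (-(a * t ^ 2)) := by
          refine add_le_add (b1.trans ?_) b2
          refine mul_le_mul (mul_le_mul he b3 (Real.exp_pos _).le (by norm_num)) b4 ?_
            (by positivity)
          have : 0 ≤ Γ := Finset.sum_nonneg fun i _ => integral_nonneg fun x => by positivity
          have : 0 ≤ σ := le_trans (by positivity) hlo
          positivity
    _ = _ := by
          rw [← sq_abs t]
          ring

/-- Smoothing by a Gaussian of standard deviation `√(log N) / T` and removing it with a shift `log N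
/ T`, where `T` is of order `√N`, loses only a logarithm against the optimal rate. The scale `N` is
separate from the number of summands, so that `2n` summands of unequal size can be treated at scale
`k`, and `v` need not be the exact variance. -/
theorem berry_esseen {K : ℝ} (hK : 1 ≤ K) : ∃ C : ℝ, 0 < C ∧ ∀ N : ℝ, 2 ≤ N →
    ∀ (ι : Type) [Fintype ι] (μ : Measure ℝ) [IsProbabilityMeasure μ] (ν : ι → Measure ℝ)
      [∀ i, IsProbabilityMeasure (ν i)], (∀ t, charFun μ t = ∏ i, charFun (ν i) t) →
      (∀ i, Integrable (fun x => |x| ^ 3) (ν i)) → (∀ i, ∫ x, x ∂(ν i) = 0) →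
      (∀ i, ∫ x, x ^ 2 ∂(ν i) ≤ K / N) → ∑ i, ∫ x, |x| ^ 3 ∂(ν i) ≤ K / √N →
      1 / K ≤ ∑ i, ∫ x, x ^ 2 ∂(ν i) → ∑ i, ∫ x, x ^ 2 ∂(ν i) ≤ K →
      ∀ v : ℝ≥0, 1 / K ≤ v → ∀ x, |cdf μ x - cdf (gaussianReal 0 v) x| ≤
        C * (Real.log N / √N + |v - ∑ i, ∫ x, x ^ 2 ∂(ν i)|) := by
  have hK0 : 0 < K := by linarith
  set a : ℝ := 1 / (4 * K) with ha
  have ha0 : 0 < a := by positivity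
  set J₁ := ∫ t : ℝ, |t| ^ 1 * Real.exp (-(a * t ^ 2)) with hJ1
  set J₂ := ∫ t : ℝ, |t| ^ 2 * Real.exp (-(a * t ^ 2)) with hJ2
  have hJ1' : 0 ≤ J₁ := integral_nonneg fun t => by positivity
  have hJ2' : 0 ≤ J₂ := integral_nonneg fun t => by positivity
  refine ⟨30 * K * J₂ + J₁ / 2 + 36 + 32 * K ^ 3, by positivity, ?_⟩
  intro N hN ι _ μ _ ν _ hφ h3 h1 hs hg hlo hhi v hv x
  have hN0 : 0 < N := by linarith
  have hsN : 0 < √N := Real.sqrt_pos.2 hN0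
  have hsN2 : √N ^ 2 = N := Real.sq_sqrt hN0.le
  set σ := ∑ i, ∫ x, x ^ 2 ∂(ν i) with hσ
  set Γ := ∑ i, ∫ x, |x| ^ 3 ∂(ν i) with hΓ
  set d := |v - σ| with hd
  set T : ℝ := √N / (16 * K ^ 2) with hT
  have hT0 : 0 < T := by positivity
  have hvp : (0 : ℝ) < v := lt_of_lt_of_le (by positivity) hv
  have hv0 : v ≠ 0 := by
    rintro rfl
    simp at hvp
  have hlog : 1 / 2 ≤ Real.log N := by
    have := Real.log_le_log (by norm_num) hN
    linarith [Real.log_two_gt_d9]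
  have hlog0 : 0 < Real.log N := by linarith
  set h : ℝ → ℝ := fun t => 15 * K / √N * (|t| ^ 2 * Real.exp (-(a * t ^ 2)))
    + d / 2 * (|t| ^ 1 * Real.exp (-(a * t ^ 2))) with hh
  have hd0 : 0 ≤ d := abs_nonneg _
  have hh0 : ∀ t, 0 ≤ h t := fun t => by positivity
  have hi2 := (integrable_abs_pow_mul_exp_neg_mul_sq ha0 2).const_mul (15 * K / √N)
  have hi1 := (integrable_abs_pow_mul_exp_neg_mul_sq ha0 1).const_mul (d / 2)
  have hhi' : Integrable h := hi2.add hi1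
  have hhI : ∫ t, h t = 15 * K / √N * J₂ + d / 2 * J₁ := by
    rw [hh, integral_add hi2 hi1, integral_const_mul, integral_const_mul]
  -- With `δ = log N / T` this choice gives `w T² = log N = δ² / w`, so that the frequency cut-off
  -- and the tail of the noise both contribute `exp (-(log N) / 2) = 1 / √N`.
  set w : ℝ≥0 := ⟨Real.log N / T ^ 2, by positivity⟩ with hw
  have hwv : (w : ℝ) = Real.log N / T ^ 2 := rfl
  have hw0 : w ≠ 0 := by
    intro h0
    have : (w : ℝ) = 0 := by rw [h0]; rfl
    rw [hwv] at this
    exact absurd this (by positivity)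
  have hexp : Real.exp (-(Real.log N / 2)) = (√N)⁻¹ := by
    rw [Real.exp_neg, ← Real.log_sqrt hN0.le, Real.exp_log hsN]
  have main := abs_cdf_sub_le_of_conv μ hv0 hw0 (δ := Real.log N / T) (by positivity)
    (fun y => abs_conv_gaussianReal_Iic_sub_le_of_le μ (gaussianReal 0 v) hw0 y hh0 hhi' hT0
      fun t ht => norm_charFun_sub_gaussian_div_le hK hN0 μ ν hφ h3 h1 hs hg hlo hhi hv ht) x
  refine main.trans ?_
  have f1 : √(w : ℝ) * T = √(Real.log N) := by
    rw [hwv, Real.sqrt_div hlog0.le, Real.sqrt_sq hT0.le]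
    field_simp
  have f2 : (w : ℝ) * T ^ 2 / 2 = Real.log N / 2 := by
    rw [hwv]; field_simp
  have f3 : -(Real.log N / T) ^ 2 / (2 * (w : ℝ)) = -(Real.log N / 2) := by
    rw [hwv]; field_simp
  rw [f1, f2, f3, hexp, hhI]
  have f4 : (√(2 * Real.pi * v))⁻¹ ≤ K := by
    rw [inv_le_comm₀ (by positivity) hK0]
    refine Real.le_sqrt_of_sq_le ?_
    have e : K⁻¹ ^ 2 ≤ K⁻¹ :=
      pow_le_of_le_one (by positivity) (inv_le_one_of_one_le₀ hK) (by norm_num)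
    have e2 : (v : ℝ) ≤ 2 * Real.pi * v :=
      le_mul_of_one_le_left hvp.le (by linarith [Real.two_le_pi])
    rw [one_div] at hv
    linarith
  have f5 : 8 / √(Real.log N) ≤ 16 := by
    rw [div_le_iff₀ (Real.sqrt_pos.2 hlog0)]
    have : 1 / 2 ≤ √(Real.log N) := Real.le_sqrt_of_sq_le (by linarith)
    linarith
  have f6 : (√N)⁻¹ ≤ 2 * (Real.log N / √N) := by
    rw [inv_eq_one_div, ← mul_div_assoc]
    gcongr
    linarith
  set R := Real.log N / √N with hR
  have hR0 : 0 ≤ R := by positivity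
  have f7 : (√(2 * Real.pi * v))⁻¹ * (2 * (Real.log N / T)) ≤ 32 * K ^ 3 * R := by
    calc _ ≤ K * (2 * (Real.log N / T)) := by gcongr
      _ = 32 * K ^ 3 * R := by rw [hT, hR]; field_simp; norm_num
  have f8 : 15 * K / √N * J₂ ≤ 30 * K * J₂ * R := by
    calc 15 * K / √N * J₂ = 15 * K * J₂ * (√N)⁻¹ := by ring
      _ ≤ 15 * K * J₂ * (2 * R) := by gcongr
      _ = _ := by ring
  have f9 : 8 / √(Real.log N) * (√N)⁻¹ ≤ 16 * (2 * R) := by gcongr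
  have q1 : 0 ≤ J₁ / 2 * R := by positivity
  have q2 : 0 ≤ (30 * K * J₂ + 36 + 32 * K ^ 3) * d := by positivity
  linarith

/-! ### Polar coordinates for the `ℓ_p`-norm -/

theorem measurableSet_lpBall (n : ℕ) (p : ℝ) : MeasurableSet (lpBall n p) :=
  measurableSet_le measurable_lpNorm measurable_const

theorem volume_lpBall {n : ℕ} (hn : n ≠ 0) {p : ℝ} (hp : 1 ≤ p) :
    volume (lpBall n p) =
      ENNReal.ofReal ((2 * Real.Gamma (1 / p + 1)) ^ n / Real.Gamma (n / p + 1)) := by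
  have : Nonempty (Fin n) := ⟨⟨0, Nat.pos_of_ne_zero hn⟩⟩
  have h := volume_sum_rpow_le (Fin n) hp 1
  rw [ENNReal.ofReal_one, one_pow, one_mul, Fintype.card_fin] at h
  rw [← h, ← (PiLp.volume_preserving_toLp (Fin n)).measure_preimage
    (measurableSet_lpBall n p).nullMeasurableSet]
  rfl

theorem volume_lpBall_pos {n : ℕ} (hn : n ≠ 0) {p : ℝ} (hp : 1 ≤ p) :
    volume (lpBall n p) ≠ 0 := by
  rw [volume_lpBall hn hp, Ne, ENNReal.ofReal_eq_zero, not_le]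
  have h1 : 0 < Real.Gamma (1 / p + 1) := Real.Gamma_pos_of_pos (by positivity)
  have h2 : 0 < Real.Gamma (n / p + 1) := Real.Gamma_pos_of_pos (by positivity)
  positivity

theorem volume_lpBall_ne_top {n : ℕ} (hn : n ≠ 0) {p : ℝ} (hp : 1 ≤ p) :
    volume (lpBall n p) ≠ ∞ := by
  rw [volume_lpBall hn hp]
  exact ENNReal.ofReal_ne_top

theorem isProbabilityMeasure_uniformMeasure {n : ℕ} (hn : n ≠ 0) {p : ℝ} (hp : 1 ≤ p) :
    IsProbabilityMeasure (uniformMeasure n p) := by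
  refine ⟨?_⟩
  rw [uniformMeasure, Measure.smul_apply, Measure.restrict_apply_univ, smul_eq_mul,
    ENNReal.inv_mul_cancel (volume_lpBall_pos hn hp) (volume_lpBall_ne_top hn hp)]

theorem isProbabilityMeasure_coneMeasure {n : ℕ} (hn : n ≠ 0) {p : ℝ} (hp : 1 ≤ p) :
    IsProbabilityMeasure (coneMeasure n p) :=
  have := isProbabilityMeasure_uniformMeasure hn hp
  Measure.isProbabilityMeasure_map measurable_normalize.aemeasurable

/-- The radial part `n r^{n-1} dr` of Lebesgue measure in polar coordinates. -/
def radialMeasure (n : ℕ) : Measure ℝ :=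
  (volume.restrict (Set.Ioi 0)).withDensity fun r => ENNReal.ofReal (n * r ^ (n - 1))

theorem radialMeasure_Iic {n : ℕ} (hn : n ≠ 0) {r : ℝ} (hr : 0 ≤ r) :
    radialMeasure n (Set.Iic r) = ENNReal.ofReal (r ^ n) := by
  rw [radialMeasure, withDensity_apply _ measurableSet_Iic, Measure.restrict_restrict
    measurableSet_Iic, Set.inter_comm, Set.Ioi_inter_Iic, ← ofReal_integral_eq_lintegral_ofReal]
  · rw [← intervalIntegral.integral_of_le hr, intervalIntegral.integral_const_mul, integral_pow]
    have h1 : n - 1 + 1 = n := Nat.succ_pred_eq_of_ne_zero hn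
    have h2 : ((n - 1 : ℕ) : ℝ) + 1 = n := by exact_mod_cast h1
    rw [h1, h2, zero_pow hn, sub_zero, mul_div_cancel₀]
    exact_mod_cast hn
  · exact (Continuous.integrableOn_Icc (by fun_prop)).mono_set Set.Ioc_subset_Icc_self
  · filter_upwards [ae_restrict_mem measurableSet_Ioc] with x hx
    have := hx.1.le
    positivity

theorem radialMeasure_Iic_of_nonpos (n : ℕ) {r : ℝ} (hr : r ≤ 0) :
    radialMeasure n (Set.Iic r) = 0 := by
  rw [radialMeasure, withDensity_apply _ measurableSet_Iic, Measure.restrict_restrict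
    measurableSet_Iic, Set.inter_comm, Set.Ioi_inter_Iic, Set.Ioc_eq_empty (not_lt.2 hr)]
  simp

/-- Lebesgue measure in polar coordinates with respect to the `ℓ_p`-norm. -/
theorem map_polar_volume {n : ℕ} (hn : n ≠ 0) {p : ℝ} (hp : 1 ≤ p) :
    (volume : Measure (EuclideanSpace ℝ (Fin n))).map
        (fun x => (lpNorm p x, (lpNorm p x)⁻¹ • x)) =
      volume (lpBall n p) • (radialMeasure n).prod (coneMeasure n p) := by
  have hp0 : 0 < p := by linarith
  have := isProbabilityMeasure_coneMeasure hn hp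
  have hne : Nonempty (Fin n) := ⟨⟨0, Nat.pos_of_ne_zero hn⟩⟩
  have hB0 := volume_lpBall_pos hn hp
  have hBt := volume_lpBall_ne_top hn hp
  set Φ : EuclideanSpace ℝ (Fin n) → ℝ × EuclideanSpace ℝ (Fin n) :=
    fun x => (lpNorm p x, (lpNorm p x)⁻¹ • x) with hΦ
  have hΦm : Measurable Φ := measurable_lpNorm.prodMk measurable_normalize
  have hspan : (radialMeasure n).FiniteSpanningSetsIn (Set.range Set.Iic) :=
    { set := fun k => Set.Iic (k : ℝ)
      set_mem := fun k => ⟨_, rfl⟩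
      finite := fun k => by
        rw [radialMeasure_Iic hn (by positivity)]
        exact ENNReal.ofReal_lt_top
      spanning := by
        rw [Set.eq_univ_iff_forall]
        intro x
        obtain ⟨k, hk⟩ := exists_nat_ge x
        exact Set.mem_iUnion.2 ⟨k, hk⟩ }
  -- Uniqueness of product measures: it suffices to compare both sides on the rectangles `(-∞, r] ×
  -- A`.
  have key : (radialMeasure n).prod (coneMeasure n p) = (volume (lpBall n p))⁻¹ • volume.map Φ := by
    refine Measure.prod_eq_generateFrom 
      ((borel_eq_generateFrom_Iic ℝ).symm.trans (BorelSpace.measurable_eq (α := ℝ)).symm)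
      MeasurableSpace.generateFrom_measurableSet isPiSystem_Iic
      MeasurableSpace.isPiSystem_measurableSet hspan
      (coneMeasure n p).toFiniteSpanningSetsIn ?_
    rintro _ ⟨r, rfl⟩ A hA
    rw [Measure.smul_apply, smul_eq_mul, Measure.map_apply hΦm (measurableSet_Iic.prod hA)]
    rcases le_or_gt r 0 with hr | hr
    · rw [radialMeasure_Iic_of_nonpos n hr, zero_mul]
      have : Φ ⁻¹' (Set.Iic r ×ˢ A) ⊆ {0} := by
        rintro x ⟨hx, -⟩
        by_contra h0
        have := lpNorm_pos (p := p) h0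
        have : lpNorm p x ≤ r := hx
        linarith
      rw [measure_mono_null this (by simp), mul_zero]
    · rw [radialMeasure_Iic hn hr.le, coneMeasure, Measure.map_apply measurable_normalize hA,
        uniformMeasure, Measure.smul_apply, smul_eq_mul,
        Measure.restrict_apply (measurable_normalize hA)]
      -- The direction `x / ‖x‖_p` does not change under dilation, so this set is `r` times the
      -- corresponding subset of the unit ball, and its volume scales by `r ^ n`.
      have hpre : Φ ⁻¹' (Set.Iic r ×ˢ A) = (r⁻¹ • ·) ⁻¹'
          ((fun x => (lpNorm p x)⁻¹ • x) ⁻¹' A ∩ lpBall n p) := by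
        ext x
        have e1 : lpNorm p (r⁻¹ • x) = r⁻¹ * lpNorm p x := lpNorm_smul hp0 (by positivity) x
        have e2 : (lpNorm p (r⁻¹ • x))⁻¹ • r⁻¹ • x = (lpNorm p x)⁻¹ • x := by
          rw [e1, smul_smul]
          congr 1
          field_simp
        have e3 : lpNorm p (r⁻¹ • x) ≤ 1 ↔ lpNorm p x ≤ r := by
          rw [e1, inv_mul_le_iff₀ hr, mul_one]
        simp only [hΦ, Set.mem_preimage, Set.mem_prod, Set.mem_Iic, Set.mem_inter_iff, lpBall,
          Set.mem_ofPred_eq, e2, e3]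
        exact and_comm
      rw [hpre, Measure.addHaar_preimage_smul _ (inv_ne_zero hr.ne'), finrank_euclideanSpace_fin,
        abs_of_nonneg (by positivity), inv_pow, inv_inv]
      ring
  rw [key, smul_smul, ENNReal.mul_inv_cancel hB0 hBt, one_smul]

theorem lintegral_polar {n : ℕ} (hn : n ≠ 0) {p : ℝ} (hp : 1 ≤ p)
    {F : ℝ → EuclideanSpace ℝ (Fin n) → ℝ≥0∞} (hF : Measurable (Function.uncurry F)) :
    ∫⁻ x, F (lpNorm p x) ((lpNorm p x)⁻¹ • x) = volume (lpBall n p) *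
      ∫⁻ r in Set.Ioi 0, ENNReal.ofReal (n * r ^ (n - 1)) * ∫⁻ θ, F r θ ∂(coneMeasure n p) := by
  have := isProbabilityMeasure_coneMeasure hn hp
  have h := congrArg (fun μ => ∫⁻ z, Function.uncurry F z ∂μ) (map_polar_volume hn hp)
  rw [lintegral_map hF (measurable_lpNorm.prodMk measurable_normalize), lintegral_smul_measure,
    lintegral_prod _ hF.aemeasurable, radialMeasure, lintegral_withDensity_eq_lintegral_mul _
      (by fun_prop)] at h
  · exact h
  · exact hF.lintegral_prod_right'

/-! ### The `p`-generalized Gaussian distribution -/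

/-- The density of the `p`-generalized Gaussian distribution. -/
def pGaussPDF (p t : ℝ) : ℝ := (2 * Real.Gamma (1 / p + 1))⁻¹ * Real.exp (-|t| ^ p)

/-- The `p`-generalized Gaussian distribution, with density proportional to `exp (-|t| ^ p)`. -/
def pGauss (p : ℝ) : Measure ℝ := volume.withDensity fun t => ENNReal.ofReal (pGaussPDF p t)

theorem measurable_pGaussPDF (p : ℝ) : Measurable (pGaussPDF p) := by
  unfold pGaussPDF
  fun_prop

theorem pGaussPDF_pos {p : ℝ} (hp : 0 < p) (t : ℝ) : 0 < pGaussPDF p t := by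
  have h : 0 < Real.Gamma (1 / p + 1) := Real.Gamma_pos_of_pos (by positivity)
  unfold pGaussPDF
  positivity

theorem integral_abs_rpow_mul_exp {p : ℝ} (hp : 0 < p) {q : ℝ} (hq : 0 ≤ q) :
    ∫ t : ℝ, |t| ^ q * Real.exp (-|t| ^ p) = 2 * ((1 / p) * Real.Gamma ((q + 1) / p)) := by
  rw [integral_comp_abs (f := fun t => t ^ q * Real.exp (-t ^ p)),
    integral_rpow_mul_exp_neg_rpow hp (by linarith)]

/-- The Bochner integral of a non-integrable function is 0 by convention, so the nonzero value of
the integral proves integrability. -/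
theorem integrable_abs_rpow_mul_exp {p : ℝ} (hp : 0 < p) {q : ℝ} (hq : 0 ≤ q) :
    Integrable fun t : ℝ => |t| ^ q * Real.exp (-|t| ^ p) := by
  refine Integrable.of_integral_ne_zero ?_
  rw [integral_abs_rpow_mul_exp hp hq]
  have : 0 < Real.Gamma ((q + 1) / p) := Real.Gamma_pos_of_pos (by positivity)
  positivity

theorem integrable_pGaussPDF {p : ℝ} (hp : 0 < p) : Integrable (pGaussPDF p) := by
  have h := (integrable_abs_rpow_mul_exp hp le_rfl).const_mul (2 * Real.Gamma (1 / p + 1))⁻¹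
  refine h.congr (Eventually.of_forall fun t => ?_)
  simp [pGaussPDF]

theorem integrable_pGauss_iff {p : ℝ} (hp : 0 < p) {f : ℝ → ℝ} :
    Integrable f (pGauss p) ↔ Integrable fun t => pGaussPDF p t * f t := by
  rw [pGauss, integrable_withDensity_iff_integrable_smul'
    (measurable_pGaussPDF p).ennreal_ofReal (Eventually.of_forall fun t => ENNReal.ofReal_lt_top)]
  simp only [ENNReal.toReal_ofReal (pGaussPDF_pos hp _).le, smul_eq_mul]

theorem integral_pGauss {p : ℝ} (hp : 0 < p) (f : ℝ → ℝ) :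
    ∫ t, f t ∂(pGauss p) = ∫ t, pGaussPDF p t * f t := by
  rw [pGauss, integral_withDensity_eq_integral_toReal_smul
    (measurable_pGaussPDF p).ennreal_ofReal (Eventually.of_forall fun t => ENNReal.ofReal_lt_top)]
  simp only [ENNReal.toReal_ofReal (pGaussPDF_pos hp _).le, smul_eq_mul]

theorem integrable_abs_rpow_pGauss {p : ℝ} (hp : 0 < p) {q : ℝ} (hq : 0 ≤ q) :
    Integrable (fun t => |t| ^ q) (pGauss p) := by
  rw [integrable_pGauss_iff hp]
  have h := (integrable_abs_rpow_mul_exp hp hq).const_mul (2 * Real.Gamma (1 / p + 1))⁻¹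
  refine h.congr (Eventually.of_forall fun t => ?_)
  simp only [pGaussPDF]
  ring

theorem integral_abs_rpow_pGauss {p : ℝ} (hp : 0 < p) {q : ℝ} (hq : 0 ≤ q) :
    ∫ t, |t| ^ q ∂(pGauss p) = Real.Gamma ((q + 1) / p) / Real.Gamma (1 / p) := by
  have e : ∀ t, pGaussPDF p t * |t| ^ q =
      (2 * Real.Gamma (1 / p + 1))⁻¹ * (|t| ^ q * Real.exp (-|t| ^ p)) := by
    intro t
    simp only [pGaussPDF]
    ring
  have h : 0 < Real.Gamma (1 / p) := Real.Gamma_pos_of_pos (by positivity)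
  rw [integral_pGauss hp]
  simp_rw [e]
  rw [integral_const_mul, integral_abs_rpow_mul_exp hp hq, Real.Gamma_add_one (by positivity)]
  field_simp

theorem isProbabilityMeasure_pGauss {p : ℝ} (hp : 0 < p) : IsProbabilityMeasure (pGauss p) := by
  refine ⟨?_⟩
  have h1 := integral_abs_rpow_pGauss hp le_rfl
  have h2 : 0 < Real.Gamma (1 / p) := Real.Gamma_pos_of_pos (by positivity)
  rw [integral_pGauss hp, zero_add, div_self h2.ne'] at h1
  simp only [Real.rpow_zero, mul_one] at h1
  rw [pGauss, withDensity_apply _ MeasurableSet.univ, Measure.restrict_univ,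
    ← ofReal_integral_eq_lintegral_ofReal (integrable_pGaussPDF hp)
      (Eventually.of_forall fun t => (pGaussPDF_pos hp t).le), h1, ENNReal.ofReal_one]

theorem pi_withDensity_ofReal (n : ℕ) {f : ℝ → ℝ} (hf0 : ∀ t, 0 ≤ f t) (hfi : Integrable f) :
    Measure.pi (fun _ : Fin n => volume.withDensity fun t => ENNReal.ofReal (f t)) =
      volume.withDensity fun x : Fin n → ℝ => ENNReal.ofReal (∏ i, f (x i)) := by
  have hfin : IsFiniteMeasure (volume.withDensity fun t => ENNReal.ofReal (f t)) :=
    isFiniteMeasure_withDensity_ofReal hfi.2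
  refine (Measure.pi_eq fun s hs => ?_)
  rw [withDensity_apply _ (MeasurableSet.univ_pi hs), volume_pi, Measure.restrict_pi_pi,
    ← ofReal_integral_eq_lintegral_ofReal (Integrable.fintype_prod fun i => hfi.restrict)
      (Eventually.of_forall fun x => Finset.prod_nonneg fun i _ => hf0 _),
    integral_fintype_prod_eq_prod, ENNReal.ofReal_prod_of_nonneg
      (fun i _ => integral_nonneg fun t => hf0 t)]
  refine Finset.prod_congr rfl fun i _ => ?_
  rw [withDensity_apply _ (hs i), ← ofReal_integral_eq_lintegral_ofReal hfi.restrict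
    (Eventually.of_forall hf0)]

theorem lpNorm_rpow {n : ℕ} {p : ℝ} (hp : 0 < p) (x : EuclideanSpace ℝ (Fin n)) :
    lpNorm p x ^ p = ∑ i, |x i| ^ p := by
  rw [lpNorm, ← Real.rpow_mul (Finset.sum_nonneg fun i _ => by positivity),
    one_div_mul_cancel hp.ne', Real.rpow_one]

theorem lintegral_pi_pGauss {n : ℕ} {p : ℝ} (hp : 0 < p)
    {F : EuclideanSpace ℝ (Fin n) → ℝ≥0∞} (hF : Measurable F) :
    ∫⁻ g, F (WithLp.toLp 2 g) ∂(Measure.pi fun _ : Fin n => pGauss p) =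
      ∫⁻ x, ENNReal.ofReal (((2 * Real.Gamma (1 / p + 1)) ^ n)⁻¹ *
        Real.exp (-(lpNorm p x) ^ p)) * F x := by
  have h1 : Measurable fun x : Fin n → ℝ => ENNReal.ofReal (∏ i, pGaussPDF p (x i)) :=
    (Finset.measurable_prod _ fun i _ =>
      (measurable_pGaussPDF p).comp (measurable_pi_apply i)).ennreal_ofReal
  have h2 : Measurable fun g : Fin n → ℝ => F (WithLp.toLp 2 g) :=
    hF.comp (PiLp.volume_preserving_toLp (Fin n)).measurable
  have h3 : Measurable fun x : EuclideanSpace ℝ (Fin n) =>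
      ENNReal.ofReal (((2 * Real.Gamma (1 / p + 1)) ^ n)⁻¹ *
        Real.exp (-(lpNorm p x) ^ p)) * F x := by
    have := measurable_lpNorm (n := n) (p := p)
    fun_prop
  rw [← (PiLp.volume_preserving_toLp (Fin n)).lintegral_comp h3]
  unfold pGauss
  rw [pi_withDensity_ofReal n (fun t => (pGaussPDF_pos hp t).le) (integrable_pGaussPDF hp),
    lintegral_withDensity_eq_lintegral_mul _ h1 h2]
  refine lintegral_congr fun x => ?_
  simp only [Pi.mul_apply, lpNorm_rpow hp, pGaussPDF, Finset.prod_mul_distrib, Finset.prod_const,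
    Finset.card_univ, Fintype.card_fin, ← Real.exp_sum, Finset.sum_neg_distrib, inv_pow]

/-! ### Probabilistic representation of `𝐏_{n,p,𝐖}` -/

theorem rpow_neg_one_div_rpow {p x : ℝ} (hp : 0 < p) (hx : 0 < x) :
    (x ^ (-(1 / p))) ^ p = x⁻¹ := by
  rw [← Real.rpow_mul hx.le, neg_mul, one_div_mul_cancel hp.ne', Real.rpow_neg_one]

theorem rpow_one_div_rpow {p x : ℝ} (hp : 0 < p) (hx : 0 ≤ x) : (x ^ (1 / p)) ^ p = x := by
  rw [← Real.rpow_mul hx, one_div_mul_cancel hp.ne', Real.rpow_one]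

theorem rpow_rpow_one_div {p x : ℝ} (hp : 0 < p) (hx : 0 ≤ x) : (x ^ p) ^ (1 / p) = x := by
  rw [← Real.rpow_mul hx, mul_one_div_cancel hp.ne', Real.rpow_one]

/-- The substitution inverts `ρ ↦ ρ / (ρ ^ p + s) ^ (1/p)`, a bijection from `(0, ∞)` to `(0, 1)`.
Its inverse `ψ` satisfies `ψ(r) ^ p = r ^ p s / (1 - r ^ p)`, the exponent that occurs in `h`. The
Jacobian together with `ψ(r) ^ (n-1)` produces `s ^ (n/p) (1 - r ^ p) ^ (-(1 + n/p))`. The case `s =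
0` is excluded, since all mass then goes to the sphere. -/
theorem lintegral_radial_substitution {n : ℕ} (hn : n ≠ 0) {p s : ℝ} (hp : 0 < p) (hs : 0 < s)
    (φ : ℝ → ℝ≥0∞) :
    ∫⁻ r in Set.Ioi 0, ENNReal.ofReal (n * r ^ (n - 1) * Real.exp (-r ^ p)) *
        φ ((r ^ p + s) ^ (-(1 / p)) * r) =
      ∫⁻ r in Set.Ioo 0 1, ENNReal.ofReal (n * r ^ (n - 1) * (1 / (1 - r ^ p) ^ (1 + n / p)) *
        (s ^ ((n : ℝ) / p) * Real.exp (-(r ^ p * s / (1 - r ^ p))))) * φ r := by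
  set ψ : ℝ → ℝ := fun r => s ^ (1 / p) * (r * (1 - r ^ p) ^ (-(1 / p))) with hψ
  have hu : ∀ r ∈ Set.Ioo (0 : ℝ) 1, 0 < 1 - r ^ p := fun r hr => by
    have := Real.rpow_lt_one hr.1.le hr.2 hp
    linarith
  have hψp : ∀ r ∈ Set.Ioo (0 : ℝ) 1, ψ r ^ p = r ^ p * s / (1 - r ^ p) := by
    intro r hr
    have h1 := hu r hr
    have h0 := hr.1.le
    rw [hψ, Real.mul_rpow (by positivity) (by positivity), Real.mul_rpow h0 (by positivity),
      rpow_one_div_rpow hp hs.le, rpow_neg_one_div_rpow hp h1]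
    field_simp
  have hχψ : ∀ r ∈ Set.Ioo (0 : ℝ) 1, (ψ r ^ p + s) ^ (-(1 / p)) * ψ r = r := by
    intro r hr
    have h1 := hu r hr
    have e : ψ r ^ p + s = s / (1 - r ^ p) := by
      rw [hψp r hr]
      field_simp
      ring
    rw [e, hψ, Real.div_rpow hs.le h1.le, Real.rpow_neg hs.le]
    have a1 : 0 < s ^ (1 / p) := by positivity
    have a2 : 0 < (1 - r ^ p) ^ (-(1 / p)) := by positivity
    field_simp
  have hψpos : ∀ r ∈ Set.Ioo (0 : ℝ) 1, 0 < ψ r := by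
    intro r hr
    have h1 := hu r hr
    have h0 := hr.1
    rw [hψ]
    positivity
  have hinj : Set.InjOn ψ (Set.Ioo 0 1) := by
    intro r hr r' hr' h
    rw [← hχψ r hr, ← hχψ r' hr', h]
  have himg : ψ '' Set.Ioo 0 1 = Set.Ioi 0 := by
    refine Set.Subset.antisymm ?_ ?_
    · rintro _ ⟨r, hr, rfl⟩
      exact hψpos r hr
    · intro r hr
      have hr0 : 0 < r := hr
      have hD : 0 < r ^ p + s := by positivity
      have e : ((r ^ p + s) ^ (-(1 / p)) * r) ^ p = r ^ p / (r ^ p + s) := by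
        rw [Real.mul_rpow (by positivity) hr0.le, rpow_neg_one_div_rpow hp hD]
        field_simp
      have e2 : 1 - ((r ^ p + s) ^ (-(1 / p)) * r) ^ p = s / (r ^ p + s) := by
        rw [e]
        field_simp
        ring
      refine ⟨(r ^ p + s) ^ (-(1 / p)) * r, ⟨by positivity, ?_⟩, ?_⟩
      · rw [← Real.rpow_lt_rpow_iff (by positivity) zero_le_one hp, e, Real.one_rpow,
          div_lt_one hD]
        linarith
      · simp only [hψ]
        rw [e2, Real.div_rpow hs.le hD.le, Real.rpow_neg hs.le]
        have a1 : 0 < s ^ (1 / p) := by positivity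
        have a2 : 0 < (r ^ p + s) ^ (-(1 / p)) := by positivity
        field_simp
  have hderiv : ∀ r ∈ Set.Ioo (0 : ℝ) 1, HasDerivWithinAt ψ
      (s ^ (1 / p) * ((1 - r ^ p) ^ (-(1 / p)) * (1 - r ^ p)⁻¹)) (Set.Ioo 0 1) r := by
    intro r hr
    have h1 := hu r hr
    have d1 : HasDerivAt (fun r : ℝ => 1 - r ^ p) (-(p * r ^ (p - 1))) r :=
      (Real.hasDerivAt_rpow_const (Or.inl hr.1.ne')).const_sub 1
    have d2 := d1.rpow_const (p := -(1 / p)) (Or.inl h1.ne')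
    have d3 := ((hasDerivAt_id r).mul d2).const_mul (s ^ (1 / p))
    refine (d3.congr_deriv ?_).hasDerivWithinAt
    congr 1
    have e1 : (1 - r ^ p) ^ (-(1 / p) - 1) = (1 - r ^ p) ^ (-(1 / p)) * (1 - r ^ p)⁻¹ := by
      rw [Real.rpow_sub h1, Real.rpow_one, div_eq_mul_inv]
    have e2 : r * r ^ (p - 1) = r ^ p := by
      rw [Real.rpow_sub_one hr.1.ne']
      have := hr.1.ne'
      field_simp
    simp only [id]
    rw [e1]
    calc _ = (1 - r ^ p) ^ (-(1 / p)) * (1 + (r * r ^ (p - 1)) * (1 - r ^ p)⁻¹) := by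
          field_simp
      _ = _ := by
          rw [e2]
          field_simp
          ring
  rw [← himg, lintegral_image_eq_lintegral_abs_deriv_mul measurableSet_Ioo hderiv hinj]
  refine setLIntegral_congr_fun measurableSet_Ioo fun r hr => ?_
  have h1 := hu r hr
  have h0 := hr.1
  rw [hχψ r hr, hψp r hr, ← mul_assoc, ← ENNReal.ofReal_mul (abs_nonneg _),
    abs_of_nonneg (by positivity)]
  congr 2
  -- The Jacobian supplies the `n`-th copy of `s ^ (1/p) (1 - r ^ p) ^ (-1/p)`.
  have en : ψ r ^ (n - 1) * (s ^ (1 / p) * (1 - r ^ p) ^ (-(1 / p))) =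
      r ^ (n - 1) * (s ^ ((n : ℝ) / p) * ((1 - r ^ p) ^ (n / p))⁻¹) := by
    have p1 : s ^ ((n : ℝ) / p) = (s ^ (1 / p)) ^ n := by
      rw [← Real.rpow_natCast, ← Real.rpow_mul hs.le]
      congr 1
      ring
    have p2 : ((1 - r ^ p) ^ (n / p))⁻¹ = ((1 - r ^ p) ^ (-(1 / p))) ^ n := by
      rw [← Real.rpow_natCast, ← Real.rpow_mul h1.le, ← Real.rpow_neg h1.le]
      congr 1
      ring
    rw [p1, p2]
    obtain ⟨m, rfl⟩ := Nat.exists_eq_succ_of_ne_zero hn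
    simp only [hψ, Nat.succ_eq_add_one, Nat.add_sub_cancel]
    ring
  have e3 : (1 - r ^ p) ^ (1 + (n : ℝ) / p) = (1 - r ^ p) * (1 - r ^ p) ^ ((n : ℝ) / p) := by
    rw [Real.rpow_add h1, Real.rpow_one]
  rw [e3, one_div ((1 - r ^ p) * (1 - r ^ p) ^ ((n : ℝ) / p)), mul_inv]
  calc _ = n * (ψ r ^ (n - 1) * (s ^ (1 / p) * (1 - r ^ p) ^ (-(1 / p)))) * (1 - r ^ p)⁻¹ *
        Real.exp (-(r ^ p * s / (1 - r ^ p))) := by ring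
    _ = _ := by
        rw [en]
        ring

theorem lintegral_radial_gamma {n : ℕ} (hn : n ≠ 0) {p : ℝ} (hp : 0 < p) :
    ∫⁻ r in Set.Ioi 0, ENNReal.ofReal (n * r ^ (n - 1) * Real.exp (-r ^ p)) =
      ENNReal.ofReal (Real.Gamma (n / p + 1)) := by
  have hn0 : (0 : ℝ) < n := by exact_mod_cast Nat.pos_of_ne_zero hn
  have hq : -1 < (n : ℝ) - 1 := by linarith
  have hI := integral_rpow_mul_exp_neg_rpow hp hq
  have hG : 0 < Real.Gamma ((n : ℝ) / p) := Real.Gamma_pos_of_pos (by positivity)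
  rw [sub_add_cancel] at hI
  have hint : IntegrableOn (fun r : ℝ => r ^ ((n : ℝ) - 1) * Real.exp (-r ^ p)) (Set.Ioi 0) := by
    refine Integrable.of_integral_ne_zero ?_
    rw [hI]
    positivity
  have e : ∀ r ∈ Set.Ioi (0 : ℝ), ENNReal.ofReal (n * r ^ (n - 1) * Real.exp (-r ^ p)) =
      ENNReal.ofReal (n * (r ^ ((n : ℝ) - 1) * Real.exp (-r ^ p))) := by
    intro r _
    rw [mul_assoc]
    congr 3
    rw [← Real.rpow_natCast, Nat.cast_sub (Nat.one_le_iff_ne_zero.2 hn), Nat.cast_one]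
  rw [setLIntegral_congr_fun measurableSet_Ioi e, ← ofReal_integral_eq_lintegral_ofReal
    (hint.const_mul _), integral_const_mul, hI, Real.Gamma_add_one (by positivity)]
  · congr 1
    field_simp
  · filter_upwards [ae_restrict_mem measurableSet_Ioi] with r hr
    have : 0 < r := hr
    positivity

theorem measurable_radialDensity (n : ℕ) (p : ℝ) (W : Measure ℝ≥0) [SFinite W] :
    Measurable (radialDensity n p W) := by
  unfold radialDensity
  refine Measurable.mul (by fun_prop) ?_
  refine Measurable.lintegral_prod_right'
    (f := fun z : ℝ × ℝ≥0 => ENNReal.ofReal ((z.2 : ℝ) ^ ((n : ℝ) / p) *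
      Real.exp (-(z.1 ^ p * z.2 / (1 - z.1 ^ p))))) ?_
  fun_prop

/-- In polar coordinates both parts have the cone measure as law of the direction; only the radius
differs, being 1 in the first part. The sphere `r = 1` is null for the second part, hence the open
interval. -/
theorem lintegral_ballMeasure {n : ℕ} (hn : n ≠ 0) {p : ℝ} (hp : 1 ≤ p) (W : Measure ℝ≥0)
    [SFinite W] {f : EuclideanSpace ℝ (Fin n) → ℝ≥0∞} (hf : Measurable f) :
    ∫⁻ x, f x ∂(ballMeasure n p W) = W {0} * ∫⁻ θ, f θ ∂(coneMeasure n p) +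
      ∫⁻ r in Set.Ioo 0 1, ENNReal.ofReal (n * r ^ (n - 1)) *
        (radialDensity n p W r * ∫⁻ θ, f (r • θ) ∂(coneMeasure n p)) := by
  have hp0 : 0 < p := by linarith
  have := isProbabilityMeasure_coneMeasure hn hp
  have hne : Nonempty (Fin n) := ⟨⟨0, Nat.pos_of_ne_zero hn⟩⟩
  have hB0 := volume_lpBall_pos hn hp
  have hBt := volume_lpBall_ne_top hn hp
  have hd := measurable_radialDensity n p W
  have hdn : Measurable fun x : EuclideanSpace ℝ (Fin n) => radialDensity n p W (lpNorm p x) :=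
    hd.comp measurable_lpNorm
  rw [ballMeasure, lintegral_add_measure, lintegral_smul_measure, smul_eq_mul,
    lintegral_withDensity_eq_lintegral_mul _ hdn hf, uniformMeasure, lintegral_smul_measure]
  congr 1
  set F : ℝ → EuclideanSpace ℝ (Fin n) → ℝ≥0∞ := fun r θ =>
    (Set.Iic 1).indicator (radialDensity n p W) r * f (r • θ) with hF
  have hFm : Measurable (Function.uncurry F) := by
    refine ((hd.indicator measurableSet_Iic).comp measurable_fst).mul (hf.comp ?_)
    exact measurable_fst.smul measurable_snd
  have e1 : ∫⁻ x in lpBall n p, ((fun x : EuclideanSpace ℝ (Fin n) => radialDensity n p W (lpNorm p x)) * f) x =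
      ∫⁻ x, F (lpNorm p x) ((lpNorm p x)⁻¹ • x) := by
    rw [← lintegral_indicator (measurableSet_lpBall n p)]
    have h0 : ∀ᵐ x : EuclideanSpace ℝ (Fin n), x ≠ 0 := by
      simp [ae_iff]
    refine lintegral_congr_ae ?_
    filter_upwards [h0] with x hx
    have hpos := lpNorm_pos (p := p) hx
    simp only [hF, smul_inv_smul₀ hpos.ne']
    by_cases h : lpNorm p x ≤ 1
    · rw [Set.indicator_of_mem (show x ∈ lpBall n p from h),
        Set.indicator_of_mem (show lpNorm p x ∈ Set.Iic 1 from h)]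
      rfl
    · rw [Set.indicator_of_notMem (show x ∉ lpBall n p from h),
        Set.indicator_of_notMem (show lpNorm p x ∉ Set.Iic 1 from h), zero_mul]
  rw [e1, lintegral_polar hn hp hFm, smul_eq_mul, ← mul_assoc, ENNReal.inv_mul_cancel hB0 hBt,
    one_mul]
  have e2 : ∀ r, ENNReal.ofReal (n * r ^ (n - 1)) * ∫⁻ θ, F r θ ∂(coneMeasure n p) =
      (Set.Iic 1).indicator (fun r => ENNReal.ofReal (n * r ^ (n - 1)) *
        (radialDensity n p W r * ∫⁻ θ, f (r • θ) ∂(coneMeasure n p))) r := by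
    intro r
    by_cases h : r ∈ Set.Iic (1 : ℝ)
    · rw [Set.indicator_of_mem h]
      simp only [hF, Set.indicator_of_mem h]
      rw [lintegral_const_mul]
      exact hf.comp (measurable_id.const_smul r)
    · rw [Set.indicator_of_notMem h]
      simp only [hF, Set.indicator_of_notMem h, zero_mul, lintegral_zero, mul_zero]
  simp_rw [e2]
  rw [lintegral_indicator measurableSet_Iic, Measure.restrict_restrict measurableSet_Iic,
    Set.inter_comm, Set.Ioi_inter_Iic]
  exact setLIntegral_congr Ioo_ae_eq_Ioc.symm

/-- If `G` has independent `p`-generalized Gaussian coordinates and `w` has law `W` and is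
independent of `G`, then `G / (‖G‖_p ^ p + w) ^ (1/p)` has law `𝐏_{n,p,𝐖}`. -/
theorem map_pGauss_eq_ballMeasure {n : ℕ} (hn : n ≠ 0) {p : ℝ} (hp : 1 ≤ p) (W : Measure ℝ≥0)
    [IsProbabilityMeasure W] :
    ((Measure.pi fun _ : Fin n => pGauss p).prod W).map (fun z =>
      ((∑ i, |z.1 i| ^ p + (z.2 : ℝ)) ^ (-(1 / p)) • WithLp.toLp 2 z.1 :
        EuclideanSpace ℝ (Fin n))) = ballMeasure n p W := by
  have hp0 : 0 < p := by linarith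
  have := isProbabilityMeasure_pGauss hp0
  have := isProbabilityMeasure_coneMeasure hn hp
  have hne : Nonempty (Fin n) := ⟨⟨0, Nat.pos_of_ne_zero hn⟩⟩
  have htoLp := (PiLp.volume_preserving_toLp (Fin n)).measurable
  have hmap : Measurable fun z : (Fin n → ℝ) × ℝ≥0 =>
      ((∑ i, |z.1 i| ^ p + (z.2 : ℝ)) ^ (-(1 / p)) • WithLp.toLp 2 z.1 :
        EuclideanSpace ℝ (Fin n)) := by
    have h1 : Measurable fun z : (Fin n → ℝ) × ℝ≥0 =>
        (∑ i, |z.1 i| ^ p + (z.2 : ℝ)) ^ (-(1 / p)) := by fun_prop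
    exact h1.smul (htoLp.comp measurable_fst)
  refine Measure.ext_of_lintegral _ fun f hf => ?_
  set φ : ℝ → ℝ≥0∞ := fun r => ∫⁻ θ, f (r • θ) ∂(coneMeasure n p) with hφ
  have hφm : Measurable φ := by
    refine Measurable.lintegral_prod_right'
      (f := fun z : ℝ × EuclideanSpace ℝ (Fin n) => f (z.1 • z.2)) ?_
    exact hf.comp (measurable_fst.smul measurable_snd)
  have hφ1 : ∫⁻ θ, f θ ∂(coneMeasure n p) = φ 1 := by simp [hφ]
  rw [lintegral_ballMeasure hn hp W hf, hφ1, lintegral_map hf hmap,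
    lintegral_prod_symm _ (show AEMeasurable (fun z : (Fin n → ℝ) × ℝ≥0 =>
      f ((∑ i, |z.1 i| ^ p + (z.2 : ℝ)) ^ (-(1 / p)) • WithLp.toLp 2 z.1)) _ from
        (hf.comp hmap).aemeasurable)]
  set γ : ℝ := 1 / Real.Gamma (n / p + 1) with hγ
  have hΓ : 0 < Real.Gamma (n / p + 1) := Real.Gamma_pos_of_pos (by positivity)
  have hγ0 : 0 < γ := by positivity
  -- For fixed `w` the weight depends on `G` only through its radius, so polar coordinates separate
  -- a direction with the cone law from a radial integral.
  have step1 : ∀ w : ℝ≥0, ∫⁻ g, f ((∑ i, |g i| ^ p + (w : ℝ)) ^ (-(1 / p)) • WithLp.toLp 2 g)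
      ∂(Measure.pi fun _ : Fin n => pGauss p) =
      ENNReal.ofReal γ * ∫⁻ r in Set.Ioi 0, ENNReal.ofReal (n * r ^ (n - 1) *
        Real.exp (-r ^ p)) * φ ((r ^ p + w) ^ (-(1 / p)) * r) := by
    intro w
    have hm : Measurable fun x : EuclideanSpace ℝ (Fin n) =>
        f ((lpNorm p x ^ p + (w : ℝ)) ^ (-(1 / p)) • x) := by
      have h0 := measurable_lpNorm (n := n) (p := p)
      have h1 : Measurable fun x : EuclideanSpace ℝ (Fin n) =>
          (lpNorm p x ^ p + (w : ℝ)) ^ (-(1 / p)) := by fun_prop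
      exact hf.comp (h1.smul measurable_id)
    have h1 := lintegral_pi_pGauss hp0 hm
    simp only [lpNorm_rpow hp0] at h1
    rw [h1]
    set F : ℝ → EuclideanSpace ℝ (Fin n) → ℝ≥0∞ := fun r θ =>
      ENNReal.ofReal (((2 * Real.Gamma (1 / p + 1)) ^ n)⁻¹ * Real.exp (-r ^ p)) *
        f (((r ^ p + (w : ℝ)) ^ (-(1 / p)) * r) • θ) with hF
    have hFm : Measurable (Function.uncurry F) := by
      have h1 : Measurable fun z : ℝ × EuclideanSpace ℝ (Fin n) =>
          (z.1 ^ p + (w : ℝ)) ^ (-(1 / p)) * z.1 := by fun_prop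
      exact Measurable.mul (by fun_prop) (hf.comp (h1.smul measurable_snd))
    have e1 : ∫⁻ x : EuclideanSpace ℝ (Fin n),
        ENNReal.ofReal (((2 * Real.Gamma (1 / p + 1)) ^ n)⁻¹ * Real.exp (-∑ i, |x i| ^ p)) *
          f ((∑ i, |x i| ^ p + (w : ℝ)) ^ (-(1 / p)) • x) =
        ∫⁻ x, F (lpNorm p x) ((lpNorm p x)⁻¹ • x) := by
      have h0 : ∀ᵐ x : EuclideanSpace ℝ (Fin n), x ≠ 0 := by
        simp [ae_iff]
      refine lintegral_congr_ae ?_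
      filter_upwards [h0] with x hx
      have hpos := lpNorm_pos (p := p) hx
      simp only [hF, lpNorm_rpow hp0, smul_smul, mul_assoc, mul_inv_cancel₀ hpos.ne', mul_one]
    rw [e1, lintegral_polar hn hp hFm, volume_lpBall hn hp,
      ← lintegral_const_mul' _ _ ENNReal.ofReal_ne_top,
      ← lintegral_const_mul' _ _ ENNReal.ofReal_ne_top]
    refine setLIntegral_congr_fun measurableSet_Ioi fun r hr => ?_
    have hr0 : 0 < r := hr
    simp only [hF]
    rw [lintegral_const_mul' _ _ ENNReal.ofReal_ne_top]
    have hg1 : 0 < Real.Gamma (1 / p + 1) := Real.Gamma_pos_of_pos (by positivity)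
    rw [← mul_assoc, ← mul_assoc, ← mul_assoc, ← ENNReal.ofReal_mul (by positivity),
      ← ENNReal.ofReal_mul (by positivity), ← ENNReal.ofReal_mul (by positivity)]
    congr 2
    rw [hγ]
    field_simp
  have step2 : ∀ w : ℝ≥0, ∫⁻ g, f ((∑ i, |g i| ^ p + (w : ℝ)) ^ (-(1 / p)) • WithLp.toLp 2 g)
      ∂(Measure.pi fun _ : Fin n => pGauss p) =
      ({0} : Set ℝ≥0).indicator (fun _ => φ 1) w +
        ∫⁻ r in Set.Ioo 0 1, ENNReal.ofReal (n * r ^ (n - 1)) * φ r *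
          (ENNReal.ofReal (γ * (1 / (1 - r ^ p) ^ (1 + n / p))) *
          ENNReal.ofReal ((w : ℝ) ^ ((n : ℝ) / p) *
            Real.exp (-(r ^ p * w / (1 - r ^ p))))) := by
    intro w
    have hn0 : (0 : ℝ) < n := by exact_mod_cast Nat.pos_of_ne_zero hn
    rw [step1 w]
    rcases eq_or_ne w 0 with rfl | hw
    -- For `w = 0` the rescaled radius is identically 1, which gives the cone part. As `n / p > 0`,
    -- the factor `w ^ (n/p)` vanishes and the density part contributes nothing.
    · have hz : (0 : ℝ) ^ ((n : ℝ) / p) = 0 := Real.zero_rpow (by positivity)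
      simp only [NNReal.coe_zero, hz, zero_mul, ENNReal.ofReal_zero, mul_zero, lintegral_zero, add_zero,
        Set.indicator_of_mem (Set.mem_singleton (0 : ℝ≥0))]
      have e : ∀ r ∈ Set.Ioi (0 : ℝ), ENNReal.ofReal (n * r ^ (n - 1) * Real.exp (-r ^ p)) *
          φ ((r ^ p) ^ (-(1 / p)) * r) =
          φ 1 * ENNReal.ofReal (n * r ^ (n - 1) * Real.exp (-r ^ p)) := by
        intro r hr
        have hr0 : 0 < r := hr
        rw [Real.rpow_neg (by positivity), rpow_rpow_one_div hp0 hr0.le,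
          inv_mul_cancel₀ hr0.ne', mul_comm]
      rw [setLIntegral_congr_fun measurableSet_Ioi e, lintegral_const_mul _ (by fun_prop),
        lintegral_radial_gamma hn hp0, mul_left_comm, ← ENNReal.ofReal_mul hγ0.le, hγ,
        one_div_mul_cancel hΓ.ne', ENNReal.ofReal_one, mul_one]
    · have hw0 : (0 : ℝ) < w := by positivity
      rw [Set.indicator_of_notMem (by simpa using hw), zero_add,
        lintegral_radial_substitution hn hp0 hw0,
        ← lintegral_const_mul' _ _ ENNReal.ofReal_ne_top]
      refine setLIntegral_congr_fun measurableSet_Ioo fun r hr => ?_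
      have hr0 := hr.1
      have hu : 0 < 1 - r ^ p := by
        have := Real.rpow_lt_one hr.1.le hr.2 hp0
        linarith
      rw [← mul_assoc, ← ENNReal.ofReal_mul (by positivity), ← ENNReal.ofReal_mul (by positivity),
        mul_right_comm (ENNReal.ofReal (n * r ^ (n - 1))), ← ENNReal.ofReal_mul (by positivity)]
      congr 2
      ring
  simp_rw [step2]
  rw [lintegral_add_left (measurable_const.indicator (measurableSet_singleton _))]
  congr 1
  · rw [lintegral_indicator (measurableSet_singleton _), setLIntegral_const, mul_comm]
  -- By Tonelli the integral over `w` moves inside, where it assembles the integral that defines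
  -- `h`.
  · rw [lintegral_lintegral_swap]
    · refine setLIntegral_congr_fun measurableSet_Ioo fun r hr => ?_
      rw [lintegral_const_mul _ (by fun_prop), lintegral_const_mul _ (by fun_prop), radialDensity,
        hγ, add_comm ((n : ℝ) / p) 1]
      simp only [hφ]
      ring
    · refine Measurable.aemeasurable ?_
      simp only [Function.uncurry_def]
      have h1 : Measurable fun z : ℝ≥0 × ℝ => φ z.2 := hφm.comp measurable_snd
      fun_prop

/-! ### The length of the projection onto a random subspace -/

instance (n : ℕ) : (haarOrthogonal n).IsMulLeftInvariant :=
  inferInstanceAs (Measure.haarMeasure (⊤ : TopologicalSpace.PositiveCompacts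
    (Matrix.orthogonalGroup (Fin n) ℝ))).IsMulLeftInvariant

theorem norm_proj_rotate {n k : ℕ} (T : Matrix.orthogonalGroup (Fin n) ℝ) (E : Gr n k)
    (x : EuclideanSpace ℝ (Fin n)) :
    ‖(rotate T E).proj x‖ = ‖E.proj ((isometryOf T).symm x)‖ := by
  have h : (rotate T E).proj x = isometryOf T (E.proj ((isometryOf T).symm x)) :=
    Submodule.starProjection_map_apply (isometryOf T) E.1 x
  rw [h, LinearIsometryEquiv.norm_map]

theorem isometryOf_symm_inv_mul {n : ℕ} (S T : Matrix.orthogonalGroup (Fin n) ℝ)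
    (x : EuclideanSpace ℝ (Fin n)) :
    (isometryOf (S⁻¹ * T)).symm x = (isometryOf T).symm (isometryOf S x) := by
  rw [isometryOf_symm_apply, isometryOf_symm_apply, isometryOf_apply]
  have h : star (S⁻¹ * T).1 = star T.1 * S.1 := by
    have : (S⁻¹ * T).1 = star S.1 * T.1 := rfl
    rw [this, star_mul, star_star]
  rw [h, map_mul]
  rfl

/-- Reflection in the hyperplane orthogonal to `y - x` exchanges two vectors of equal length; if `x
= y` it is the identity. -/
theorem exists_isometryOf_eq {n : ℕ} {x y : EuclideanSpace ℝ (Fin n)} (h : ‖y‖ = ‖x‖) :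
    ∃ S : Matrix.orthogonalGroup (Fin n) ℝ, isometryOf S y = x := by
  set e : EuclideanSpace ℝ (Fin n) ≃ₗᵢ[ℝ] EuclideanSpace ℝ (Fin n) :=
    (Submodule.span ℝ {y - x})ᗮ.reflection with he
  have hex : e y = x := Submodule.reflection_sub h
  set u := Unitary.linearIsometryEquiv.symm e with hu
  set A := (Matrix.toEuclideanCLM (n := Fin n) (𝕜 := ℝ)).symm u.1 with hA
  have hAm : A ∈ Matrix.orthogonalGroup (Fin n) ℝ :=
    Unitary.map_mem (Matrix.toEuclideanCLM (n := Fin n) (𝕜 := ℝ)).symm u.2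
  refine ⟨⟨A, hAm⟩, ?_⟩
  have hAu : Matrix.toEuclideanCLM (n := Fin n) (𝕜 := ℝ) A = u.1 :=
    StarAlgEquiv.apply_symm_apply _ _
  rw [isometryOf_apply, hAu, ← hex]
  have : Unitary.linearIsometryEquiv u = e := by rw [hu, MulEquiv.apply_symm_apply]
  rw [← this]
  rfl

theorem continuous_isometryOf_symm (n : ℕ) :
    Continuous fun z : Matrix.orthogonalGroup (Fin n) ℝ × EuclideanSpace ℝ (Fin n) =>
      (isometryOf z.1).symm z.2 := by
  have hc : Continuous fun A : Matrix (Fin n) (Fin n) ℝ =>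
      Matrix.toEuclideanCLM (n := Fin n) (𝕜 := ℝ) A :=
    LinearMap.continuous_of_finiteDimensional
      (Matrix.toEuclideanCLM (n := Fin n) (𝕜 := ℝ)).toAlgEquiv.toLinearMap
  simp_rw [isometryOf_symm_apply]
  exact (hc.comp (continuous_star.comp (continuous_subtype_val.comp continuous_fst))).clm_apply
    continuous_snd

theorem proj_coordSubspace {n k : ℕ} (hk : k ≤ n) (x : EuclideanSpace ℝ (Fin n)) :
    (coordSubspace hk).proj x = WithLp.toLp 2 fun i : Fin n => if (i : ℕ) < k then x i else 0 := by
  refine Submodule.eq_starProjection_of_mem_of_inner_eq_zero ?_ ?_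
  · have h : (WithLp.toLp 2 fun i : Fin n => if (i : ℕ) < k then x i else 0) =
        ∑ i : Fin k, x (Fin.castLE hk i) • EuclideanSpace.basisFun (Fin n) ℝ (Fin.castLE hk i) := by
      ext j
      simp only [WithLp.ofLp_sum, WithLp.ofLp_smul, Finset.sum_apply, Pi.smul_apply,
        EuclideanSpace.basisFun_apply, smul_eq_mul, PiLp.single_apply]
      by_cases hj : (j : ℕ) < k
      · rw [if_pos hj, Finset.sum_eq_single ⟨j, hj⟩]
        · simp
        · intro i _ hi
          rw [if_neg, mul_zero]
          rintro rfl
          exact hi (by ext; simp)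
        · simp
      · rw [if_neg hj, Finset.sum_eq_zero]
        intro i _
        rw [if_neg, mul_zero]
        rintro rfl
        exact hj (by simp)
    rw [h]
    exact Submodule.sum_mem _ fun i _ => Submodule.smul_mem _ _
      (Submodule.subset_span ⟨i, rfl⟩)
  · intro w hw
    induction hw using Submodule.span_induction with
    | mem w hw =>
      obtain ⟨i, rfl⟩ := hw
      simp [EuclideanSpace.basisFun_apply, EuclideanSpace.inner_single_right]
    | zero => simp
    | add a b _ _ ha hb => rw [inner_add_right, ha, hb, add_zero]
    | smul c a _ ha => rw [inner_smul_right, ha, mul_zero]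

theorem norm_proj_coordSubspace {n k : ℕ} (hk : k ≤ n) (x : EuclideanSpace ℝ (Fin n)) :
    ‖(coordSubspace hk).proj x‖ = √(∑ i : Fin n, if (i : ℕ) < k then x i ^ 2 else 0) := by
  rw [proj_coordSubspace, EuclideanSpace.norm_eq]
  congr 1
  refine Finset.sum_congr rfl fun i _ => ?_
  by_cases h : (i : ℕ) < k <;> simp [h]

theorem measurable_proj (n k : ℕ) : Measurable (Gr.proj : Gr n k → _) := comap_measurable _

theorem measurable_eval (n : ℕ) :
    Measurable fun z : EuclideanSpace ℝ (Fin n) ×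
      (EuclideanSpace ℝ (Fin n) →L[ℝ] EuclideanSpace ℝ (Fin n)) => ‖z.2 z.1‖ := by
  have h2 : Continuous fun z : EuclideanSpace ℝ (Fin n) ×
      (EuclideanSpace ℝ (Fin n) →L[ℝ] EuclideanSpace ℝ (Fin n)) => ‖z.2 z.1‖ :=
    (continuous_snd.clm_apply continuous_fst).norm
  have : SecondCountableTopologyEither (EuclideanSpace ℝ (Fin n)) 
      (EuclideanSpace ℝ (Fin n) →L[ℝ] EuclideanSpace ℝ (Fin n)) := ⟨Or.inl inferInstance⟩
  have : OpensMeasurableSpace (EuclideanSpace ℝ (Fin n) ×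
      (EuclideanSpace ℝ (Fin n) →L[ℝ] EuclideanSpace ℝ (Fin n))) := Prod.opensMeasurableSpace
  exact h2.measurable
theorem measurable_norm_proj (n k : ℕ) :
    Measurable fun z : EuclideanSpace ℝ (Fin n) × Gr n k => ‖z.2.proj z.1‖ := by
  have h1 : Measurable fun z : EuclideanSpace ℝ (Fin n) × Gr n k => z.2.proj :=
    (measurable_proj n k).comp measurable_snd
  have h3 : Measurable fun z : EuclideanSpace ℝ (Fin n) × Gr n k => (z.1, z.2.proj) :=
    measurable_fst.prodMk h1
  have h2 := measurable_eval n
  generalize hF : (fun z : EuclideanSpace ℝ (Fin n) ×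
      (EuclideanSpace ℝ (Fin n) →L[ℝ] EuclideanSpace ℝ (Fin n)) => ‖z.2 z.1‖) = F at h2
  have h4 : (fun z : EuclideanSpace ℝ (Fin n) × Gr n k => ‖z.2.proj z.1‖) =
    F ∘ fun z : EuclideanSpace ℝ (Fin n) × Gr n k => (z.1, z.2.proj) := by rw [← hF]; rfl
  rw [h4]
  exact Measurable.comp h2 h3

theorem lintegral_haarGr {n k : ℕ} (hk : k ≤ n) (x : EuclideanSpace ℝ (Fin n)) {f : ℝ → ℝ≥0∞}
    (hf : Measurable f) :
    ∫⁻ E, f ‖E.proj x‖ ∂(haarGr hk) =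
      ∫⁻ T, f ‖(coordSubspace hk).proj ((isometryOf T).symm x)‖ ∂(haarOrthogonal n) := by
  have hm : Measurable fun E : Gr n k => f ‖E.proj x‖ :=
    hf.comp ((measurable_norm_proj n k).of_uncurry_left (f := fun x (E : Gr n k) => ‖E.proj x‖))
  rw [haarGr, lintegral_map hm (measurable_rotate _)]
  simp_rw [norm_proj_rotate]

/-- Moving the vector by `S` amounts to moving the subspace by `S⁻¹`, which Haar measure does not
notice. -/
theorem lintegral_haarGr_congr {n k : ℕ} (hk : k ≤ n) {x y : EuclideanSpace ℝ (Fin n)}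
    (h : ‖y‖ = ‖x‖) {f : ℝ → ℝ≥0∞} (hf : Measurable f) :
    ∫⁻ E, f ‖E.proj x‖ ∂(haarGr hk) = ∫⁻ E, f ‖E.proj y‖ ∂(haarGr hk) := by
  obtain ⟨S, rfl⟩ := exists_isometryOf_eq h
  rw [lintegral_haarGr hk _ hf, lintegral_haarGr hk _ hf]
  simp_rw [← isometryOf_symm_inv_mul]
  exact lintegral_mul_left_eq_self
    (fun T => f ‖(coordSubspace hk).proj ((isometryOf T).symm y)‖) S⁻¹

/-- For a random subspace `E`, the law of `‖P_E x‖` is that of `‖x‖ ‖P_{E₀} g‖ / ‖g‖` with `g`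
standard Gaussian. -/
theorem lintegral_norm_proj_haarGr {n k : ℕ} (hn : n ≠ 0) (hk : k ≤ n)
    (x : EuclideanSpace ℝ (Fin n)) {f : ℝ → ℝ≥0∞} (hf : Measurable f) :
    ∫⁻ E, f ‖E.proj x‖ ∂(haarGr hk) =
      ∫⁻ g, f (‖x‖ * √((∑ i : Fin n, if (i : ℕ) < k then g i ^ 2 else 0) / ∑ i, g i ^ 2))
        ∂(Measure.pi fun _ : Fin n => gaussianReal 0 1) := by
  set γ := stdGaussian (EuclideanSpace ℝ (Fin n)) with hγ
  have hne : Nonempty (Fin n) := ⟨⟨0, Nat.pos_of_ne_zero hn⟩⟩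
  have htoLp := (PiLp.volume_preserving_toLp (Fin n)).measurable
  have hγmap : (Measure.pi fun _ : Fin n => gaussianReal 0 1).map (WithLp.toLp 2) = γ :=
    map_pi_eq_stdGaussian
  have h0 : ∀ᵐ g ∂γ, g ≠ 0 := by
    have hS : MeasurableSet {g : EuclideanSpace ℝ (Fin n) | g ≠ 0} :=
      (measurableSet_singleton 0).compl
    rw [← hγmap, ae_map_iff htoLp.aemeasurable hS]
    have : NullSingletonClass (gaussianReal 0 1) := nullSingletonClass_gaussianReal one_ne_zero
    have hs : (Measure.pi fun _ : Fin n => gaussianReal 0 1) {0} = 0 := by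
      rw [Measure.pi_singleton]
      exact Finset.prod_eq_zero (Finset.mem_univ ⟨0, Nat.pos_of_ne_zero hn⟩) (by simp)
    rw [ae_iff]
    refine measure_mono_null ?_ hs
    intro g hg
    simpa using hg
  set P := (coordSubspace hk).proj with hP
  have hsm : ∀ c : ℝ, 0 ≤ c → ∀ y, ‖P (c • y)‖ = c * ‖P y‖ := by
    intro c hc y
    rw [map_smul, norm_smul, Real.norm_of_nonneg hc]
  -- The integral depends on `x` only through its norm, so `x` may be replaced by `(‖x‖ / ‖g‖) g`
  -- for almost every Gaussian `g`, and then averaged over `g`.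
  have step1 : ∫⁻ E, f ‖E.proj x‖ ∂(haarGr hk) =
      ∫⁻ g, ∫⁻ T, f (‖x‖ / ‖g‖ * ‖P ((isometryOf T).symm g)‖) ∂(haarOrthogonal n) ∂γ := by
    have : ∫⁻ E, f ‖E.proj x‖ ∂(haarGr hk) = ∫⁻ _, ∫⁻ E, f ‖E.proj x‖ ∂(haarGr hk) ∂γ := by simp
    rw [this]
    refine lintegral_congr_ae ?_
    filter_upwards [h0] with g hg
    have hg' : 0 < ‖g‖ := norm_pos_iff.2 hg
    have hn : ‖(‖x‖ / ‖g‖) • g‖ = ‖x‖ := by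
      rw [norm_smul, Real.norm_of_nonneg (by positivity)]
      field_simp
    rw [lintegral_haarGr_congr hk hn hf, lintegral_haarGr hk _ hf]
    refine lintegral_congr fun T => ?_
    rw [map_smul, hsm _ (by positivity)]
  have hFm : Measurable fun z : EuclideanSpace ℝ (Fin n) × Matrix.orthogonalGroup (Fin n) ℝ =>
      f (‖x‖ / ‖z.1‖ * ‖P ((isometryOf z.2).symm z.1)‖) := by
    refine hf.comp (Measurable.mul (by fun_prop) ?_)
    have h1 : Continuous fun z : EuclideanSpace ℝ (Fin n) × Matrix.orthogonalGroup (Fin n) ℝ =>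
        ‖P ((isometryOf z.2).symm z.1)‖ :=
      (P.continuous.comp ((continuous_isometryOf_symm n).comp continuous_swap)).norm
    exact h1.measurable
  have hGm : Measurable fun g : EuclideanSpace ℝ (Fin n) => f (‖x‖ / ‖g‖ * ‖P g‖) := by
    refine hf.comp (Measurable.mul (by fun_prop) ?_)
    exact P.continuous.norm.measurable
  rw [step1, lintegral_lintegral_swap hFm.aemeasurable]
  -- After exchanging the integrals, rotation invariance of the Gaussian law removes `T`, and only
  -- the fixed coordinate subspace remains.
  have step2 : ∀ T : Matrix.orthogonalGroup (Fin n) ℝ,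
      ∫⁻ g, f (‖x‖ / ‖g‖ * ‖P ((isometryOf T).symm g)‖) ∂γ = ∫⁻ g, f (‖x‖ / ‖g‖ * ‖P g‖) ∂γ := by
    intro T
    have hmap : γ.map (isometryOf T).symm = γ := stdGaussian_map (isometryOf T).symm
    conv_rhs => rw [← hmap, lintegral_map hGm (isometryOf T).symm.continuous.measurable]
    simp_rw [LinearIsometryEquiv.norm_map]
  simp_rw [step2]
  rw [lintegral_const, measure_univ, mul_one, ← hγmap, lintegral_map hGm htoLp]
  refine lintegral_congr fun g => ?_
  rw [hP, norm_proj_coordSubspace, EuclideanSpace.norm_eq (WithLp.toLp 2 g),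
    Real.sqrt_div (Finset.sum_nonneg fun i _ => by positivity)]
  simp only [Real.norm_eq_abs, sq_abs]
  congr 1
  ring

/-! ### Sums of independent variables -/

/-- Outside `B`, `Y ≤ x` implies `Z ≤ x + δ`, and `Z ≤ x - δ` implies `Y ≤ x`; the shift is absorbed
by the Lipschitz bound. Only subadditivity is used, so `B` need not be measurable. -/
theorem abs_cdf_map_sub_le_of_close {Ω : Type*} [MeasurableSpace Ω] (Q : Measure Ω)
    [IsProbabilityMeasure Q] {Y Z : Ω → ℝ} (hY : Measurable Y) (hZ : Measurable Z) {B : Set Ω}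
    {δ η : ℝ} (hδ : 0 ≤ δ) (hB : ∀ ω ∉ B, |Y ω - Z ω| ≤ δ) {v : ℝ≥0} (hv : v ≠ 0)
    (h : ∀ x, |cdf (Q.map Z) x - cdf (gaussianReal 0 v) x| ≤ η) (x : ℝ) :
    |cdf (Q.map Y) x - cdf (gaussianReal 0 v) x| ≤
      η + Q.real B + (√(2 * Real.pi * v))⁻¹ * δ := by
  have := Measure.isProbabilityMeasure_map (μ := Q) hY.aemeasurable
  have := Measure.isProbabilityMeasure_map (μ := Q) hZ.aemeasurable
  have e : ∀ (V : Ω → ℝ) (_ : Measurable V) (y : ℝ), cdf (Q.map V) y = Q.real {ω | V ω ≤ y} := by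
    intro V hV y
    have := Measure.isProbabilityMeasure_map (μ := Q) hV.aemeasurable
    rw [cdf_eq_real, map_measureReal_apply hV measurableSet_Iic]
    rfl
  have a1 : cdf (Q.map Y) x ≤ cdf (Q.map Z) (x + δ) + Q.real B := by
    rw [e Y hY, e Z hZ]
    refine (measureReal_mono ?_).trans (measureReal_union_le _ _)
    intro ω hω
    by_cases hb : ω ∈ B
    · exact Or.inr hb
    · left
      have := (abs_le.1 (hB ω hb)).1
      have hω' : Y ω ≤ x := hω
      show Z ω ≤ x + δ
      linarith
  have a2 : cdf (Q.map Z) (x - δ) ≤ cdf (Q.map Y) x + Q.real B := by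
    rw [e Y hY, e Z hZ]
    refine (measureReal_mono ?_).trans (measureReal_union_le _ _)
    intro ω hω
    by_cases hb : ω ∈ B
    · exact Or.inr hb
    · left
      have := (abs_le.1 (hB ω hb)).2
      have hω' : Z ω ≤ x - δ := hω
      show Y ω ≤ x
      linarith
  have b1 := (abs_le.1 (h (x + δ))).2
  have b2 := (abs_le.1 (h (x - δ))).1
  have c1 := cdf_gaussianReal_add_le hv x hδ
  have c2 := cdf_gaussianReal_add_le hv (x - δ) hδ
  rw [sub_add_cancel] at c2
  rw [abs_le]
  constructor <;> linarith

theorem charFun_map_pi_sum {ι : Type*} [Fintype ι] (m : ι → Measure ℝ)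
    [∀ i, IsProbabilityMeasure (m i)] {F : ι → ℝ → ℝ} (hF : ∀ i, Measurable (F i)) (t : ℝ) :
    charFun ((Measure.pi m).map fun x => ∑ i, F i (x i)) t =
      ∏ i, charFun ((m i).map (F i)) t := by
  have hs : Measurable fun x : ι → ℝ => ∑ i, F i (x i) :=
    Finset.measurable_sum _ fun i _ => (hF i).comp (measurable_pi_apply i)
  have hc : Continuous fun x : ℝ => Complex.exp (t * x * Complex.I) := by fun_prop
  simp_rw [charFun_apply_real]
  rw [integral_map hs.aemeasurable hc.aestronglyMeasurable]
  have h2 : ∀ i, ∫ x, Complex.exp (t * x * Complex.I) ∂((m i).map (F i)) =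
      ∫ x, Complex.exp (t * F i x * Complex.I) ∂(m i) := fun i =>
    integral_map (hF i).aemeasurable hc.aestronglyMeasurable
  simp_rw [h2]
  rw [← integral_fintype_prod_eq_prod]
  refine integral_congr_ae (Eventually.of_forall fun x => ?_)
  simp only
  rw [← Complex.exp_sum, Complex.ofReal_sum, Finset.mul_sum, Finset.sum_mul]

/-- Moments of the law of a multiple of `f`. -/
theorem moments_map_const_mul {m : Measure ℝ} [IsProbabilityMeasure m] {f : ℝ → ℝ}
    (hf : Measurable f) (h3 : Integrable (fun x => |f x| ^ 3) m) (c : ℝ) :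
    Integrable (fun x => |x| ^ 3) (m.map fun x => c * f x) ∧
    ∫ x, x ∂(m.map fun x => c * f x) = c * ∫ x, f x ∂m ∧
    ∫ x, x ^ 2 ∂(m.map fun x => c * f x) = c ^ 2 * ∫ x, f x ^ 2 ∂m ∧
    ∫ x, |x| ^ 3 ∂(m.map fun x => c * f x) = |c| ^ 3 * ∫ x, |f x| ^ 3 ∂m := by
  have hm : Measurable fun x => c * f x := hf.const_mul c
  refine ⟨?_, ?_, ?_, ?_⟩
  · rw [integrable_map_measure (Continuous.aestronglyMeasurable (by fun_prop)) hm.aemeasurable]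
    refine (h3.const_mul (|c| ^ 3)).congr (Eventually.of_forall fun x => ?_)
    simp [abs_mul, mul_pow]
  · rw [integral_map hm.aemeasurable (Continuous.aestronglyMeasurable (by fun_prop)),
      integral_const_mul]
  · rw [integral_map hm.aemeasurable (Continuous.aestronglyMeasurable (by fun_prop)),
      ← integral_const_mul]
    simp_rw [mul_pow]
  · rw [integral_map hm.aemeasurable (Continuous.aestronglyMeasurable (by fun_prop)),
      ← integral_const_mul]
    simp_rw [abs_mul, mul_pow]

theorem sum_ite_lt_const {n k : ℕ} (hk : k ≤ n) (c : ℝ) :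
    ∑ i : Fin n, (if (i : ℕ) < k then c else 0) = k * c := by
  rw [← Finset.sum_filter, Finset.sum_const, nsmul_eq_mul]
  congr 2
  rw [Fin.card_filter_val_lt, min_eq_right hk]

/-- Moderate deviations for averages of independent identically distributed variables. -/
theorem exists_tail_average_le (m : Measure ℝ) [IsProbabilityMeasure m] {f : ℝ → ℝ}
    (hf : Measurable f) (h3 : Integrable (fun x => |f x| ^ 3) m) (h1 : ∫ x, f x ∂m = 0)
    (h2 : 0 < ∫ x, f x ^ 2 ∂m) :
    ∃ C : ℝ, 0 < C ∧ ∀ n k : ℕ, 2 ≤ k → k ≤ n → ∀ ε : ℝ, C * √(Real.log k / k) ≤ ε →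
      (Measure.pi fun _ : Fin n => m).real
        {x | ε < |(∑ i : Fin n, if (i : ℕ) < k then f (x i) else 0) / k|} ≤
        C * (Real.log k / √k) := by
  set s := ∫ x, f x ^ 2 ∂m with hs
  set M := ∫ x, |f x| ^ 3 ∂m with hM
  have hM0 : 0 ≤ M := integral_nonneg fun x => by positivity
  set K : ℝ := 1 + s + s⁻¹ + M with hK
  have hK1 : 1 ≤ K := by
    have : 0 < s⁻¹ := by positivity
    linarith
  have hK0 : 0 < K := by linarith
  -- The tail is read off from the normal approximation. Exponential moments are not available in
  -- general: the square of a `p`-generalized Gaussian variable has none if `p < 2`.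
  obtain ⟨C, hC, hBE⟩ := berry_esseen hK1
  refine ⟨2 * C + 4 + √s, by positivity, ?_⟩
  intro n k hk2 hkn ε hε
  have hk0 : (0 : ℝ) < k := by exact_mod_cast (by omega : 0 < k)
  have hk2' : (2 : ℝ) ≤ k := by exact_mod_cast hk2
  have hsk : 0 < √(k : ℝ) := Real.sqrt_pos.2 hk0
  have hsk2 : √(k : ℝ) ^ 2 = k := Real.sq_sqrt hk0.le
  -- Coordinates beyond `k` get coefficient 0; their laws are point masses at 0, which the
  -- Berry–Esseen bound admits.
  set c : Fin n → ℝ := fun i => if (i : ℕ) < k then (√(k : ℝ))⁻¹ else 0 with hc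
  have hsum : ∀ j : ℕ, j ≠ 0 → ∑ i, |c i| ^ j = k * (√(k : ℝ))⁻¹ ^ j := by
    intro j hj
    rw [← sum_ite_lt_const hkn]
    refine Finset.sum_congr rfl fun i _ => ?_
    by_cases h : (i : ℕ) < k
    · simp only [hc, if_pos h]
      rw [abs_of_nonneg (by positivity)]
    · simp [hc, h, hj]
  have hS2 : ∑ i, c i ^ 2 = 1 := by
    have := hsum 2 (by norm_num)
    simp only [sq_abs] at this
    rw [this, inv_pow, hsk2]
    field_simp
  have hS3 : ∑ i, |c i| ^ 3 = (√(k : ℝ))⁻¹ := by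
    rw [hsum 3 (by norm_num)]
    nth_rw 1 [← hsk2]
    field_simp
  have hmom := fun i => moments_map_const_mul hf h3 (c i)
  have hprob : ∀ i, IsProbabilityMeasure (m.map fun x => c i * f x) := fun i =>
    Measure.isProbabilityMeasure_map (hf.const_mul _).aemeasurable
  set Y : (Fin n → ℝ) → ℝ := fun x => ∑ i, c i * f (x i) with hY
  have hYm : Measurable Y :=
    Finset.measurable_sum _ fun i _ => (hf.comp (measurable_pi_apply i)).const_mul _
  set Q := Measure.pi fun _ : Fin n => m with hQ
  have := Measure.isProbabilityMeasure_map (μ := Q) hYm.aemeasurable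
  have hsumvar : ∑ i, ∫ x, x ^ 2 ∂(m.map fun x => c i * f x) = s := by
    simp_rw [fun i => (hmom i).2.2.1]
    rw [← Finset.sum_mul, hS2, one_mul]
  set v : ℝ≥0 := ⟨s, h2.le⟩ with hv
  have hvs : (v : ℝ) = s := rfl
  have hv0 : v ≠ 0 := by
    intro h
    have : (v : ℝ) = 0 := by rw [h]; rfl
    rw [hvs] at this
    exact h2.ne' this
  have hsi : 0 < s⁻¹ := by positivity
  have hKs : 1 / K ≤ s := by
    rw [one_div]
    exact inv_le_of_inv_le₀ h2 (by linarith)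
  have main := hBE k hk2' (Fin n) (Q.map Y) (fun i => m.map fun x => c i * f x)
    (fun t => charFun_map_pi_sum (fun _ => m) (fun i => hf.const_mul (c i)) t)
    (fun i => (hmom i).1) (fun i => by rw [(hmom i).2.1, h1, mul_zero])
    (fun i => by
      rw [(hmom i).2.2.1, ← hs]
      by_cases h : (i : ℕ) < k
      · simp only [hc, if_pos h, inv_pow, hsk2]
        rw [inv_mul_eq_div]
        gcongr
        linarith
      · simp only [hc, if_neg h]
        rw [zero_pow (by norm_num), zero_mul]
        positivity)
    (by
      simp_rw [fun i => (hmom i).2.2.2]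
      rw [← Finset.sum_mul, hS3, ← hM, inv_mul_eq_div]
      gcongr
      linarith)
    (by rw [hsumvar]; exact hKs)
    (by rw [hsumvar]; linarith) v (by rw [hvs]; exact hKs)
  rw [hsumvar, hvs, sub_self, abs_zero, add_zero] at main
  set R := Real.log k / √(k : ℝ) with hR
  have hlog : 1 / 2 ≤ Real.log k := by
    have := Real.log_le_log (by norm_num) hk2'
    linarith [Real.log_two_gt_d9]
  have hR0 : 0 ≤ R := by positivity
  have hRk : (√(k : ℝ))⁻¹ ≤ 2 * R := by
    rw [inv_eq_one_div, hR, ← mul_div_assoc]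
    gcongr
    linarith
  -- At this level the Gaussian tail `exp (-a² / (2s))` equals `1 / √k`, no larger than the order of
  -- the Berry–Esseen error.
  set a : ℝ := √(s * Real.log k) with ha
  have ha0 : 0 ≤ a := Real.sqrt_nonneg _
  have hexp : Real.exp (-a ^ 2 / (2 * v)) = (√(k : ℝ))⁻¹ := by
    rw [ha, Real.sq_sqrt (by positivity), hvs, ← Real.exp_log hsk, ← Real.exp_neg,
      Real.log_sqrt hk0.le]
    congr 1
    field_simp
  have g1 := gaussianReal_real_Ici_le hv0 ha0
  have g2 := gaussianReal_real_Iic_neg_le hv0 ha0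
  rw [hexp] at g1 g2
  have hsub : {x : Fin n → ℝ | ε < |(∑ i : Fin n, if (i : ℕ) < k then f (x i) else 0) / k|} ⊆
      Y ⁻¹' (Set.Ioi a) ∪ Y ⁻¹' (Set.Iic (-a)) := by
    intro x hx
    have hx' : ε < |(∑ i : Fin n, if (i : ℕ) < k then f (x i) else 0) / k| := hx
    have e1 : (∑ i : Fin n, if (i : ℕ) < k then f (x i) else 0) / k = Y x / √(k : ℝ) := by
      have : Y x = (√(k : ℝ))⁻¹ * ∑ i : Fin n, if (i : ℕ) < k then f (x i) else 0 := by
        rw [hY, Finset.mul_sum]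
        refine Finset.sum_congr rfl fun i _ => ?_
        by_cases h : (i : ℕ) < k <;> simp [hc, h]
      rw [this]
      nth_rw 1 [← hsk2]
      field_simp
    rw [e1, abs_div, abs_of_pos hsk, lt_div_iff₀ hsk] at hx'
    have e2 : a ≤ ε * √(k : ℝ) := by
      have : √s * √(Real.log k / k) ≤ ε := by
        refine le_trans ?_ hε
        gcongr
        linarith [Real.sqrt_nonneg s]
      calc a = √s * √(Real.log k / k) * √(k : ℝ) := by
            rw [ha, Real.sqrt_mul h2.le, Real.sqrt_div (by linarith)]
            field_simp
        _ ≤ ε * √(k : ℝ) := by gcongr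
    have e3 : a < |Y x| := lt_of_le_of_lt e2 hx'
    rcases lt_abs.1 e3 with h | h
    · exact Or.inl h
    · refine Or.inr ?_
      show Y x ≤ -a
      linarith
  have p1 : Q.real (Y ⁻¹' (Set.Iic (-a))) ≤ C * R + (√(k : ℝ))⁻¹ := by
    have := (abs_le.1 (main (-a))).2
    rw [cdf_eq_real, cdf_eq_real, map_measureReal_apply hYm measurableSet_Iic] at this
    linarith
  have p2 : Q.real (Y ⁻¹' (Set.Ioi a)) ≤ C * R + (√(k : ℝ))⁻¹ := by
    have h4 := (abs_le.1 (main a)).1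
    rw [cdf_eq_real, cdf_eq_real] at h4
    have h5 : (Q.map Y).real (Set.Ioi a) = 1 - (Q.map Y).real (Set.Iic a) := by
      rw [← Set.compl_Iic, probReal_compl_eq_one_sub measurableSet_Iic]
    have h6 : (gaussianReal 0 v).real (Set.Ioi a) = 1 - (gaussianReal 0 v).real (Set.Iic a) := by
      rw [← Set.compl_Iic, probReal_compl_eq_one_sub measurableSet_Iic]
    have h7 : (gaussianReal 0 v).real (Set.Ioi a) ≤ (gaussianReal 0 v).real (Set.Ici a) :=
      measureReal_mono Set.Ioi_subset_Ici_self
    rw [← map_measureReal_apply hYm measurableSet_Ioi]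
    linarith
  refine (measureReal_mono hsub).trans ((measureReal_union_le _ _).trans ?_)
  have : 0 ≤ √s * R := by positivity
  linarith

/-! ### Linearization of the projected length -/

theorem abs_log_sub_le {x : ℝ} (hx : |x - 1| ≤ 1 / 2) : |Real.log x - (x - 1)| ≤ 2 * (x - 1) ^ 2 := by
  have h := abs_le.1 hx
  have hx0 : 0 < x := by linarith
  have h1 := Real.log_le_sub_one_of_pos hx0
  have h2 := Real.one_sub_inv_le_log_of_pos hx0
  have h3 : (x - 1) - (1 - x⁻¹) = (x - 1) ^ 2 * x⁻¹ := by
    field_simp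
  have h4 : x⁻¹ ≤ 2 := by
    rw [inv_le_comm₀ hx0 (by norm_num)]
    linarith
  have h5 : (x - 1) ^ 2 * x⁻¹ ≤ (x - 1) ^ 2 * 2 := by gcongr
  rw [abs_le]
  constructor <;> nlinarith [sq_nonneg (x - 1)]

/-- The product is `exp L` with `L` a combination of logarithms. Taylor's formula for the logarithm
puts `L` within `(11 + a) ε²` of the linear form, and `|exp L - 1 - L| ≤ L² ≤ 25 ε²` gives the rest
of `36 + a`. The perturbation `ω` is already of second order, so it is absent from the linear form.
-/
theorem abs_linearization_le {p a ε ω x₁ x₂ x₃ x₄ : ℝ} (hp : 1 ≤ p) (hε : 0 ≤ ε)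
    (hε8 : ε ≤ 1 / 8) (haε : a * ε ≤ 1) (h₁ : |x₁ - 1| ≤ ε) (h₂ : |x₂ - 1| ≤ ε)
    (h₃ : |x₃ - 1| ≤ ε) (h₄ : |x₄ - 1| ≤ ε) (hω0 : 0 ≤ ω) (hω : ω ≤ a * ε ^ 2) :
    |√x₁ * (x₂ + ω) ^ (-(1 / p)) * √(x₃ / x₄) - 1
      - 1 / 2 * ((x₁ - 1) - 2 / p * (x₂ - 1) + (x₃ - 1) - (x₄ - 1))| ≤ (36 + a) * ε ^ 2 := by
  have hp0 : 0 < p := by linarith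
  have hq1 : 1 / p ≤ 1 := by rw [div_le_one hp0]; exact hp
  have hq0 : 0 < 1 / p := by positivity
  have key : ∀ x : ℝ, |x - 1| ≤ ε → 0 < x ∧ |Real.log x - (x - 1)| ≤ 2 * ε ^ 2 := by
    intro x hx
    have := abs_le.1 hx
    refine ⟨by linarith, (abs_log_sub_le (by linarith)).trans ?_⟩
    rw [← sq_abs]
    gcongr
  obtain ⟨p1, l1⟩ := key x₁ h₁
  obtain ⟨p3, l3⟩ := key x₃ h₃
  obtain ⟨p4, l4⟩ := key x₄ h₄
  have hωε : ω ≤ ε := by nlinarith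
  have h2ω : |x₂ + ω - 1| ≤ 2 * ε := by
    have := abs_le.1 h₂
    rw [abs_le]
    constructor <;> linarith
  have p2 : 0 < x₂ + ω := by
    have := abs_le.1 h₂
    linarith
  have l2 : |Real.log (x₂ + ω) - (x₂ + ω - 1)| ≤ 8 * ε ^ 2 := by
    refine (abs_log_sub_le (by linarith)).trans ?_
    rw [← sq_abs]
    calc 2 * |x₂ + ω - 1| ^ 2 ≤ 2 * (2 * ε) ^ 2 := by gcongr
      _ = 8 * ε ^ 2 := by ring
  set L := 1 / 2 * Real.log x₁ - 1 / p * Real.log (x₂ + ω) +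
    1 / 2 * (Real.log x₃ - Real.log x₄) with hL
  have hexp : √x₁ * (x₂ + ω) ^ (-(1 / p)) * √(x₃ / x₄) = Real.exp L := by
    rw [Real.sqrt_eq_rpow, Real.sqrt_eq_rpow, Real.rpow_def_of_pos p1, Real.rpow_def_of_pos p2,
      Real.rpow_def_of_pos (by positivity), Real.log_div p3.ne' p4.ne', ← Real.exp_add,
      ← Real.exp_add, hL]
    congr 1
    ring
  set lin := 1 / 2 * ((x₁ - 1) - 2 / p * (x₂ - 1) + (x₃ - 1) - (x₄ - 1)) with hlin
  have e1 : L - lin = 1 / 2 * (Real.log x₁ - (x₁ - 1)) -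
      1 / p * ((Real.log (x₂ + ω) - (x₂ + ω - 1)) + ω) +
      1 / 2 * (Real.log x₃ - (x₃ - 1)) - 1 / 2 * (Real.log x₄ - (x₄ - 1)) := by
    rw [hL, hlin]
    ring
  have e2 : |1 / p * ((Real.log (x₂ + ω) - (x₂ + ω - 1)) + ω)| ≤ 8 * ε ^ 2 + a * ε ^ 2 := by
    rw [abs_mul, abs_of_pos hq0]
    calc 1 / p * |(Real.log (x₂ + ω) - (x₂ + ω - 1)) + ω|
        ≤ 1 * |(Real.log (x₂ + ω) - (x₂ + ω - 1)) + ω| := by gcongr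
      _ ≤ |Real.log (x₂ + ω) - (x₂ + ω - 1)| + |ω| := by rw [one_mul]; exact abs_add_le _ _
      _ ≤ _ := by rw [abs_of_nonneg hω0]; linarith
  have e3 : |L - lin| ≤ (11 + a) * ε ^ 2 := by
    rw [e1]
    have a1 := abs_le.1 l1
    have a2 := abs_le.1 e2
    have a3 := abs_le.1 l3
    have a4 := abs_le.1 l4
    rw [abs_le]
    constructor <;> linarith
  have e5 : |1 / p * (x₂ - 1)| ≤ ε := by
    rw [abs_mul, abs_of_pos hq0]
    calc 1 / p * |x₂ - 1| ≤ 1 * |x₂ - 1| := by gcongr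
      _ ≤ ε := by linarith
  have e4 : |lin| ≤ 5 / 2 * ε := by
    have e : lin = 1 / 2 * (x₁ - 1) - 1 / p * (x₂ - 1) + 1 / 2 * (x₃ - 1) - 1 / 2 * (x₄ - 1) := by
      rw [hlin]
      ring
    have a1 := abs_le.1 h₁
    have a2 := abs_le.1 e5
    have a3 := abs_le.1 h₃
    have a4 := abs_le.1 h₄
    rw [e, abs_le]
    constructor <;> linarith
  have e6 : |L| ≤ 5 * ε := by
    have h7 : |L| ≤ |lin| + |L - lin| := by
      have := abs_add_le lin (L - lin)
      rwa [add_sub_cancel] at this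
    -- Here `11 ε + a ε ≤ 11/8 + 1 ≤ 5/2`.
    have h8 : (11 + a) * ε ^ 2 ≤ 5 / 2 * ε := by nlinarith
    linarith
  have e7 : |Real.exp L - 1 - L| ≤ 25 * ε ^ 2 := by
    have := Real.norm_exp_sub_one_sub_id_le (x := L) (by rw [Real.norm_eq_abs]; linarith)
    rw [Real.norm_eq_abs, Real.norm_eq_abs] at this
    refine this.trans ?_
    calc |L| ^ 2 ≤ (5 * ε) ^ 2 := by gcongr
      _ = 25 * ε ^ 2 := by ring
  rw [hexp]
  have e8 : Real.exp L - 1 - lin = (Real.exp L - 1 - L) + (L - lin) := by ring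
  rw [e8]
  refine (abs_add_le _ _).trans ?_
  linarith

/-! ### Moments of the summands -/

/-- The functional equation of `Γ`. It reduces every moment containing `|t| ^ p` to a lower one, so
that only `Γ(1/p)`, `Γ(3/p)` and `Γ(5/p)` survive in the variance. -/
theorem integral_abs_rpow_add_pGauss {p : ℝ} (hp : 0 < p) {q : ℝ} (hq : 0 ≤ q) :
    ∫ t, |t| ^ (p + q) ∂(pGauss p) = (q + 1) / p * ∫ t, |t| ^ q ∂(pGauss p) := by
  rw [integral_abs_rpow_pGauss hp (by positivity), integral_abs_rpow_pGauss hp hq]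
  have e : (p + q + 1) / p = (q + 1) / p + 1 := by field_simp; ring
  rw [e, Real.Gamma_add_one (by positivity)]
  ring

/-- The second moment of the `p`-generalized Gaussian distribution. -/
def secondMoment (p : ℝ) : ℝ := Real.Gamma (3 / p) / Real.Gamma (1 / p)

theorem secondMoment_pos {p : ℝ} (hp : 0 < p) : 0 < secondMoment p :=
  div_pos (Real.Gamma_pos_of_pos (by positivity)) (Real.Gamma_pos_of_pos (by positivity))

theorem integral_sq_pGauss {p : ℝ} (hp : 0 < p) : ∫ t, t ^ 2 ∂(pGauss p) = secondMoment p := by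
  have := integral_abs_rpow_pGauss hp (q := 2) (by norm_num)
  norm_num at this
  rw [this, secondMoment, one_div]

theorem integral_pow_four_pGauss {p : ℝ} (hp : 0 < p) :
    ∫ t, t ^ 4 ∂(pGauss p) = Real.Gamma (5 / p) / Real.Gamma (1 / p) := by
  have := integral_abs_rpow_pGauss hp (q := 4) (by norm_num)
  have e : ∀ t : ℝ, |t| ^ (4 : ℝ) = t ^ 4 := by
    intro t
    rw [show (4 : ℝ) = ((4 : ℕ) : ℝ) by norm_num, Real.rpow_natCast, Even.pow_abs ⟨2, rfl⟩]
  simp_rw [e] at this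
  norm_num at this
  rw [this, one_div]

theorem integral_abs_rpow_self_pGauss {p : ℝ} (hp : 0 < p) :
    ∫ t, |t| ^ p ∂(pGauss p) = 1 / p := by
  have := isProbabilityMeasure_pGauss hp
  have h := integral_abs_rpow_add_pGauss hp (q := 0) le_rfl
  simpa using h

theorem integral_abs_rpow_self_sq_pGauss {p : ℝ} (hp : 0 < p) :
    ∫ t, (|t| ^ p) ^ 2 ∂(pGauss p) = (p + 1) / p * (1 / p) := by
  rw [← integral_abs_rpow_self_pGauss hp, ← integral_abs_rpow_add_pGauss hp hp.le]
  refine integral_congr_ae (Eventually.of_forall fun t => ?_)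
  simp only
  rw [← Real.rpow_natCast, ← Real.rpow_mul (abs_nonneg _)]
  congr 1
  push_cast
  ring

theorem integral_sq_mul_abs_rpow_self_pGauss {p : ℝ} (hp : 0 < p) :
    ∫ t, t ^ 2 * |t| ^ p ∂(pGauss p) = 3 / p * secondMoment p := by
  have h := integral_abs_rpow_add_pGauss hp (q := 2) (by norm_num)
  rw [show (2 : ℝ) + 1 = 3 by norm_num] at h
  have e : ∀ t : ℝ, |t| ^ (2 : ℝ) = t ^ 2 := by
    intro t
    rw [Real.rpow_two, sq_abs]
  simp_rw [e] at h
  rw [← integral_sq_pGauss hp, ← h]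
  refine integral_congr_ae (Eventually.of_forall fun t => ?_)
  simp only
  rw [Real.rpow_add' (abs_nonneg _) (by positivity), e]
  ring

theorem memLp_abs_rpow_pGauss {p : ℝ} (hp : 0 < p) {q : ℝ} (hq : 0 ≤ q) (r : ℕ) :
    MemLp (fun t => |t| ^ q) r (pGauss p) := by
  have := isProbabilityMeasure_pGauss hp
  have hm : Measurable fun t : ℝ => |t| ^ q := by fun_prop
  rcases Nat.eq_zero_or_pos r with rfl | hr
  · simpa using memLp_zero_iff_aestronglyMeasurable.2 hm.aestronglyMeasurable
  rw [← integrable_norm_rpow_iff hm.aestronglyMeasurable (by exact_mod_cast hr.ne') (by simp)]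
  refine (integrable_abs_rpow_pGauss hp (q := q * r) (by positivity)).congr
    (Eventually.of_forall fun t => ?_)
  simp only [ENNReal.toReal_natCast]
  rw [Real.norm_of_nonneg (by positivity), ← Real.rpow_mul (abs_nonneg _)]

theorem memLp_sq_pGauss {p : ℝ} (hp : 0 < p) (r : ℕ) :
    MemLp (fun t : ℝ => t ^ 2) r (pGauss p) := by
  have := memLp_abs_rpow_pGauss hp (q := 2) (by norm_num) r
  simpa using this

/-- The centred and normalized square, at the scale of the `p`-generalized Gaussian
distribution. -/
def sqPart (p t : ℝ) : ℝ := t ^ 2 / secondMoment p - 1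

/-- The centred and normalized `p`-th power. -/
def powPart (p t : ℝ) : ℝ := p * |t| ^ p - 1

/-- The linearized contribution of a coordinate with the `p`-generalized Gaussian distribution. -/
def linPart (p t : ℝ) : ℝ := sqPart p t - 2 / p * powPart p t

theorem measurable_sqPart (p : ℝ) : Measurable (sqPart p) := by unfold sqPart; fun_prop

theorem measurable_powPart (p : ℝ) : Measurable (powPart p) := by unfold powPart; fun_prop

theorem measurable_linPart (p : ℝ) : Measurable (linPart p) :=
  (measurable_sqPart p).sub ((measurable_powPart p).const_mul _)

theorem memLp_sqPart {p : ℝ} (hp : 0 < p) (r : ℕ) : MemLp (sqPart p) r (pGauss p) := by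
  have := isProbabilityMeasure_pGauss hp
  have h := ((memLp_sq_pGauss hp r).const_mul (secondMoment p)⁻¹).sub (memLp_const (1 : ℝ))
  refine h.ae_eq (Eventually.of_forall fun t => ?_)
  simp only [Pi.sub_apply, sqPart]
  ring

theorem memLp_powPart {p : ℝ} (hp : 0 < p) (r : ℕ) : MemLp (powPart p) r (pGauss p) := by
  have := isProbabilityMeasure_pGauss hp
  exact ((memLp_abs_rpow_pGauss hp hp.le r).const_mul p).sub (memLp_const (1 : ℝ))

theorem memLp_linPart {p : ℝ} (hp : 0 < p) (r : ℕ) : MemLp (linPart p) r (pGauss p) :=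
  (memLp_sqPart hp r).sub ((memLp_powPart hp r).const_mul _)

theorem integrable_abs_pow_three_of_memLp {m : Measure ℝ} {f : ℝ → ℝ}
    (h : MemLp f (3 : ℕ) m) : Integrable (fun t => |f t| ^ 3) m := by
  have := h.integrable_norm_pow (p := 3) (by norm_num)
  simpa using this

theorem integral_sqPart {p : ℝ} (hp : 0 < p) : ∫ t, sqPart p t ∂(pGauss p) = 0 := by
  have := isProbabilityMeasure_pGauss hp
  have h1 := (memLp_sq_pGauss hp 1).integrable (by simp)
  unfold sqPart
  rw [integral_sub (h1.div_const _) (integrable_const _), integral_div, integral_sq_pGauss hp,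
    div_self (secondMoment_pos hp).ne']
  simp

theorem integral_powPart {p : ℝ} (hp : 0 < p) : ∫ t, powPart p t ∂(pGauss p) = 0 := by
  have := isProbabilityMeasure_pGauss hp
  unfold powPart
  rw [integral_sub ((integrable_abs_rpow_pGauss hp hp.le).const_mul _) (integrable_const _),
    integral_const_mul, integral_abs_rpow_self_pGauss hp, mul_one_div_cancel hp.ne']
  simp

theorem integral_linPart {p : ℝ} (hp : 0 < p) : ∫ t, linPart p t ∂(pGauss p) = 0 := by
  have := isProbabilityMeasure_pGauss hp
  unfold linPart
  rw [integral_sub ((memLp_sqPart hp 1).integrable (by simp))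
    (((memLp_powPart hp 1).integrable (by simp)).const_mul _), integral_const_mul,
    integral_sqPart hp, integral_powPart hp]
  simp

/-- The factor 4 compensates the factor `1/2` in front of the linear form. -/
theorem integral_linPart_sq {p : ℝ} (hp : 0 < p) :
    ∫ t, linPart p t ^ 2 ∂(pGauss p) = 4 * limitVariance p 1 := by
  have := isProbabilityMeasure_pGauss hp
  set s := secondMoment p with hs
  have hs0 : 0 < s := secondMoment_pos hp
  have i4 : Integrable (fun t : ℝ => t ^ 4) (pGauss p) := by
    have := (integrable_abs_rpow_pGauss hp (q := 4) (by norm_num))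
    refine this.congr (Eventually.of_forall fun t => ?_)
    simp only
    rw [show (4 : ℝ) = ((4 : ℕ) : ℝ) by norm_num, Real.rpow_natCast, Even.pow_abs ⟨2, rfl⟩]
  have i2 : Integrable (fun t : ℝ => t ^ 2) (pGauss p) := (memLp_sq_pGauss hp 1).integrable (by simp)
  have ip : Integrable (fun t : ℝ => |t| ^ p) (pGauss p) := integrable_abs_rpow_pGauss hp hp.le
  have ipp : Integrable (fun t : ℝ => (|t| ^ p) ^ 2) (pGauss p) :=
    (memLp_abs_rpow_pGauss hp hp.le 2).integrable_sq
  have i2p : Integrable (fun t : ℝ => t ^ 2 * |t| ^ p) (pGauss p) :=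
    MemLp.integrable_mul (p := 2) (q := 2) (memLp_sq_pGauss hp 2)
      (memLp_abs_rpow_pGauss hp hp.le 2)
  have e : ∀ t, linPart p t ^ 2 = (s⁻¹) ^ 2 * t ^ 4 + 4 * (|t| ^ p) ^ 2 + (-(4 * s⁻¹)) * (t ^ 2 * |t| ^ p)
      + (2 * (2 / p - 1) * s⁻¹) * t ^ 2 + (-(4 * (2 / p - 1))) * |t| ^ p + (2 / p - 1) ^ 2 := by
    intro t
    simp only [linPart, sqPart, powPart, ← hs]
    field_simp
    ring
  simp_rw [e]
  rw [integral_add (by fun_prop) (by fun_prop), integral_add (by fun_prop) (by fun_prop),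
    integral_add (by fun_prop) (by fun_prop), integral_add (by fun_prop) (by fun_prop),
    integral_add (by fun_prop) (by fun_prop)]
  simp_rw [integral_const_mul]
  rw [integral_pow_four_pGauss hp, integral_abs_rpow_self_sq_pGauss hp,
    integral_sq_mul_abs_rpow_self_pGauss hp, integral_sq_pGauss hp,
    integral_abs_rpow_self_pGauss hp, ← hs]
  have g1 : Real.Gamma (1 / p) ≠ 0 := (Real.Gamma_pos_of_pos (by positivity)).ne'
  have g3 : Real.Gamma (3 / p) ≠ 0 := (Real.Gamma_pos_of_pos (by positivity)).ne'
  have e1 : (s⁻¹) ^ 2 * (Real.Gamma (5 / p) / Real.Gamma (1 / p)) =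
      Real.Gamma (1 / p) * Real.Gamma (5 / p) / Real.Gamma (3 / p) ^ 2 := by
    rw [hs, secondMoment]
    field_simp
  rw [e1, limitVariance]
  simp only [integral_const, probReal_univ, smul_eq_mul]
  field_simp
  ring

theorem integral_sq_pos_of_ne_zero {p : ℝ} (hp : 0 < p) {f : ℝ → ℝ} (hf : Continuous f)
    (h0 : f 0 ≠ 0) (h2 : MemLp f (2 : ℕ) (pGauss p)) : 0 < ∫ t, f t ^ 2 ∂(pGauss p) := by
  rw [integral_pGauss hp]
  have hc : Continuous (pGaussPDF p) := by
    unfold pGaussPDF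
    have : Continuous fun t : ℝ => |t| ^ p := continuous_abs.rpow_const fun _ => Or.inr hp.le
    fun_prop
  refine integral_pos_of_integrable_nonneg_nonzero (x := 0) (by fun_prop)
    ((integrable_pGauss_iff hp).1 h2.integrable_sq) ?_ ?_
  · intro t
    have := pGaussPDF_pos hp t
    simp only [Pi.zero_apply]
    positivity
  · exact mul_ne_zero (pGaussPDF_pos hp 0).ne' (pow_ne_zero 2 h0)

theorem continuous_sqPart (p : ℝ) : Continuous (sqPart p) := by unfold sqPart; fun_prop

theorem continuous_powPart {p : ℝ} (hp : 0 < p) : Continuous (powPart p) := by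
  have : Continuous fun t : ℝ => |t| ^ p := continuous_abs.rpow_const fun _ => Or.inr hp.le
  unfold powPart
  fun_prop

theorem integral_sqPart_sq_pos {p : ℝ} (hp : 0 < p) : 0 < ∫ t, sqPart p t ^ 2 ∂(pGauss p) :=
  integral_sq_pos_of_ne_zero hp (continuous_sqPart p) (by simp [sqPart]) (memLp_sqPart hp 2)

theorem integral_powPart_sq_pos {p : ℝ} (hp : 0 < p) : 0 < ∫ t, powPart p t ^ 2 ∂(pGauss p) :=
  integral_sq_pos_of_ne_zero hp (continuous_powPart hp)
    (by simp [powPart, Real.zero_rpow hp.ne']) (memLp_powPart hp 2)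

/-- The continuous function `linPart p` takes the value `2/p - 1` at 0, nonzero exactly for `p ≠ 2`,
and the density is positive everywhere. -/
theorem limitVariance_one_pos {p : ℝ} (hp : 0 < p) (hp2 : p ≠ 2) : 0 < limitVariance p 1 := by
  have h : 0 < ∫ t, linPart p t ^ 2 ∂(pGauss p) := by
    refine integral_sq_pos_of_ne_zero hp
      ((continuous_sqPart p).sub ((continuous_powPart hp).const_mul _)) ?_ (memLp_linPart hp 2)
    simp only [linPart, sqPart, powPart, abs_zero, Real.zero_rpow hp.ne']
    intro h
    apply hp2
    have h' : 2 / p = 1 := by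
      rw [mul_zero, zero_sub, zero_pow two_ne_zero, zero_div] at h
      linarith
    rw [div_eq_one_iff_eq hp.ne'] at h'
    exact h'.symm
  rw [integral_linPart_sq hp] at h
  linarith

/-- The variance interpolates affinely between `1/2` at `l = 0`, where only the random subspace
matters, and its value at `l = 1`, where only the random vector matters. Lower bounds on `[0, 1]`
and the comparison of `k/n` with `l` both come from this form. -/
theorem limitVariance_eq (p l : ℝ) :
    limitVariance p l = l * limitVariance p 1 + (1 - l) / 2 := by
  unfold limitVariance
  ring

theorem limitVariance_two (l : ℝ) : limitVariance 2 l = (1 - l) / 2 := by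
  have h1 : Real.Gamma (1 / 2) ≠ 0 := (Real.Gamma_pos_of_pos (by positivity)).ne'
  have h3 : Real.Gamma (3 / 2) = 1 / 2 * Real.Gamma (1 / 2) := by
    rw [← Real.Gamma_add_one (by norm_num)]; norm_num
  have h5 : Real.Gamma (5 / 2) = 3 / 2 * (1 / 2 * Real.Gamma (1 / 2)) := by
    rw [← h3, ← Real.Gamma_add_one (by norm_num)]; norm_num
  unfold limitVariance
  rw [h5, h3]
  field_simp
  ring

/-! ### The centred square of a standard Gaussian variable -/

theorem memLp_sq_sub_one_gaussian (r : ℕ) :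
    MemLp (fun t : ℝ => t ^ 2 - 1) r (gaussianReal 0 1) := by
  refine MemLp.sub ?_ (memLp_const 1)
  have hm : Measurable fun t : ℝ => t ^ 2 := by fun_prop
  rcases Nat.eq_zero_or_pos r with rfl | hr
  · simpa using memLp_zero_iff_aestronglyMeasurable.2 hm.aestronglyMeasurable
  rw [← integrable_norm_rpow_iff hm.aestronglyMeasurable (by exact_mod_cast hr.ne') (by simp)]
  have := (memLp_id_gaussianReal (μ := 0) (v := 1) ((2 * r : ℕ) : ℝ≥0)).integrable_norm_pow
    (p := 2 * r) (by omega)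
  refine Integrable.congr (f := fun t : ℝ => ‖id t‖ ^ (2 * r)) ?_ (Eventually.of_forall fun t => ?_)
  · simpa using this
  · simp [pow_mul]

theorem integral_sq_gaussian : ∫ t : ℝ, t ^ 2 ∂(gaussianReal 0 1) = 1 := by
  have h := variance_id_gaussianReal (μ := 0) (v := 1)
  rw [variance_of_integral_eq_zero aemeasurable_id (by simp)] at h
  simpa using h

theorem integral_sq_sub_one_gaussian : ∫ t : ℝ, (t ^ 2 - 1) ∂(gaussianReal 0 1) = 0 := by
  have h : Integrable (fun t : ℝ => t ^ 2) (gaussianReal 0 1) :=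
    ((memLp_id_gaussianReal (μ := 0) (v := 1) 2).integrable_sq)
  rw [integral_sub h (integrable_const _), integral_sq_gaussian]
  simp

theorem integral_pow_four_gaussian : ∫ t : ℝ, t ^ 4 ∂(gaussianReal 0 1) = 3 := by
  rw [integral_gaussianReal_eq_integral_smul (by norm_num)]
  have e : ∀ t : ℝ, gaussianPDFReal 0 1 t • t ^ 4 =
      (√(2 * Real.pi))⁻¹ * (|t| ^ (4 : ℝ) * Real.exp (-(1 / 2) * |t| ^ (2 : ℝ))) := by
    intro t
    rw [show (4 : ℝ) = ((4 : ℕ) : ℝ) by norm_num, Real.rpow_natCast, Even.pow_abs ⟨2, rfl⟩,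
      Real.rpow_two, sq_abs, gaussianPDFReal, smul_eq_mul]
    have : -(t - 0) ^ 2 / (2 * ((1 : ℝ≥0) : ℝ)) = -(1 / 2) * t ^ 2 := by
      rw [NNReal.coe_one]
      ring
    rw [this, NNReal.coe_one, mul_one]
    ring
  simp_rw [e]
  rw [integral_const_mul,
    integral_comp_abs (f := fun t => t ^ (4 : ℝ) * Real.exp (-(1 / 2) * t ^ (2 : ℝ))),
    integral_rpow_mul_exp_neg_mul_rpow (by norm_num) (by norm_num) (by norm_num)]
  have g5 : Real.Gamma ((4 + 1) / 2) = 3 / 4 * √Real.pi := by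
    rw [show ((4 : ℝ) + 1) / 2 = 1 / 2 + 1 + 1 by norm_num, Real.Gamma_add_one (by norm_num),
      Real.Gamma_add_one (by norm_num), Real.Gamma_one_half_eq]
    ring
  have e5 : (1 / 2 : ℝ) ^ (-(4 + 1) / 2 : ℝ) = 4 * √2 := by
    rw [one_div, Real.inv_rpow (by norm_num), ← Real.rpow_neg (by norm_num),
      show (-(-(4 + 1) / 2) : ℝ) = 2 + 1 / 2 by norm_num, Real.rpow_add (by norm_num),
      ← Real.sqrt_eq_rpow, Real.rpow_two]
    norm_num
  rw [g5, e5, Real.sqrt_mul (by norm_num)]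
  have : √Real.pi ≠ 0 := (Real.sqrt_pos.2 Real.pi_pos).ne'
  field_simp

theorem integral_sq_sub_one_sq_gaussian :
    ∫ t : ℝ, (t ^ 2 - 1) ^ 2 ∂(gaussianReal 0 1) = 2 := by
  have h2 : Integrable (fun t : ℝ => t ^ 2) (gaussianReal 0 1) :=
    ((memLp_id_gaussianReal (μ := 0) (v := 1) 2).integrable_sq)
  have h4 : Integrable (fun t : ℝ => t ^ 4) (gaussianReal 0 1) :=
    Integrable.of_integral_ne_zero (by rw [integral_pow_four_gaussian]; norm_num)
  have e : ∀ t : ℝ, (t ^ 2 - 1) ^ 2 = t ^ 4 + (-2) * t ^ 2 + 1 := fun t => by ring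
  simp_rw [e]
  rw [integral_add (by fun_prop) (by fun_prop), integral_add (by fun_prop) (by fun_prop),
    integral_const_mul, integral_pow_four_gaussian, integral_sq_gaussian]
  norm_num

/-! ### The probabilistic representation -/

/-- The joint law of a vector with independent `p`-generalized Gaussian coordinates, a variable with
distribution `W` and a standard Gaussian vector. -/
def reprMeasure (n : ℕ) (p : ℝ) (W : Measure ℝ≥0) : Measure (((Fin n → ℝ) × ℝ≥0) × (Fin n → ℝ)) :=
  ((Measure.pi fun _ : Fin n => pGauss p).prod W).prod
    (Measure.pi fun _ : Fin n => gaussianReal 0 1)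

/-- The vector built from `p`-generalized Gaussian coordinates and `w`. -/
def reprVector {n : ℕ} (p : ℝ) (z : (Fin n → ℝ) × ℝ≥0) : EuclideanSpace ℝ (Fin n) :=
  (∑ i, |z.1 i| ^ p + (z.2 : ℝ)) ^ (-(1 / p)) • WithLp.toLp 2 z.1

theorem measurable_reprVector {n : ℕ} (p : ℝ) : Measurable (reprVector (n := n) p) := by
  unfold reprVector
  have h : Measurable fun z : (Fin n → ℝ) × ℝ≥0 =>
      (WithLp.toLp 2 z.1 : EuclideanSpace ℝ (Fin n)) :=
    (PiLp.volume_preserving_toLp (Fin n)).measurable.comp measurable_fst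
  have h1 : Measurable fun z : (Fin n → ℝ) × ℝ≥0 =>
      (∑ i, |z.1 i| ^ p + (z.2 : ℝ)) ^ (-(1 / p)) := by fun_prop
  exact h1.smul h

/-- The representation of `normalizedLength`. -/
def reprLength (n k : ℕ) (p : ℝ) (z : ((Fin n → ℝ) × ℝ≥0) × (Fin n → ℝ)) : ℝ :=
  (n : ℝ) ^ (1 / p) * √(Real.Gamma (1 / p) / (p ^ (2 / p) * Real.Gamma (3 / p))) *
    (‖reprVector p z.1‖ *
      √((∑ i : Fin n, if (i : ℕ) < k then z.2 i ^ 2 else 0) / ∑ i, z.2 i ^ 2)) - √(k : ℝ)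

theorem measurable_ite_sum_sq (n k : ℕ) :
    Measurable fun g : Fin n → ℝ => ∑ i : Fin n, if (i : ℕ) < k then g i ^ 2 else 0 := by
  refine Finset.measurable_sum _ fun i _ => ?_
  split_ifs <;> fun_prop

theorem measurable_reprLength (n k : ℕ) (p : ℝ) : Measurable (reprLength n k p) := by
  unfold reprLength
  have h1 : Measurable fun z : ((Fin n → ℝ) × ℝ≥0) × (Fin n → ℝ) => ‖reprVector p z.1‖ :=
    (measurable_reprVector (n := n) p).norm.comp measurable_fst
  have h2 : Measurable fun z : ((Fin n → ℝ) × ℝ≥0) × (Fin n → ℝ) =>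
      ∑ i : Fin n, if (i : ℕ) < k then z.2 i ^ 2 else 0 :=
    (measurable_ite_sum_sq n k).comp measurable_snd
  have h3 : Measurable fun z : ((Fin n → ℝ) × ℝ≥0) × (Fin n → ℝ) => ∑ i, z.2 i ^ 2 := by fun_prop
  exact ((h1.mul (h2.div h3).sqrt).const_mul _).sub_const _

/-- By independence the two representations can be inserted one after the other: first for the
random subspace with the vector fixed, then for the vector. -/
theorem map_normalizedLength {n k : ℕ} (hn : n ≠ 0) (hk : k ≤ n) {p : ℝ} (hp : 1 ≤ p)
    (W : Measure ℝ≥0) [IsProbabilityMeasure W] {Ω : Type*} [MeasurableSpace Ω] {P : Measure Ω}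
    [IsProbabilityMeasure P] {X : Ω → EuclideanSpace ℝ (Fin n)} {E : Ω → Gr n k}
    (hX : HasLaw X (ballMeasure n p W) P) (hE : HasLaw E (haarGr hk) P) (hXE : IndepFun X E P) :
    P.map (fun ω => normalizedLength p (X ω) (E ω)) =
      (reprMeasure n p W).map (reprLength n k p) := by
  have hp0 : 0 < p := by linarith
  have := isProbabilityMeasure_pGauss hp0
  set c := (n : ℝ) ^ (1 / p) * √(Real.Gamma (1 / p) / (p ^ (2 / p) * Real.Gamma (3 / p))) with hc
  have hF := measurable_norm_proj n k
  have hball : ((Measure.pi fun _ : Fin n => pGauss p).prod W).map (reprVector p) =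
      ballMeasure n p W := map_pGauss_eq_ballMeasure hn hp W
  have hpb : IsProbabilityMeasure (ballMeasure n p W) := by
    rw [← hball]
    exact Measure.isProbabilityMeasure_map (measurable_reprVector p).aemeasurable
  have hjoint : P.map (fun ω => (X ω, E ω)) = (ballMeasure n p W).prod (haarGr hk) := by
    rw [(indepFun_iff_map_prod_eq_prod_map_map hX.aemeasurable hE.aemeasurable).1 hXE, hX.map_eq,
      hE.map_eq]
  have hhaar := fun (x : EuclideanSpace ℝ (Fin n)) (f : ℝ → ℝ≥0∞) (hf : Measurable f) =>
    lintegral_norm_proj_haarGr hn hk x hf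
  have hdef : (fun ω => normalizedLength p (X ω) (E ω)) = fun ω =>
      c * (fun z : EuclideanSpace ℝ (Fin n) × Gr n k => ‖z.2.proj z.1‖) (X ω, E ω) - √(k : ℝ) :=
    rfl
  have hhaar' : ∀ x f, Measurable f → ∫⁻ E, f
      ((fun z : EuclideanSpace ℝ (Fin n) × Gr n k => ‖z.2.proj z.1‖) (x, E)) ∂(haarGr hk) = _ :=
    hhaar
  rw [hdef]
  clear hdef
  generalize (fun z : EuclideanSpace ℝ (Fin n) × Gr n k => ‖z.2.proj z.1‖) = F at hF hhaar' ⊢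
  have hm : Measurable fun z => c * F z - √(k : ℝ) := (hF.const_mul c).sub_const _
  have hcomp : P.map (fun ω => c * F (X ω, E ω) - √(k : ℝ)) =
      ((ballMeasure n p W).prod (haarGr hk)).map fun z => c * F z - √(k : ℝ) := by
    rw [← hjoint, AEMeasurable.map_map_of_aemeasurable hm.aemeasurable
      (hX.aemeasurable.prodMk hE.aemeasurable)]
    rfl
  rw [hcomp]
  refine Measure.ext_of_lintegral _ fun f hf => ?_
  have hlen := measurable_reprLength n k p
  have hfm : Measurable fun z => f (c * F z - √(k : ℝ)) := hf.comp hm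
  have hfl : Measurable fun z => f (reprLength n k p z) := hf.comp hlen
  rw [lintegral_map hf hm, lintegral_map hf hlen, lintegral_prod _ hfm.aemeasurable,
    reprMeasure, lintegral_prod _ hfl.aemeasurable, ← hball,
    lintegral_map hfm.lintegral_prod_right' (measurable_reprVector p)]
  refine lintegral_congr fun z => ?_
  exact hhaar' (reprVector p z) (fun r => f (c * r - √(k : ℝ))) (by fun_prop)

/-- The length in terms of averages. -/
theorem reprLength_eq {n k : ℕ} (hn : n ≠ 0) (hk : k ≠ 0) (hkn : k ≤ n) {p : ℝ} (hp : 0 < p)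
    (z : ((Fin n → ℝ) × ℝ≥0) × (Fin n → ℝ)) :
    reprLength n k p z = √(k : ℝ) *
      (√(1 + (∑ i, sqPart p (z.1.1 i)) / n) *
        ((1 + (∑ i, powPart p (z.1.1 i)) / n) + p * z.1.2 / n) ^ (-(1 / p)) *
        √((1 + (∑ i : Fin n, if (i : ℕ) < k then z.2 i ^ 2 - 1 else 0) / k) /
          (1 + (∑ i, (z.2 i ^ 2 - 1)) / n)) - 1) := by
  have hn0 : (0 : ℝ) < n := by exact_mod_cast Nat.pos_of_ne_zero hn
  have hk0 : (0 : ℝ) < k := by exact_mod_cast Nat.pos_of_ne_zero hk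
  have hs := secondMoment_pos hp
  set s := secondMoment p with hsdef
  have e1 : 1 + (∑ i, sqPart p (z.1.1 i)) / n = (∑ i, z.1.1 i ^ 2) / (n * s) := by
    simp only [sqPart, Finset.sum_sub_distrib, ← Finset.sum_div, Finset.sum_const,
      Finset.card_univ, Fintype.card_fin, nsmul_eq_mul, ← hsdef]
    field_simp
    ring
  have e2 : 1 + (∑ i, powPart p (z.1.1 i)) / n + p * z.1.2 / n =
      p / n * (∑ i, |z.1.1 i| ^ p + z.1.2) := by
    simp only [powPart, Finset.sum_sub_distrib, ← Finset.mul_sum, Finset.sum_const,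
      Finset.card_univ, Fintype.card_fin, nsmul_eq_mul]
    field_simp
    ring
  have e3 : 1 + (∑ i : Fin n, if (i : ℕ) < k then z.2 i ^ 2 - 1 else 0) / k =
      (∑ i : Fin n, if (i : ℕ) < k then z.2 i ^ 2 else 0) / k := by
    have : ∑ i : Fin n, (if (i : ℕ) < k then z.2 i ^ 2 - 1 else 0) =
        (∑ i : Fin n, if (i : ℕ) < k then z.2 i ^ 2 else 0) - k * 1 := by
      rw [← sum_ite_lt_const hkn, ← Finset.sum_sub_distrib]
      refine Finset.sum_congr rfl fun i _ => ?_
      split_ifs <;> simp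
    rw [this]
    field_simp
    ring
  have e4 : 1 + (∑ i, (z.2 i ^ 2 - 1)) / n = (∑ i, z.2 i ^ 2) / n := by
    simp only [Finset.sum_sub_distrib, Finset.sum_const, Finset.card_univ, Fintype.card_fin,
      nsmul_eq_mul]
    field_simp
    ring
  rw [e1, e2, e3, e4, reprLength, reprVector, norm_smul, EuclideanSpace.norm_eq]
  simp only [Real.norm_eq_abs, sq_abs]
  set A := ∑ i, z.1.1 i ^ 2
  set T := ∑ i, |z.1.1 i| ^ p + (z.1.2 : ℝ)
  set B := ∑ i : Fin n, if (i : ℕ) < k then z.2 i ^ 2 else 0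
  set D := ∑ i, z.2 i ^ 2
  have hA : 0 ≤ A := Finset.sum_nonneg fun i _ => by positivity
  have hT : 0 ≤ T := add_nonneg (Finset.sum_nonneg fun i _ => by positivity) z.1.2.2
  have hB : 0 ≤ B := Finset.sum_nonneg fun i _ => by split_ifs <;> positivity
  have hD : 0 ≤ D := Finset.sum_nonneg fun i _ => by positivity
  set q := p ^ (1 / p) with hq
  have hq0 : 0 < q := Real.rpow_pos_of_pos hp _
  -- Together with `n ^ (1/p)`, this prefactor normalizes `∑ G_i²`, of mean `n s`, and `∑ |G_i| ^
  -- p`, of mean `n / p`, to averages of mean 1.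
  have f1 : √(Real.Gamma (1 / p) / (p ^ (2 / p) * Real.Gamma (3 / p))) = (√s * q)⁻¹ := by
    have g1 : Real.Gamma (1 / p) ≠ 0 := (Real.Gamma_pos_of_pos (by positivity)).ne'
    have g3 : Real.Gamma (3 / p) ≠ 0 := (Real.Gamma_pos_of_pos (by positivity)).ne'
    have hq2 : p ^ (2 / p) = q ^ 2 := by
      rw [hq, ← Real.rpow_natCast, ← Real.rpow_mul hp.le]
      congr 1
      push_cast
      ring
    have : Real.Gamma (1 / p) / (p ^ (2 / p) * Real.Gamma (3 / p)) = (s * q ^ 2)⁻¹ := by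
      rw [hq2, hsdef, secondMoment]
      field_simp
    rw [this, Real.sqrt_inv, Real.sqrt_mul hs.le, Real.sqrt_sq hq0.le]
  have f2 : (p / n * T) ^ (-(1 / p)) = (n : ℝ) ^ (1 / p) * q⁻¹ * T ^ (-(1 / p)) := by
    rw [Real.mul_rpow (by positivity) hT, Real.div_rpow hp.le hn0.le, Real.rpow_neg hp.le,
      Real.rpow_neg hn0.le, ← hq]
    field_simp
  have f3 : √(B / k / (D / n)) = √(B / D) * (√(n : ℝ) / √(k : ℝ)) := by
    rw [← Real.sqrt_div hn0.le, ← Real.sqrt_mul (by positivity)]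
    congr 1
    field_simp
  have f4 : √(A / (n * s)) = √A / (√(n : ℝ) * √s) := by
    rw [Real.sqrt_div hA, Real.sqrt_mul hn0.le]
  have hsn := Real.sqrt_pos.2 hn0
  have hsk := Real.sqrt_pos.2 hk0
  have hss := Real.sqrt_pos.2 hs
  rw [f1, f2, f3, f4, abs_of_nonneg (Real.rpow_nonneg hT _)]
  field_simp

/-! ### The central limit theorem for the linearized length -/

theorem isProbabilityMeasure_reprMeasure (n : ℕ) {p : ℝ} (hp : 0 < p) (W : Measure ℝ≥0)
    [IsProbabilityMeasure W] : IsProbabilityMeasure (reprMeasure n p W) := by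
  have := isProbabilityMeasure_pGauss hp
  unfold reprMeasure
  infer_instance

theorem charFun_map_reprMeasure {n : ℕ} {p : ℝ} (hp : 0 < p) (W : Measure ℝ≥0)
    [IsProbabilityMeasure W] {F H : Fin n → ℝ → ℝ} (hF : ∀ i, Measurable (F i))
    (hH : ∀ i, Measurable (H i)) (t : ℝ) :
    charFun ((reprMeasure n p W).map fun z => ∑ i, F i (z.1.1 i) + ∑ i, H i (z.2 i)) t =
      (∏ i, charFun ((pGauss p).map (F i)) t) * ∏ i, charFun ((gaussianReal 0 1).map (H i)) t := by
  have := isProbabilityMeasure_pGauss hp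
  rw [← charFun_map_pi_sum (fun _ => pGauss p) hF, ← charFun_map_pi_sum (fun _ => gaussianReal 0 1) hH]
  have hc : Continuous fun x : ℝ => Complex.exp (t * x * Complex.I) := by fun_prop
  have m1 : Measurable fun x : Fin n → ℝ => ∑ i, F i (x i) :=
    Finset.measurable_sum _ fun i _ => (hF i).comp (measurable_pi_apply i)
  have m2 : Measurable fun x : Fin n → ℝ => ∑ i, H i (x i) :=
    Finset.measurable_sum _ fun i _ => (hH i).comp (measurable_pi_apply i)
  have m3 : Measurable fun z : ((Fin n → ℝ) × ℝ≥0) × (Fin n → ℝ) =>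
      ∑ i, F i (z.1.1 i) + ∑ i, H i (z.2 i) :=
    (m1.comp (measurable_fst.comp measurable_fst)).add (m2.comp measurable_snd)
  simp_rw [charFun_apply_real]
  rw [integral_map m1.aemeasurable hc.aestronglyMeasurable,
    integral_map m2.aemeasurable hc.aestronglyMeasurable,
    integral_map m3.aemeasurable hc.aestronglyMeasurable]
  have hmul := integral_prod_mul (μ := (Measure.pi fun _ : Fin n => pGauss p).prod W)
    (ν := Measure.pi fun _ : Fin n => gaussianReal 0 1)
    (fun y => Complex.exp (t * ((∑ i, F i (y.1 i) : ℝ) : ℂ) * Complex.I))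
    (fun x => Complex.exp (t * ((∑ i, H i (x i) : ℝ) : ℂ) * Complex.I))
  have hfst := integral_fun_fst (μ := Measure.pi fun _ : Fin n => pGauss p) (ν := W)
    (fun x => Complex.exp (t * ((∑ i, F i (x i) : ℝ) : ℂ) * Complex.I))
  rw [probReal_univ, one_smul] at hfst
  rw [← hfst, ← hmul]
  refine integral_congr_ae (Eventually.of_forall fun z => ?_)
  simp only
  rw [← Complex.exp_add, Complex.ofReal_add]
  congr 1
  ring

/-- The coefficient of the `i`-th Gaussian coordinate in the linearized length. -/
def gaussCoeff (n k : ℕ) (i : Fin n) : ℝ :=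
  √(k : ℝ) / 2 * ((if (i : ℕ) < k then (k : ℝ)⁻¹ else 0) - (n : ℝ)⁻¹)

theorem abs_gaussCoeff_le {n k : ℕ} (hk : k ≠ 0) (hkn : k ≤ n) (i : Fin n) :
    |gaussCoeff n k i| ≤ (2 * √(k : ℝ))⁻¹ := by
  have hk0 : (0 : ℝ) < k := by exact_mod_cast Nat.pos_of_ne_zero hk
  have hkn' : (k : ℝ) ≤ n := by exact_mod_cast hkn
  have h : |(if (i : ℕ) < k then (k : ℝ)⁻¹ else 0) - (n : ℝ)⁻¹| ≤ (k : ℝ)⁻¹ := by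
    have h1 : (n : ℝ)⁻¹ ≤ (k : ℝ)⁻¹ := inv_anti₀ hk0 hkn'
    have h2 : (0 : ℝ) ≤ (n : ℝ)⁻¹ := by positivity
    rw [abs_le]
    split_ifs <;> constructor <;> linarith
  rw [gaussCoeff, abs_mul, abs_of_nonneg (by positivity)]
  calc _ ≤ √(k : ℝ) / 2 * (k : ℝ)⁻¹ := by gcongr
    _ = (2 * √(k : ℝ))⁻¹ := by
      have := Real.sqrt_pos.2 hk0
      nth_rw 2 [← Real.sq_sqrt hk0.le]
      field_simp

/-- Multiplied by 2, the variance of `g² - 1`, this is the contribution `(1 - k/n) / 2` of the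
random subspace to the variance. -/
theorem sum_gaussCoeff_sq {n k : ℕ} (hk : k ≠ 0) (hkn : k ≤ n) :
    ∑ i, gaussCoeff n k i ^ 2 = (1 - k / n) / 4 := by
  have hk0 : (0 : ℝ) < k := by exact_mod_cast Nat.pos_of_ne_zero hk
  have hkn' : (k : ℝ) ≤ n := by exact_mod_cast hkn
  have hn0 : (0 : ℝ) < n := by linarith
  have e : ∀ i : Fin n, gaussCoeff n k i ^ 2 =
      (if (i : ℕ) < k then k / 4 * ((k : ℝ)⁻¹ ^ 2 - 2 * (k : ℝ)⁻¹ * (n : ℝ)⁻¹) else 0) +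
        k / 4 * (n : ℝ)⁻¹ ^ 2 := by
    intro i
    rw [gaussCoeff, mul_pow, div_pow, Real.sq_sqrt hk0.le]
    split_ifs <;> ring
  simp_rw [e]
  rw [Finset.sum_add_distrib, sum_ite_lt_const hkn, Finset.sum_const, Finset.card_univ,
    Fintype.card_fin, nsmul_eq_mul]
  field_simp
  ring

/-- The linearized length. -/
def linLength (n k : ℕ) (p : ℝ) (z : ((Fin n → ℝ) × ℝ≥0) × (Fin n → ℝ)) : ℝ :=
  ∑ i, √(k : ℝ) / (2 * n) * linPart p (z.1.1 i) + ∑ i, gaussCoeff n k i * (z.2 i ^ 2 - 1)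

theorem measurable_linLength (n k : ℕ) (p : ℝ) : Measurable (linLength n k p) := by
  have := measurable_linPart p
  unfold linLength
  fun_prop

theorem sum_pow_three_le {ι : Type*} [Fintype ι] (d : ι → ℝ) {a b : ℝ} (ha : ∀ i, |d i| ≤ a)
    (hb : ∑ i, d i ^ 2 ≤ b) (ha0 : 0 ≤ a) : ∑ i, |d i| ^ 3 ≤ a * b := by
  calc ∑ i, |d i| ^ 3 ≤ ∑ i, a * d i ^ 2 := by
        refine Finset.sum_le_sum fun i _ => ?_
        rw [pow_succ', sq_abs]
        gcongr
        exact ha i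
    _ ≤ a * b := by rw [← Finset.mul_sum]; gcongr

/-- The Berry–Esseen bound for `2n` summands at scale `N = k`: all coefficients are at most `1 /
(2√k)` and their squares sum to at most `1/4` in each half, so third moments sum to `O(1/√k)`. The
variances add up exactly to the limiting variance at `k/n`. -/
theorem exists_abs_cdf_linLength_sub_le {p : ℝ} (hp : 0 < p) {δ : ℝ} (hδ : 0 < δ) :
    ∃ C : ℝ, 0 < C ∧ ∀ (n k : ℕ), 2 ≤ k → k ≤ n → ∀ (W : Measure ℝ≥0) [IsProbabilityMeasure W]
      (v : ℝ≥0), δ ≤ v → δ ≤ limitVariance p (k / n) → ∀ x,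
        |cdf ((reprMeasure n p W).map (linLength n k p)) x - cdf (gaussianReal 0 v) x| ≤
          C * (Real.log k / √k + |v - limitVariance p (k / n)|) := by
  have := isProbabilityMeasure_pGauss hp
  have hV3 := integrable_abs_pow_three_of_memLp (memLp_linPart hp 3)
  have hζ3 := integrable_abs_pow_three_of_memLp (memLp_sq_sub_one_gaussian 3)
  set M := ∫ t, |linPart p t| ^ 3 ∂(pGauss p) with hM
  set M' := ∫ t : ℝ, |t ^ 2 - 1| ^ 3 ∂(gaussianReal 0 1) with hM'
  have hM0 : 0 ≤ M := integral_nonneg fun t => by positivity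
  have hM'0 : 0 ≤ M' := integral_nonneg fun t => by positivity
  set s := limitVariance p 1 with hs
  have hVs : ∫ t, linPart p t ^ 2 ∂(pGauss p) = 4 * s := integral_linPart_sq hp
  have hs0 : 0 ≤ s := by
    have : 0 ≤ ∫ t, linPart p t ^ 2 ∂(pGauss p) := integral_nonneg fun t => sq_nonneg _
    linarith
  set K : ℝ := 1 + s + M + M' + δ⁻¹ with hK
  have hδi : 0 < δ⁻¹ := by positivity
  have hK1 : 1 ≤ K := by linarith
  have hK0 : 0 < K := by linarith
  have hKδ : 1 / K ≤ δ := by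
    rw [one_div]
    exact inv_le_of_inv_le₀ hδ (by linarith)
  obtain ⟨C, hC, hBE⟩ := berry_esseen hK1
  refine ⟨C, hC, ?_⟩
  intro n k hk2 hkn W _ v hv hvar
  have hk : k ≠ 0 := by omega
  have hk0 : (0 : ℝ) < k := by exact_mod_cast (by omega : 0 < k)
  have hk2' : (2 : ℝ) ≤ k := by exact_mod_cast hk2
  have hkn' : (k : ℝ) ≤ n := by exact_mod_cast hkn
  have hn0 : (0 : ℝ) < n := by linarith
  have hsk : 0 < √(k : ℝ) := Real.sqrt_pos.2 hk0
  have hsk2 : √(k : ℝ) ^ 2 = k := Real.sq_sqrt hk0.le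
  have hx1 : (k : ℝ) / n ≤ 1 := by rw [div_le_one hn0]; exact hkn'
  have hx0 : (0 : ℝ) ≤ (k : ℝ) / n := by positivity
  have hQ := isProbabilityMeasure_reprMeasure n hp W
  have hZm := measurable_linLength n k p
  have := Measure.isProbabilityMeasure_map (μ := reprMeasure n p W) hZm.aemeasurable
  set c : Fin n → ℝ := fun _ => √(k : ℝ) / (2 * n) with hc
  set d := gaussCoeff n k with hd
  have hζm : Measurable fun t : ℝ => t ^ 2 - 1 := by fun_prop
  have hVm := measurable_linPart p
  have hca : ∀ i, |c i| ≤ (2 * √(k : ℝ))⁻¹ := by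
    intro i
    rw [abs_of_nonneg (by positivity)]
    simp only [hc]
    rw [inv_eq_one_div, div_le_div_iff₀ (by positivity) (by positivity)]
    nlinarith
  have hc2 : ∑ i, c i ^ 2 = k / n / 4 := by
    simp only [hc, Finset.sum_const, Finset.card_univ, Fintype.card_fin, nsmul_eq_mul, div_pow,
      hsk2]
    field_simp
    norm_num
  have hda : ∀ i, |d i| ≤ (2 * √(k : ℝ))⁻¹ := abs_gaussCoeff_le hk hkn
  have hd2 : ∑ i, d i ^ 2 = (1 - k / n) / 4 := sum_gaussCoeff_sq hk hkn
  have hi0 : 0 ≤ (2 * √(k : ℝ))⁻¹ := by positivity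
  have hc3 := sum_pow_three_le c hca (b := 1 / 4) (by rw [hc2]; linarith) hi0
  have hd3 := sum_pow_three_le d hda (b := 1 / 4) (by rw [hd2]; linarith) hi0
  have hsq : ∀ y : ℝ, |y| ≤ (2 * √(k : ℝ))⁻¹ → y ^ 2 ≤ 1 / (4 * k) := by
    intro y hy
    calc y ^ 2 = |y| ^ 2 := (sq_abs y).symm
      _ ≤ (2 * √(k : ℝ))⁻¹ ^ 2 := by gcongr
      _ = 1 / (4 * k) := by rw [inv_pow, mul_pow, hsk2]; norm_num
  have mc := fun i => moments_map_const_mul hVm hV3 (c i)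
  have md := fun i => moments_map_const_mul hζm hζ3 (d i)
  set ν : Fin n ⊕ Fin n → Measure ℝ := Sum.elim
    (fun i => (pGauss p).map fun t => c i * linPart p t)
    (fun i => (gaussianReal 0 1).map fun t => d i * (t ^ 2 - 1)) with hν
  have hprob : ∀ i, IsProbabilityMeasure (ν i) := by
    rintro (i | i)
    · exact Measure.isProbabilityMeasure_map (hVm.const_mul _).aemeasurable
    · exact Measure.isProbabilityMeasure_map (hζm.const_mul _).aemeasurable
  have hsum2 : ∑ i, ∫ x, x ^ 2 ∂(ν i) = limitVariance p (k / n) := by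
    rw [Fintype.sum_sum_type]
    simp only [hν, Sum.elim_inl, Sum.elim_inr]
    simp_rw [fun i => (mc i).2.2.1, fun i => (md i).2.2.1]
    rw [← Finset.sum_mul, ← Finset.sum_mul, hc2, hd2, hVs, integral_sq_sub_one_sq_gaussian,
      limitVariance_eq]
    ring
  have hupper : limitVariance p (k / n) ≤ K := by
    rw [limitVariance_eq, ← hs]
    have : (k : ℝ) / n * s ≤ 1 * s := by gcongr
    linarith
  have main := hBE k hk2' (Fin n ⊕ Fin n) ((reprMeasure n p W).map (linLength n k p)) ν
    (fun t => by
      rw [Fintype.prod_sum_type]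
      exact charFun_map_reprMeasure hp W (fun i => hVm.const_mul (c i))
        (fun i => hζm.const_mul (d i)) t)
    (by
      rintro (i | i)
      · exact (mc i).1
      · exact (md i).1)
    (by
      rintro (i | i)
      · exact (mc i).2.1.trans (by rw [integral_linPart hp, mul_zero])
      · exact (md i).2.1.trans (by rw [integral_sq_sub_one_gaussian, mul_zero]))
    (by
      rintro (i | i)
      · refine (mc i).2.2.1.trans_le ?_
        rw [hVs]
        calc c i ^ 2 * (4 * s) ≤ 1 / (4 * k) * (4 * s) := by gcongr; exact hsq _ (hca i)
          _ = s / k := by field_simp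
          _ ≤ K / k := by gcongr; linarith
      · refine (md i).2.2.1.trans_le ?_
        rw [integral_sq_sub_one_sq_gaussian]
        calc d i ^ 2 * 2 ≤ 1 / (4 * k) * 2 := by gcongr; exact hsq _ (hda i)
          _ = (1 / 2) / k := by field_simp; norm_num
          _ ≤ K / k := by gcongr; linarith)
    (by
      rw [Fintype.sum_sum_type]
      simp only [hν, Sum.elim_inl, Sum.elim_inr]
      simp_rw [fun i => (mc i).2.2.2, fun i => (md i).2.2.2]
      rw [← Finset.sum_mul, ← Finset.sum_mul, ← hM, ← hM']
      calc _ ≤ (2 * √(k : ℝ))⁻¹ * (1 / 4) * M + (2 * √(k : ℝ))⁻¹ * (1 / 4) * M' := by gcongr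
        _ = ((M + M') / 8) / √(k : ℝ) := by field_simp; ring
        _ ≤ K / √(k : ℝ) := by gcongr; linarith)
    (by rw [hsum2]; exact hKδ.trans hvar) (by rw [hsum2]; exact hupper) v (hKδ.trans hv)
  rwa [hsum2] at main

/-! ### The rate of convergence -/

theorem half_le_log {k : ℕ} (hk : 2 ≤ k) : 1 / 2 ≤ Real.log k := by
  have h : (2 : ℝ) ≤ k := by exact_mod_cast hk
  have := Real.log_le_log (by norm_num) h
  linarith [Real.log_two_gt_d9]

/-- Averages over all `n` coordinates come with `n` in place of `k`. From `log n = log k + log (n/k)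
≤ log k + n/k` and `1 ≤ 2 log k` they are still controlled at scale `k`. The next estimate applies
the same device to `√n / √k`. -/
theorem log_div_self_le {n k : ℕ} (hk : 2 ≤ k) (hkn : k ≤ n) :
    Real.log n / n ≤ 3 * (Real.log k / k) := by
  have hk0 : (0 : ℝ) < k := by exact_mod_cast (by omega : 0 < k)
  have hkn' : (k : ℝ) ≤ n := by exact_mod_cast hkn
  have hn0 : (0 : ℝ) < n := by linarith
  have hl := half_le_log hk
  have h1 : Real.log n = Real.log k + Real.log (n / k) := by
    rw [Real.log_div hn0.ne' hk0.ne']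
    ring
  have h2 : Real.log (n / k) ≤ n / k := Real.log_le_self (by positivity)
  calc Real.log n / n ≤ (Real.log k + n / k) / n := by gcongr; linarith
    _ = Real.log k / n + 1 / k := by field_simp
    _ ≤ Real.log k / k + 2 * Real.log k / k := by gcongr; linarith
    _ = _ := by ring

theorem log_div_sqrt_le {n k : ℕ} (hk : 2 ≤ k) (hkn : k ≤ n) :
    Real.log n / √n ≤ 5 * (Real.log k / √k) := by
  have hk0 : (0 : ℝ) < k := by exact_mod_cast (by omega : 0 < k)
  have hkn' : (k : ℝ) ≤ n := by exact_mod_cast hkn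
  have hn0 : (0 : ℝ) < n := by linarith
  have hl := half_le_log hk
  have hsk := Real.sqrt_pos.2 hk0
  have hsn := Real.sqrt_pos.2 hn0
  have h1 : Real.log n = Real.log k + 2 * Real.log (√n / √k) := by
    rw [Real.log_div hsn.ne' hsk.ne', Real.log_sqrt hn0.le, Real.log_sqrt hk0.le]
    ring
  have h2 : Real.log (√n / √k) ≤ √n / √k := Real.log_le_self (by positivity)
  calc Real.log n / √n ≤ (Real.log k + 2 * (√n / √k)) / √n := by gcongr; linarith
    _ = Real.log k / √n + 2 / √k := by field_simp
    _ ≤ Real.log k / √k + 4 * Real.log k / √k := by gcongr; linarith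
    _ = _ := by ring

theorem abs_cdf_sub_cdf_le_one (μ ν : Measure ℝ) (x : ℝ) : |cdf μ x - cdf ν x| ≤ 1 := by
  have h1 := cdf_nonneg μ x
  have h2 := cdf_le_one μ x
  have h3 := cdf_nonneg ν x
  have h4 := cdf_le_one ν x
  rw [abs_le]
  constructor <;> linarith

theorem reprMeasure_real_preimage_pGauss {n : ℕ} {p : ℝ} (hp : 0 < p) (W : Measure ℝ≥0)
    [IsProbabilityMeasure W] {s : Set (Fin n → ℝ)} (hs : MeasurableSet s) :
    (reprMeasure n p W).real {z | z.1.1 ∈ s} = (Measure.pi fun _ : Fin n => pGauss p).real s := by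
  have := isProbabilityMeasure_pGauss hp
  have h := (measurePreserving_fst (μ := Measure.pi fun _ : Fin n => pGauss p) (ν := W)).comp
    (measurePreserving_fst (μ := (Measure.pi fun _ : Fin n => pGauss p).prod W)
      (ν := Measure.pi fun _ : Fin n => gaussianReal 0 1))
  exact h.measureReal_preimage hs.nullMeasurableSet

theorem reprMeasure_real_preimage_gaussian {n : ℕ} {p : ℝ} (hp : 0 < p) (W : Measure ℝ≥0)
    [IsProbabilityMeasure W] {s : Set (Fin n → ℝ)} (hs : MeasurableSet s) :
    (reprMeasure n p W).real {z | z.2 ∈ s} =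
      (Measure.pi fun _ : Fin n => gaussianReal 0 1).real s := by
  have := isProbabilityMeasure_pGauss hp
  have h := measurePreserving_snd (μ := (Measure.pi fun _ : Fin n => pGauss p).prod W)
      (ν := Measure.pi fun _ : Fin n => gaussianReal 0 1)
  exact h.measureReal_preimage hs.nullMeasurableSet

theorem reprMeasure_real_preimage_weight {n : ℕ} {p : ℝ} (hp : 0 < p) (W : Measure ℝ≥0)
    [IsProbabilityMeasure W] {s : Set ℝ≥0} (hs : MeasurableSet s) :
    (reprMeasure n p W).real {z | z.1.2 ∈ s} = W.real s := by
  have := isProbabilityMeasure_pGauss hp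
  have h := (measurePreserving_snd (μ := Measure.pi fun _ : Fin n => pGauss p) (ν := W)).comp
    (measurePreserving_fst (μ := (Measure.pi fun _ : Fin n => pGauss p).prod W)
      (ν := Measure.pi fun _ : Fin n => gaussianReal 0 1))
  exact h.measureReal_preimage hs.nullMeasurableSet

theorem measurableSet_tail {n k : ℕ} {f : ℝ → ℝ} (hf : Measurable f) (ε : ℝ) :
    MeasurableSet {x : Fin n → ℝ | ε < |(∑ i : Fin n, if (i : ℕ) < k then f (x i) else 0) / k|} := by
  have h : Measurable fun x : Fin n → ℝ => ∑ i : Fin n, if (i : ℕ) < k then f (x i) else 0 := by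
    refine Finset.measurable_sum _ fun i _ => ?_
    split_ifs
    · exact hf.comp (measurable_pi_apply i)
    · fun_prop
  have h2 : Measurable fun x : Fin n → ℝ =>
    |(∑ i : Fin n, if (i : ℕ) < k then f (x i) else 0) / k| := (h.div_const _).abs
  exact measurableSet_lt measurable_const h2

theorem linLength_eq {n k : ℕ} {p : ℝ}
    (z : ((Fin n → ℝ) × ℝ≥0) × (Fin n → ℝ)) :
    linLength n k p z = √(k : ℝ) * (1 / 2 * ((∑ i, sqPart p (z.1.1 i)) / n -
      2 / p * ((∑ i, powPart p (z.1.1 i)) / n) +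
      (∑ i : Fin n, if (i : ℕ) < k then z.2 i ^ 2 - 1 else 0) / k -
      (∑ i, (z.2 i ^ 2 - 1)) / n)) := by
  have e : ∀ i, gaussCoeff n k i * (z.2 i ^ 2 - 1) = √(k : ℝ) / 2 *
      ((k : ℝ)⁻¹ * (if (i : ℕ) < k then z.2 i ^ 2 - 1 else 0) - (n : ℝ)⁻¹ * (z.2 i ^ 2 - 1)) := by
    intro i
    rw [gaussCoeff]
    split_ifs <;> ring
  rw [linLength]
  simp_rw [e]
  simp only [linPart, ← Finset.mul_sum, Finset.sum_sub_distrib]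
  ring

theorem abs_reprLength_sub_linLength_le {n k : ℕ} (hn : n ≠ 0) (hk : k ≠ 0) (hkn : k ≤ n) {p : ℝ}
    (hp : 1 ≤ p) {a ε : ℝ} (hε : 0 ≤ ε) (hε8 : ε ≤ 1 / 8) (haε : a * ε ≤ 1)
    {z : ((Fin n → ℝ) × ℝ≥0) × (Fin n → ℝ)}
    (h₁ : |(∑ i, sqPart p (z.1.1 i)) / n| ≤ ε) (h₂ : |(∑ i, powPart p (z.1.1 i)) / n| ≤ ε)
    (h₃ : |(∑ i : Fin n, if (i : ℕ) < k then z.2 i ^ 2 - 1 else 0) / (k : ℝ)| ≤ ε)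
    (h₄ : |(∑ i, (z.2 i ^ 2 - 1)) / (n : ℝ)| ≤ ε) (hω : p * z.1.2 / n ≤ a * ε ^ 2) :
    |reprLength n k p z - linLength n k p z| ≤ √(k : ℝ) * ((36 + a) * ε ^ 2) := by
  have hp0 : 0 < p := by linarith
  have hω0 : 0 ≤ p * z.1.2 / n := by
    have := z.1.2.2
    positivity
  rw [reprLength_eq hn hk hkn hp0, linLength_eq, ← mul_sub, abs_mul,
    abs_of_nonneg (Real.sqrt_nonneg _)]
  refine mul_le_mul_of_nonneg_left ?_ (Real.sqrt_nonneg _)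
  have := abs_linearization_le hp hε hε8 haε (x₁ := 1 + (∑ i, sqPart p (z.1.1 i)) / n)
    (x₂ := 1 + (∑ i, powPart p (z.1.1 i)) / n)
    (x₃ := 1 + (∑ i : Fin n, if (i : ℕ) < k then z.2 i ^ 2 - 1 else 0) / k)
    (x₄ := 1 + (∑ i, (z.2 i ^ 2 - 1)) / n) (by rwa [add_sub_cancel_left])
    (by rwa [add_sub_cancel_left]) (by rwa [add_sub_cancel_left]) (by rwa [add_sub_cancel_left])
    hω0 hω
  simpa only [add_sub_cancel_left] using this

/-- The exceptional set is the union of four moderate-deviation events, one for each average in the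
representation, and of the event that the variable with law `W` is large. -/
theorem exists_tail_bound {p : ℝ} (hp : 0 < p) :
    ∃ A C : ℝ, 1 ≤ A ∧ 0 < C ∧ ∀ (n k : ℕ), 2 ≤ k → k ≤ n → ∀ (W : Measure ℝ≥0)
      [IsProbabilityMeasure W] (ε b : ℝ), ε = A * √(Real.log k / k) →
      ∃ B : Set (((Fin n → ℝ) × ℝ≥0) × (Fin n → ℝ)),
        (reprMeasure n p W).real B ≤ C * (Real.log k / √k) + W.real {s | b < (s : ℝ)} ∧
        ∀ z ∉ B, |(∑ i, sqPart p (z.1.1 i)) / n| ≤ ε ∧ |(∑ i, powPart p (z.1.1 i)) / n| ≤ ε ∧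
          |(∑ i : Fin n, if (i : ℕ) < k then z.2 i ^ 2 - 1 else 0) / (k : ℝ)| ≤ ε ∧
          |(∑ i, (z.2 i ^ 2 - 1)) / (n : ℝ)| ≤ ε ∧ (z.1.2 : ℝ) ≤ b := by
  have := isProbabilityMeasure_pGauss hp
  have hζm : Measurable fun t : ℝ => t ^ 2 - 1 := by fun_prop
  obtain ⟨C₁, hC₁, htail₁⟩ := exists_tail_average_le (pGauss p) (measurable_sqPart p)
    (integrable_abs_pow_three_of_memLp (memLp_sqPart hp 3)) (integral_sqPart hp)
    (integral_sqPart_sq_pos hp)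
  obtain ⟨C₂, hC₂, htail₂⟩ := exists_tail_average_le (pGauss p) (measurable_powPart p)
    (integrable_abs_pow_three_of_memLp (memLp_powPart hp 3)) (integral_powPart hp)
    (integral_powPart_sq_pos hp)
  obtain ⟨C₃, hC₃, htail₃⟩ := exists_tail_average_le (gaussianReal 0 1) hζm
    (integrable_abs_pow_three_of_memLp (memLp_sq_sub_one_gaussian 3)) integral_sq_sub_one_gaussian
    (by rw [integral_sq_sub_one_sq_gaussian]; norm_num)
  -- The 2 and the 5 are the costs of passing from scale `n` to scale `k`; the Gaussian squares
  -- enter at both scales, hence `6 = 5 + 1`.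
  refine ⟨1 + 2 * (C₁ + C₂ + C₃), 5 * C₁ + 5 * C₂ + 6 * C₃, by linarith, by positivity, ?_⟩
  intro n k hk2 hkn W _ ε b hε
  have hn2 : 2 ≤ n := hk2.trans hkn
  have hl := half_le_log hk2
  have hlogn : √(Real.log n / n) ≤ 2 * √(Real.log k / k) := by
    rw [Real.sqrt_le_left (by positivity), mul_pow, Real.sq_sqrt (by positivity)]
    have := log_div_self_le hk2 hkn
    have : 0 ≤ Real.log k / k := by positivity
    linarith
  have hlogn' := log_div_sqrt_le hk2 hkn
  have hAr : ∀ c : ℝ, 0 ≤ c → c ≤ C₁ + C₂ + C₃ → c * √(Real.log n / n) ≤ ε := by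
    intro c hc0 hcA
    calc c * √(Real.log n / n) ≤ c * (2 * √(Real.log k / k)) := by gcongr
      _ = (2 * c) * √(Real.log k / k) := by ring
      _ ≤ ε := by rw [hε]; gcongr; linarith
  have t₁ := htail₁ n n hn2 le_rfl ε (hAr C₁ hC₁.le (by linarith))
  have t₂ := htail₂ n n hn2 le_rfl ε (hAr C₂ hC₂.le (by linarith))
  have t₃ := htail₃ n k hk2 hkn ε (by rw [hε]; gcongr; linarith)
  have t₄ := htail₃ n n hn2 le_rfl ε (hAr C₃ hC₃.le (by linarith))
  rw [← reprMeasure_real_preimage_pGauss hp W (measurableSet_tail (measurable_sqPart p) ε)] at t₁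
  rw [← reprMeasure_real_preimage_pGauss hp W (measurableSet_tail (measurable_powPart p) ε)] at t₂
  rw [← reprMeasure_real_preimage_gaussian hp W (measurableSet_tail hζm ε)] at t₃ t₄
  have t₅ := reprMeasure_real_preimage_weight (n := n) hp W (s := {s | b < (s : ℝ)})
    (measurableSet_lt measurable_const measurable_coe_nnreal_real)
  simp only [Set.mem_ofPred_eq, Fin.is_lt, if_true] at t₁ t₂ t₃ t₄ t₅
  refine ⟨_ ∪ (_ ∪ (_ ∪ (_ ∪ _))), ((measureReal_union_le _ _).trans (add_le_add t₁
    ((measureReal_union_le _ _).trans (add_le_add t₂ ((measureReal_union_le _ _).trans (add_le_add t₃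
    ((measureReal_union_le _ _).trans (add_le_add t₄ t₅.le)))))))).trans ?_, ?_⟩
  · have m₁ := mul_le_mul_of_nonneg_left hlogn' hC₁.le
    have m₂ := mul_le_mul_of_nonneg_left hlogn' hC₂.le
    have m₃ := mul_le_mul_of_nonneg_left hlogn' hC₃.le
    linarith
  · intro z hz
    simp only [Set.mem_union, not_or] at hz
    obtain ⟨z₁, z₂, z₃, z₄, z₅⟩ := hz
    exact ⟨not_lt.1 z₁, not_lt.1 z₂, not_lt.1 z₃, not_lt.1 z₄, not_lt.1 z₅⟩

/-- Off the exceptional set the length differs from its linearization by at most `√k (36 + p²) ε²`,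
which is a multiple of `log k / √k`; the normal approximation of the linear part is then
transferred. -/
theorem exists_abs_cdf_reprLength_sub_le {p : ℝ} (hp : 1 ≤ p) {δ : ℝ} (hδ : 0 < δ) :
    ∃ C : ℝ, 0 < C ∧ ∀ (n k : ℕ), 2 ≤ k → k ≤ n → ∀ (W : Measure ℝ≥0) [IsProbabilityMeasure W]
      (v : ℝ≥0), δ ≤ v → δ ≤ limitVariance p (k / n) → ∀ x,
        |cdf ((reprMeasure n p W).map (reprLength n k p)) x - cdf (gaussianReal 0 v) x| ≤
          C * (Real.log k / √k + |v - limitVariance p (k / n)|) +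
            W.real {s | p * n * Real.log k / k < (s : ℝ)} := by
  have hp0 : 0 < p := by linarith
  have := isProbabilityMeasure_pGauss hp0
  obtain ⟨C₀, hC₀, hclt⟩ := exists_abs_cdf_linLength_sub_le hp0 hδ
  obtain ⟨A, C₁, hA1, hC₁, htail⟩ := exists_tail_bound hp0
  have hA0 : 0 < A := by linarith
  set D : ℝ := C₀ + C₁ + (√δ)⁻¹ * ((36 + p ^ 2) * A ^ 2) +
    2 * A * (8 + p ^ 2) with hD
  have hsδ : 0 < √δ := Real.sqrt_pos.2 hδ
  refine ⟨D, by positivity, ?_⟩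
  intro n k hk2 hkn W _ v hv hvar x
  have hk : k ≠ 0 := by omega
  have hn : n ≠ 0 := by omega
  have hk0 : (0 : ℝ) < k := by exact_mod_cast (by omega : 0 < k)
  have hn0 : (0 : ℝ) < n := by exact_mod_cast (by omega : 0 < n)
  have hl := half_le_log hk2
  set R := Real.log k / √(k : ℝ) with hR
  set r := √(Real.log k / k) with hr
  have hr0 : 0 ≤ r := Real.sqrt_nonneg _
  have hr2 : r ^ 2 = Real.log k / k := Real.sq_sqrt (by positivity)
  have hsk := Real.sqrt_pos.2 hk0
  have hR0 : 0 ≤ R := by positivity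
  have hRr : √(k : ℝ) * r ^ 2 = R := by
    rw [hr2, hR, mul_div_assoc', div_eq_div_iff hk0.ne' hsk.ne', mul_right_comm,
      Real.mul_self_sqrt hk0.le, mul_comm]
  have hrR : r ≤ 2 * R := by
    have h1 : R = r * √(Real.log k) := by
      rw [hr, hR, Real.sqrt_div (by linarith)]
      nth_rw 1 [← Real.sq_sqrt (show 0 ≤ Real.log k by linarith)]
      ring
    have h2 : 1 / 2 ≤ √(Real.log k) := by
      rw [Real.le_sqrt (by norm_num) (by linarith)]
      linarith
    rw [h1]
    nlinarith
  set Δ := |(v : ℝ) - limitVariance p (k / n)| with hΔ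
  have hΔ0 : 0 ≤ Δ := abs_nonneg _
  set w := W.real {s | p * n * Real.log k / k < (s : ℝ)} with hw
  have hw0 : 0 ≤ w := measureReal_nonneg
  set ε := A * r with hε
  have hε0 : 0 ≤ ε := by positivity
  -- If `ε` is too large for the linearization, then `log k / √k` is bounded below in terms of `p`
  -- and `A`, and the trivial bound 1 suffices.
  by_cases hsmall : ε * (8 + p ^ 2) ≤ 1
  swap
  · have h1 : 1 ≤ D * R := by
      calc (1 : ℝ) ≤ ε * (8 + p ^ 2) := (not_le.1 hsmall).le
        _ ≤ A * (2 * R) * (8 + p ^ 2) := by rw [hε]; gcongr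
        _ = (2 * A * (8 + p ^ 2)) * R := by ring
        _ ≤ D * R := by
          gcongr
          rw [hD]
          have : 0 ≤ C₀ + C₁ + (√δ)⁻¹ * ((36 + p ^ 2) * A ^ 2) := by
            positivity
          linarith
    have h2 : 0 ≤ D * Δ := by positivity
    refine (abs_cdf_sub_cdf_le_one _ _ x).trans ?_
    rw [mul_add]
    linarith
  have hεp : 0 ≤ p ^ 2 * ε := by positivity
  have hsplit : ε * (8 + p ^ 2) = 8 * ε + p ^ 2 * ε := by ring
  have hε8 : ε ≤ 1 / 8 := by linarith
  have haε : p ^ 2 * ε ≤ 1 := by linarith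
  have hQ := isProbabilityMeasure_reprMeasure n hp0 W
  obtain ⟨B, hBle, hBz⟩ := htail n k hk2 hkn W ε (p * n * Real.log k / k) hε
  have hclose : ∀ z ∉ B, |reprLength n k p z - linLength n k p z| ≤
      (36 + p ^ 2) * A ^ 2 * R := by
    intro z hz
    obtain ⟨z₁, z₂, z₃, z₄, z₅⟩ := hBz z hz
    -- The cut-off `p n log k / k` for `w` is the one that makes its effect second order, with `a =
    -- p²`.
    have hω : p * z.1.2 / n ≤ p ^ 2 * ε ^ 2 := by
      calc p * z.1.2 / n ≤ p * (p * n * Real.log k / k) / n := by gcongr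
        _ = p ^ 2 * r ^ 2 := by rw [hr2]; field_simp
        _ ≤ p ^ 2 * ε ^ 2 := by
          gcongr
          exact le_mul_of_one_le_left hr0 hA1
    refine (abs_reprLength_sub_linLength_le hn hk hkn hp hε0 hε8 haε z₁ z₂ z₃ z₄ hω).trans_eq ?_
    rw [← hRr, hε]
    ring
  have hv0 : (0 : ℝ) < v := by linarith
  have hv0' : v ≠ 0 := by
    rintro rfl
    simp at hv0
  have main := abs_cdf_map_sub_le_of_close (reprMeasure n p W) (measurable_reprLength n k p)
    (measurable_linLength n k p) (by positivity) hclose hv0' (hclt n k hk2 hkn W v hv hvar) x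
  have hsv : (√(2 * Real.pi * v))⁻¹ ≤ (√δ)⁻¹ := by
    gcongr
    nlinarith [Real.pi_gt_three]
  have h6 : (√(2 * Real.pi * v))⁻¹ * ((36 + p ^ 2) * A ^ 2 * R) ≤
      (√δ)⁻¹ * ((36 + p ^ 2) * A ^ 2 * R) := by gcongr
  refine main.trans ?_
  calc C₀ * (R + Δ) + (reprMeasure n p W).real B +
        (√(2 * Real.pi * v))⁻¹ * ((36 + p ^ 2) * A ^ 2 * R)
      ≤ C₀ * (R + Δ) + (C₁ * R + w) + (√δ)⁻¹ * ((36 + p ^ 2) * A ^ 2 * R) := by gcongr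
    _ ≤ C₀ * (R + Δ) + (C₁ * R + w) + (√δ)⁻¹ * ((36 + p ^ 2) * A ^ 2 * R) +
        (2 * A * (8 + p ^ 2) * R +
          (C₁ + (√δ)⁻¹ * ((36 + p ^ 2) * A ^ 2) + 2 * A * (8 + p ^ 2)) * Δ) :=
      le_add_of_nonneg_right (by positivity)
    _ = D * (R + Δ) + w := by
      rw [hD]
      ring

/-- The rate of convergence. -/
def rate (n k : ℕ) (l : ℝ) : ℝ :=
  max (Real.log k / √(k : ℝ)) (max ((n : ℝ) / (k : ℝ) ^ (3 / 2 : ℝ)) |(k : ℝ) / n - l|)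

theorem exists_cdf_sub_le_rate {p : ℝ} (hp : 1 ≤ p) {δ : ℝ} (hδ : 0 < δ) :
    ∃ C : ℝ, 1 ≤ C ∧ ∀ (n k : ℕ) (l : ℝ), 2 ≤ n → 1 ≤ k → k ≤ n → δ ≤ limitVariance p l →
      δ ≤ limitVariance p (k / n) → ∀ (W : Measure ℝ≥0) [IsProbabilityMeasure W] (x : ℝ),
        |cdf ((reprMeasure n p W).map (reprLength n k p)) x -
          cdf (gaussianReal 0 (limitVariance p l).toNNReal) x| ≤
          C * rate n k l + W.real {s | p * n * Real.log k / k < (s : ℝ)} := by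
  obtain ⟨C, hC, hb⟩ := exists_abs_cdf_reprLength_sub_le hp hδ
  set M := |limitVariance p 1 - 1 / 2| with hM
  have hM0 : 0 ≤ M := abs_nonneg _
  have hCM : 0 ≤ C * (1 + M) := by positivity
  refine ⟨1 + C * (1 + M), by linarith, ?_⟩
  intro n k l hn2 hk1 hkn hl hkl W _ x
  -- For `k = 1` the logarithmic term vanishes, but `n / k ^ (3/2) = n ≥ 1` makes the bound trivial.
  rcases hk1.eq_or_lt with rfl | hk2
  · have h1 : 1 ≤ rate n 1 l := by
      have : (1 : ℝ) ≤ n := by exact_mod_cast (by omega : 1 ≤ n)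
      refine le_max_of_le_right (le_max_of_le_left ?_)
      simpa using this
    refine (abs_cdf_sub_cdf_le_one _ _ x).trans ?_
    have h2 : 0 ≤ W.real {s | p * n * Real.log (1 : ℕ) / (1 : ℕ) < (s : ℝ)} := measureReal_nonneg
    nlinarith
  have hv : ((limitVariance p l).toNNReal : ℝ) = limitVariance p l :=
    Real.coe_toNNReal _ (by linarith)
  have main := hb n k hk2 hkn W (limitVariance p l).toNNReal (by rwa [hv]) hkl x
  have e : |((limitVariance p l).toNNReal : ℝ) - limitVariance p (k / n)| =
      M * |(k : ℝ) / n - l| := by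
    rw [hv, limitVariance_eq p l, limitVariance_eq p (k / n), hM, ← abs_mul, ← abs_neg]
    congr 1
    ring
  have h1 : Real.log k / √(k : ℝ) ≤ rate n k l := le_max_left _ _
  have h2 : |(k : ℝ) / n - l| ≤ rate n k l := (le_max_right _ _).trans (le_max_right _ _)
  have h0 : 0 ≤ rate n k l := (abs_nonneg _).trans h2
  rw [e] at main
  refine main.trans (add_le_add_left ?_ _)
  calc C * (Real.log k / √(k : ℝ) + M * |(k : ℝ) / n - l|)
      ≤ C * (rate n k l + M * rate n k l) := by gcongr
    _ = C * (1 + M) * rate n k l := by ring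
    _ ≤ (1 + C * (1 + M)) * rate n k l := by gcongr; linarith

/-- Being affine, the variance is at least the minimum of its values at 0 and 1 throughout `[0, 1]`.
This lower bound depends on `p` only, hence so does the constant. -/
theorem exists_cdf_sub_le_rate_of_ne_two {p : ℝ} (hp : 1 ≤ p) (hp2 : p ≠ 2) :
    ∃ C : ℝ, 0 < C ∧ ∀ (n k : ℕ) (l : ℝ), 2 ≤ n → 1 ≤ k → k ≤ n → 0 ≤ l → l ≤ 1 →
      ∀ (W : Measure ℝ≥0) [IsProbabilityMeasure W] (x : ℝ),
        |cdf ((reprMeasure n p W).map (reprLength n k p)) x -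
          cdf (gaussianReal 0 (limitVariance p l).toNNReal) x| ≤
          C * rate n k l + W.real {s | p * n * Real.log k / k < (s : ℝ)} := by
  have hs : 0 < limitVariance p 1 := limitVariance_one_pos (by linarith) hp2
  set δ := min (limitVariance p 1) (1 / 2) with hδ
  have hδ0 : 0 < δ := lt_min hs (by norm_num)
  have hδ1 : δ ≤ limitVariance p 1 := min_le_left _ _
  have hδ2 : δ ≤ 1 / 2 := min_le_right _ _
  have hle : ∀ y : ℝ, 0 ≤ y → y ≤ 1 → δ ≤ limitVariance p y := by
    intro y h0 h1
    rw [limitVariance_eq]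
    nlinarith
  obtain ⟨C, hC, hb⟩ := exists_cdf_sub_le_rate hp hδ0
  refine ⟨C, by linarith, ?_⟩
  intro n k l hn2 hk1 hkn h0 h1 W _ x
  have hkn' : (k : ℝ) ≤ n := by exact_mod_cast hkn
  exact hb n k l hn2 hk1 hkn (hle l h0 h1)
    (hle _ (by positivity) (div_le_one_of_le₀ hkn' (by positivity))) W x

theorem exists_cdf_sub_le_rate_two {l : ℝ} (hl : l < 1) :
    ∃ C : ℝ, 0 < C ∧ ∀ (n k : ℕ), 2 ≤ n → 1 ≤ k → k ≤ n →
      ∀ (W : Measure ℝ≥0) [IsProbabilityMeasure W] (x : ℝ),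
        |cdf ((reprMeasure n 2 W).map (reprLength n k 2)) x -
          cdf (gaussianReal 0 (limitVariance 2 l).toNNReal) x| ≤
          C * rate n k l + W.real {s | 2 * n * Real.log k / k < (s : ℝ)} := by
  have hδ : 0 < (1 - l) / 4 := by linarith
  obtain ⟨C, hC, hb⟩ := exists_cdf_sub_le_rate (p := 2) (by norm_num) hδ
  have hl' : 0 < 1 - l := by linarith
  have hl2 : 0 < 2 / (1 - l) := by positivity
  refine ⟨C + 2 / (1 - l), by linarith, ?_⟩
  intro n k hn2 hk1 hkn W _ x
  have h2 : |(k : ℝ) / n - l| ≤ rate n k l := (le_max_right _ _).trans (le_max_right _ _)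
  have h0 : 0 ≤ rate n k l := (abs_nonneg _).trans h2
  have hw : 0 ≤ W.real {s | 2 * n * Real.log k / k < (s : ℝ)} := measureReal_nonneg
  -- For `p = 2` the variance at `k/n` is `(1 - k/n) / 2`, which is small when `k/n` is near 1. In
  -- that case `|k/n - l|` is bounded below and the estimate is trivial; otherwise `1 - k/n > (1 -
  -- l)/2`, and the variance is at least `(1 - l)/4`.
  by_cases hfar : (1 - l) / 2 ≤ |(k : ℝ) / n - l|
  · have h3 : 1 ≤ 2 / (1 - l) * rate n k l := by
      calc (1 : ℝ) = 2 / (1 - l) * ((1 - l) / 2) := by field_simp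
        _ ≤ 2 / (1 - l) * rate n k l := by gcongr; exact hfar.trans h2
    have h4 : 0 ≤ C * rate n k l := by positivity
    refine (abs_cdf_sub_cdf_le_one _ _ x).trans ?_
    rw [add_mul]
    linarith
  · have h5 := (abs_lt.1 (not_le.1 hfar)).2
    refine (hb n k l hn2 hk1 hkn (by rw [limitVariance_two]; linarith)
      (by rw [limitVariance_two]; linarith) W x).trans ?_
    gcongr
    linarith

theorem exists_constant {p : ℝ} (hp : 1 ≤ p) :
    ∃ C : ℝ → ℝ, (∀ l, 0 < C l) ∧ (p ≠ 2 → ∀ l l', C l = C l') ∧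
      ∀ (n k : ℕ) (l : ℝ), 2 ≤ n → 1 ≤ k → k ≤ n → 0 ≤ l → l ≤ 1 → (p = 2 → l < 1) →
        ∀ (W : Measure ℝ≥0) [IsProbabilityMeasure W] (x : ℝ),
          |cdf ((reprMeasure n p W).map (reprLength n k p)) x -
            cdf (gaussianReal 0 (limitVariance p l).toNNReal) x| ≤
            C l * rate n k l + W.real {s | p * n * Real.log k / k < (s : ℝ)} := by
  by_cases hp2 : p = 2
  · subst hp2
    have h : ∀ l : ℝ, ∃ C : ℝ, 0 < C ∧ (l < 1 → ∀ (n k : ℕ), 2 ≤ n → 1 ≤ k → k ≤ n →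
        ∀ (W : Measure ℝ≥0) [IsProbabilityMeasure W] (x : ℝ),
          |cdf ((reprMeasure n 2 W).map (reprLength n k 2)) x -
            cdf (gaussianReal 0 (limitVariance 2 l).toNNReal) x| ≤
            C * rate n k l + W.real {s | 2 * n * Real.log k / k < (s : ℝ)}) := by
      intro l
      by_cases hl : l < 1
      · obtain ⟨C, hC, hb⟩ := exists_cdf_sub_le_rate_two hl
        exact ⟨C, hC, fun _ => hb⟩
      -- An arbitrary positive value where nothing is claimed.
      · exact ⟨1, one_pos, fun h => absurd h hl⟩
    choose C hC hb using h
    exact ⟨C, hC, fun h => absurd rfl h, fun n k l hn hk hkn _ _ hl W _ x =>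
      hb l (hl rfl) n k hn hk hkn W x⟩
  · obtain ⟨C, hC, hb⟩ := exists_cdf_sub_le_rate_of_ne_two hp hp2
    exact ⟨fun _ => C, fun _ => hC, fun _ _ _ => rfl, fun n k l hn hk hkn h0 h1 _ W _ x =>
      hb n k l hn hk hkn h0 h1 W x⟩

end LpProjection

end

/-! ### The uniform bound for the normalized length of the projection -/

theorem theorem2 :
    ∃ α : ℝ, 0 < α ∧ ∀ p : ℝ, 1 ≤ p →
      ∃ C : ℝ → ℝ, (∀ l, 0 < C l) ∧ (p ≠ 2 → ∀ l l', C l = C l') ∧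
        ∀ (W : Measure ℝ≥0) [IsProbabilityMeasure W]
          (l : ℝ), 0 ≤ l → l ≤ 1 → (p = 2 → l < 1) →
        ∀ (k : ℕ → ℕ) (hk : ∀ n, k n ≤ n), (∀ n, 1 ≤ n → 1 ≤ k n) →
          Tendsto k atTop atTop →
          Tendsto (fun n : ℕ => (k n : ℝ) / n) atTop (𝓝 l) →
          Tendsto (fun n : ℕ => (k n : ℝ) / (n : ℝ) ^ (2 / 3 : ℝ)) atTop atTop →
        ∀ (Ω : Type*) [MeasurableSpace Ω] (P : Measure Ω) [IsProbabilityMeasure P]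
          (X : ∀ n : ℕ, Ω → EuclideanSpace ℝ (Fin n))
          (E : ∀ n : ℕ, Ω → LpProjection.Gr n (k n)),
          (∀ n, 1 ≤ n → HasLaw (X n) (LpProjection.ballMeasure n p W) P) →
          (∀ n, 1 ≤ n → HasLaw (E n) (LpProjection.haarGr (hk n)) P) →
          iIndepFun X P → iIndepFun E P → (∀ n, 1 ≤ n → IndepFun (X n) (E n) P) →
        ∀ n : ℕ, 2 ≤ n →
          (⨆ t : ℝ,
            |cdf (P.map fun ω => LpProjection.normalizedLength p (X n ω) (E n ω)) t
              - cdf (gaussianReal 0 (LpProjection.limitVariance p l).toNNReal) t|) ≤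
            C l * max (Real.log (k n) / √(k n : ℝ))
                (max ((n : ℝ) / (k n : ℝ) ^ (3 / 2 : ℝ)) |(k n : ℝ) / n - l|)
              + W.real {s | α * p * n * Real.log (k n) / k n < |(s : ℝ)|}
              + 2 * W.real {s | √((n : ℝ) ^ 2 * Real.log (k n) / k n) < |(s : ℝ)|} := by
  -- The cut-off `p n log k / k` used for `w` corresponds to `α = 1`.
  refine ⟨1, one_pos, fun p hp => ?_⟩
  obtain ⟨C, hC, hC2, hb⟩ := LpProjection.exists_constant hp
  refine ⟨C, hC, hC2, ?_⟩
  intro W _ l hl0 hl1 hl2 k hk hk1 _ _ _ Ω _ P _ X E hX hE _ _ hXE n hn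
  have hn1 : 1 ≤ n := by omega
  refine ciSup_le fun t => ?_
  rw [LpProjection.map_normalizedLength (by omega) (hk n) hp W (hX n hn1) (hE n hn1) (hXE n hn1)]
  have h := hb n (k n) l hn (hk1 n hn1) (hk n) hl0 hl1 hl2 W t
  have e : W.real {s | 1 * p * n * Real.log (k n) / k n < |(s : ℝ)|} =
      W.real {s | p * n * Real.log (k n) / k n < (s : ℝ)} := by
    simp only [one_mul, NNReal.abs_eq]
  -- The bound already holds without the second tail of `W`, which is nonnegative and is only added.
  have h0 : 0 ≤ 2 * W.real {s | √((n : ℝ) ^ 2 * Real.log (k n) / k n) < |(s : ℝ)|} := by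
    positivity
  rw [e]
  exact h.trans (le_add_of_nonneg_right h0)
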